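/- Consider one bosonic mode with Hilbert space $L^2(\mathbb{R})$ ($\hbar=1$). Operators $\hat\rho$ are written in position representation as $\rho(x,r)=\langle r-\tfrac x2|\hat\rho|r+\tfrac x2\rangle$, and a superoperator has kernel $J$ if $\rho_f(x_f,r_f)=\int J(x_f,r_f;x_i,r_i)\,\rho_i(x_i,r_i)\,dx_i\,dr_i$ in the sense of distributions. A \emph{Gaussian unitary channel} is a map $\hat\rho\mapsto U\hat\rho U^\dagger$, $U$ unitary on $L^2(\mathbb{R})$, that takes Gaussian states to Gaussian states. Write $S(\sigma,d)$ for the Gaussian operator with covariance matrix $\sigma$ and mean vector $d$. Let $$\Sigma=i\,(b_1x_fr_f+b_2x_fr_i+b_3x_ir_f+b_4x_ir_i+c_1x_f+c_2x_i)-a_1x_f^2-a_2x_fx_i-a_3x_i^2-e_1r_f^2-e_2r_fr_i-e_3r_i^2-d_1r_f-d_2r_i ,$$ and consider the following functional forms: - the Gaussian form $J_G=\frac{|b_3|}{2\pi}e^{\Sigma}$ with all $e_n=d_n=0$ and real coefficients; - the one-delta form $J_I=\mathcal N\,\delta(\vec\alpha^{T}\vec v_f-\vec\beta^{T}\vec v_i)\,e^{\Sigma}$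 with $\vec v=(r,x)$, $\mathcal N\in\mathbb{C}$, $\vec\alpha,\vec\beta\in\mathbb{R}^2$ not both zero, and finite (possibly complex) coefficients; - the two-delta form $J_{II}=|\beta\gamma|\,\delta(\gamma r_f-\eta r_i-s)\,\delta(\alpha x_f-\beta x_i)\,e^{\Sigma}$ with $\beta,\gamma\ne0$, real coefficients and an offset $s\in\mathbb{R}$. Then: 1. The kernel of every Gaussian unitary channel is of the form $J_G$ with $a_n=0$ for all $n$ and $b_2=b_3\neq0$, or of the form $J_{II}$ with $a_n=e_n=d_n=0$ for all $n$ and $\alpha\eta=\beta\gamma$; in the second case one can take $s=0$ if the channel does not displace the position, i.e. if it maps Gaussian states with mean $(\langle\hat q\rangle,\langle\hat p\rangle)=(0,0)$ to Gaussian states with $\langle\hat q\rangle=0$. 2. The kernel of a Gaussian unitary channel never has the form $J_I$. 3. Let an operation have the kernel $J_I$ with real coefficients, delta factor $\delta(\alpha x_f-\beta x_i)$, $\beta\ne0$, $e_1>0$, and the trace-preserving values $\mathcal N=|\beta|\sqrt{e_1/\pi}$, $e_3=e_2^2/(4e_1)$, $d_1=d_2=0$. Then there are real $2\times2$ matrices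 $T$ and $N=N^{T}$ and a vector $\tau$ such that it maps $S(\sigma,d)$ to $S(T\sigma T^{T}+N,\,Td+\tau)$ for all $\sigma>0$ and all $d$, and $N_{11}=1/(2e_1)$; so $N\neq0$ for every finite $e_1$. 4. If $a_n=0$ for all $n$ and $b_2=b_3\ne0$, then $J_G$ is the kernel of a Gaussian unitary channel. 5. If $s=0$, $a_n=0$ for all $n$, $\alpha\eta=\beta\gamma$, and the trace-preserving conditions $e_1(\eta/\gamma)^2+e_2\,\eta/\gamma+e_3=0$ and $d_1\,\eta/\gamma+d_2=0$ hold, then $J_{II}$ is the kernel of a Gaussian unitary channel. -/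

import Mathlib

open MeasureTheory Filter Topology ComplexConjugate
open scoped ContDiff InnerProductSpace

noncomputable section

namespace OneMode

/-- The Hilbert space of one bosonic mode, in position representation (`ħ = 1`). -/
abbrev L2 : Type := Lp ℂ 2 (volume : Measure ℝ)

/-! ### Gaussian states

Position kernels are written in the coordinates `x = q₂ - q₁` and `r = (q₁ + q₂) / 2`, so that
`ρ(x, r) = ⟨r - x/2| ρ |r + x/2⟩`. -/

/-- The kernel `ρ(x, r)` of the Gaussian operator `S(σ, d)` with covariance matrix `σ` and mean
vector `d` of `(q, p)`: its Wigner function `(2π)⁻¹ ∫ exp(i p x) ρ(x, r) dx` is the Gaussian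
density `(2π √det σ)⁻¹ exp(-½ (v - d)ᵀ σ⁻¹ (v - d))`, `v = (r, p)`. -/
def gaussianKernel (σ : Matrix (Fin 2) (Fin 2) ℝ) (d : Fin 2 → ℝ) (x r : ℝ) : ℂ :=
  (((√(2 * Real.pi * σ 0 0))⁻¹ : ℝ) : ℂ) *
    Complex.exp
      (((-(r - d 0) ^ 2 / (2 * σ 0 0) - σ.det / (2 * σ 0 0) * x ^ 2 : ℝ) : ℂ)
        - Complex.I * ((x * (d 1 + σ 0 1 / σ 0 0 * (r - d 0)) : ℝ) : ℂ))

/-- `ρ` is the Gaussian state `S(σ, d)`: a positive operator on `L²(ℝ)` whose position kernel is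
`gaussianKernel σ d` (its trace `∫ ρ(0, r) dr` is then automatically `1`). -/
def IsGaussianStateWith (ρ : L2 →L[ℂ] L2) (σ : Matrix (Fin 2) (Fin 2) ℝ) (d : Fin 2 → ℝ) : Prop :=
  σ.PosDef ∧ ρ.IsPositive ∧
    ∀ ψ : L2, ∀ᵐ q : ℝ, ρ ψ q = ∫ q' : ℝ, gaussianKernel σ d (q' - q) ((q + q') / 2) * ψ q'

/-- `ρ` is a Gaussian state. -/
def IsGaussianState (ρ : L2 →L[ℂ] L2) : Prop := ∃ σ d, IsGaussianStateWith ρ σ d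

/-! ### Gaussian unitary channels -/

/-- The unitary channel `ρ ↦ U ρ U†`. -/
def unitaryChannel (U : L2 ≃ₗᵢ[ℂ] L2) (ρ : L2 →L[ℂ] L2) : L2 →L[ℂ] L2 :=
  U.toContinuousLinearEquiv.toContinuousLinearMap ∘L ρ ∘L
    U.symm.toContinuousLinearEquiv.toContinuousLinearMap

/-- A unitary is Gaussian if its channel transforms Gaussian states into Gaussian states. -/
def IsGaussianUnitary (U : L2 ≃ₗᵢ[ℂ] L2) : Prop :=
  ∀ ρ, IsGaussianState ρ → IsGaussianState (unitaryChannel U ρ)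

/-- The channel of `U` does not displace the position: a Gaussian state with mean `(0, 0)` goes
to one whose mean position is `0`. -/
def NoPositionDisplacement (U : L2 ≃ₗᵢ[ℂ] L2) : Prop :=
  ∀ ρ σ, IsGaussianStateWith ρ σ 0 →
    ∃ σ' d', d' 0 = 0 ∧ IsGaussianStateWith (unitaryChannel U ρ) σ' d'

/-! ### Kernels of superoperators

A generalised kernel `J(x_f, r_f; x_i, r_i)` is given by a family `J ε` of functions of
`x_f r_f x_i r_i`, and stands for the distributional limit of `J ε` as `ε → 0⁺`. -/

/-- Smooth compactly supported functions on the line. -/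
def IsTest (f : ℝ → ℂ) : Prop := ContDiff ℝ ∞ f ∧ HasCompactSupport f

theorem IsTest.memLp {f : ℝ → ℂ} (hf : IsTest f) : MemLp f 2 (volume : Measure ℝ) :=
  hf.1.continuous.memLp_of_hasCompactSupport hf.2

/-- The element of `L²(ℝ)` given by a test function. -/
def IsTest.toL2 {f : ℝ → ℂ} (hf : IsTest f) : L2 := hf.memLp.toLp f

/-- The superoperator `ρ ↦ U ρ U†` has the kernel `J` in position representation, i.e.
`ρ_f(x_f, r_f) = ∫ J(x_f, r_f; x_i, r_i) ρ_i(x_i, r_i) dx_i dr_i` in the sense of distributions: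
for `ρ_i = |f₁⟩⟨f₂|` the matrix element `⟨g₁| U ρ_i U† |g₂⟩` is the pairing of `J` with
`ρ_i(x_i, r_i)` and `conj g₁(r_f - x_f/2) g₂(r_f + x_f/2)`, for all test functions. -/
def HasKernel (U : L2 ≃ₗᵢ[ℂ] L2) (J : ℝ → ℝ → ℝ → ℝ → ℝ → ℂ) : Prop :=
  ∀ (f₁ f₂ g₁ g₂ : ℝ → ℂ) (hf₁ : IsTest f₁) (hf₂ : IsTest f₂) (hg₁ : IsTest g₁) (hg₂ : IsTest g₂),
    Tendsto
      (fun ε : ℝ => ∫ xf : ℝ, ∫ rf : ℝ, ∫ xi : ℝ, ∫ ri : ℝ,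
        J ε xf rf xi ri * (f₁ (ri - xi / 2) * conj (f₂ (ri + xi / 2))) *
          (conj (g₁ (rf - xf / 2)) * g₂ (rf + xf / 2)))
      (𝓝[>] 0)
      (𝓝 (⟪hg₁.toL2, U hf₁.toL2⟫_ℂ * ⟪U hf₂.toL2, hg₂.toL2⟫_ℂ))

/-- Coefficients of the exponent of the functional forms. -/
structure Coeffs (K : Type) where
  (a1 a2 a3 b1 b2 b3 b4 c1 c2 d1 d2 e1 e2 e3 : K)

/-- Real coefficients, regarded as complex ones. -/
def Coeffs.toComplex (κ : Coeffs ℝ) : Coeffs ℂ :=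
  { a1 := κ.a1, a2 := κ.a2, a3 := κ.a3, b1 := κ.b1, b2 := κ.b2, b3 := κ.b3, b4 := κ.b4,
    c1 := κ.c1, c2 := κ.c2, d1 := κ.d1, d2 := κ.d2, e1 := κ.e1, e2 := κ.e2, e3 := κ.e3 }

/-- The exponent `Σ(x_f, x_i; r_f, r_i)`. -/
def Coeffs.exponent (κ : Coeffs ℂ) (xf rf xi ri : ℝ) : ℂ :=
  Complex.I * (κ.b1 * xf * rf + κ.b2 * xf * ri + κ.b3 * xi * rf + κ.b4 * xi * ri
      + κ.c1 * xf + κ.c2 * xi)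
    - κ.a1 * xf ^ 2 - κ.a2 * xf * xi - κ.a3 * xi ^ 2
    - κ.e1 * rf ^ 2 - κ.e2 * rf * ri - κ.e3 * ri ^ 2 - κ.d1 * rf - κ.d2 * ri

/-- The Gaussian regularisation of the Dirac delta, `δ(t) = lim_{ε → 0⁺} deltaReg ε t`. -/
def deltaReg (ε t : ℝ) : ℝ := (ε * √Real.pi)⁻¹ * Real.exp (-(t / ε) ^ 2)

/-- The Gaussian form `J_G = (|b₃| / 2π) exp Σ`, where `Σ` has no terms `e_n`, `d_n`
(a genuine function, so the family is constant). -/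
def kernelG (κ : Coeffs ℝ) (_ε xf rf xi ri : ℝ) : ℂ :=
  ((|κ.b3| / (2 * Real.pi) : ℝ) : ℂ) *
    Complex.exp ({ κ with e1 := 0, e2 := 0, e3 := 0, d1 := 0, d2 := 0 : Coeffs ℝ
      }.toComplex.exponent xf rf xi ri)

/-- The one-delta form `J_I = 𝒩 δ(αᵀ v_f - βᵀ v_i) exp Σ`, with `v = (r, x)`. -/
def kernelI (𝒩 : ℂ) (α β : Fin 2 → ℝ) (κ : Coeffs ℂ) (ε xf rf xi ri : ℝ) : ℂ :=
  𝒩 * (deltaReg ε (α 0 * rf + α 1 * xf - (β 0 * ri + β 1 * xi)) : ℂ) *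
    Complex.exp (κ.exponent xf rf xi ri)

/-- The two-delta form `J_II = |β γ| δ(γ r_f - η r_i - s) δ(α x_f - β x_i) exp Σ`, with an offset
`s` in the first delta. -/
def kernelII (α β γ η s : ℝ) (κ : Coeffs ℝ) (ε xf rf xi ri : ℝ) : ℂ :=
  ((|β * γ| * deltaReg ε (γ * rf - η * ri - s) * deltaReg ε (α * xf - β * xi) : ℝ) : ℂ) *
    Complex.exp (κ.toComplex.exponent xf rf xi ri)

end OneMode

end

open MeasureTheory Filter Topology ComplexConjugate
open scoped ContDiff InnerProductSpace

noncomputable section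

namespace OneMode

/-! A Gaussian unitary is determined by its action on the coherent vectors `coh z`, that is
exp(-q²/2 + zq). The state of `coh z` is a rank-one Gaussian state, so its image is one too, and a
vector whose projector is a Gaussian state is a multiple of exp(-A(z)q² + B(z)q) with Re A > 0
(`exists_gvec_of_rankOne`). The matrix elements F(w,z) = ⟨coh w, U coh z⟩ are entire and zero-free
in z, and F(1,z)F(-1,z)/F(0,z)² = exp(1/(2(1/2 + A(z)))) is bounded, so by Liouville A is a constant
a. Preservation of inner products then forces B(z) = b₀ + bz with |b|² = 2 Re a
(`exists_affine_of_isGaussianUnitary`). If b is real, the images of the coherent vectors are those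
under an affine substitution with a quadratic phase (`affineU`); otherwise they are those under a
Fourier transform between two chirps (`chirpU`). Coherent vectors are total, so agreement on them up
to factors is agreement up to one phase, which the channel does not see
(`affineU_or_chirpU_of_isGaussianUnitary`).

If U has integral kernel k, its channel has kernel k(q₁,q₁') times the conjugate of k(q₂,q₂'), with
q₁ = r - x/2 and q₂ = r + x/2. For `chirpU` the squares in the phase difference leave only products
of an x with an r, which is `J_G` with `a_n = 0` and `b₂ = b₃`. For `affineU` the channel kernel is
a product of two deltas, in r and in x, with equal ratios of coefficients. Conversely, both families
consist of Gaussian unitaries (`isGaussianUnitary_wcomp`, `isGaussianUnitary_fourierU`), and their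
parameters can be fitted to the given coefficients.

One delta is excluded for two different reasons. On wave packets of width r the product of matrix
elements of `affineU` is of order r², whereas a single delta leaves three free integrations over
lengths of order r, hence a bound of order r³. The kernel of `chirpU` has constant nonzero modulus,
whereas a one-delta form vanishes off a hyperplane.

For the trace-preserving one-delta form, the terms in r combine into -(r_f - t r_i)²/(2n) with n =
1/(2e₁) and t = -e₂/(2e₁). This is a scaling of the position by t followed by Gaussian noise of
variance n, and the remaining Gaussian integral can be done in closed form. -/

/-! ### Gaussian wave functions and coherent vectors. -/

/-- The unnormalised Gaussian wave function `exp(-a q² + b q)`. -/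
def gfun (a b : ℂ) (q : ℝ) : ℂ := Complex.exp (-a * q ^ 2 + b * q)

theorem continuous_gfun (a b : ℂ) : Continuous (gfun a b) := by
  unfold gfun; fun_prop

theorem gfun_ne_zero (a b : ℂ) (q : ℝ) : gfun a b q ≠ 0 := Complex.exp_ne_zero _

theorem gfun_mul (a b a' b' : ℂ) (q : ℝ) : gfun a b q * gfun a' b' q = gfun (a + a') (b + b') q := by
  unfold gfun; rw [← Complex.exp_add]; ring_nf

theorem conj_gfun (a b : ℂ) (q : ℝ) : conj (gfun a b q) = gfun (conj a) (conj b) q := by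
  unfold gfun; rw [← Complex.exp_conj]; simp

theorem norm_gfun (a b : ℂ) (q : ℝ) : ‖gfun a b q‖ = Real.exp (-a.re * q ^ 2 + b.re * q) := by
  unfold gfun; rw [Complex.norm_exp]; simp [← Complex.ofReal_pow]

theorem integrable_gfun {a : ℂ} (ha : 0 < a.re) (b : ℂ) : Integrable (gfun a b) := by
  refine (integrable_cexp_quadratic ha b 0).congr (ae_of_all _ fun q => ?_)
  simp [gfun]

theorem integral_gfun {a : ℂ} (ha : 0 < a.re) (b : ℂ) :
    ∫ q, gfun a b q = (Real.pi / a) ^ (1 / 2 : ℂ) * Complex.exp (b ^ 2 / (4 * a)) := by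
  have h := integral_cexp_quadratic (b := -a) (by simpa using ha) b 0
  simp only [gfun]
  simp only [add_zero, neg_neg, zero_sub] at h
  rw [h]; congr 2
  have : a ≠ 0 := by rintro rfl; simp at ha
  field_simp

theorem memLp_gfun {a : ℂ} (ha : 0 < a.re) (b : ℂ) : MemLp (gfun a b) 2 (volume : Measure ℝ) := by
  rw [memLp_two_iff_integrable_sq_norm (continuous_gfun a b).aestronglyMeasurable]
  have h2 := (integrable_gfun (a := a + a) (by simpa using by linarith) (b + b)).norm
  refine h2.congr (ae_of_all _ fun q => ?_)
  simp only [← gfun_mul, norm_mul, sq]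

/-- The Gaussian wave function as a vector of `L²(ℝ)`. -/
def gvec {a : ℂ} (ha : 0 < a.re) (b : ℂ) : L2 := (memLp_gfun ha b).toLp _

theorem coeFn_gvec {a : ℂ} (ha : 0 < a.re) (b : ℂ) : gvec ha b =ᵐ[volume] gfun a b :=
  MemLp.coeFn_toLp _

theorem inner_eq_integral (f g : L2) : ⟪f, g⟫_ℂ = ∫ q, conj (f q) * g q := by
  rw [L2.inner_def]
  congr 1; ext q; simp [mul_comm]

theorem inner_eq_integral_of_ae {f g : L2} {f' g' : ℝ → ℂ} (hf : f =ᵐ[volume] f')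
    (hg : g =ᵐ[volume] g') : ⟪f, g⟫_ℂ = ∫ q, conj (f' q) * g' q := by
  rw [inner_eq_integral]
  refine integral_congr_ae ?_
  filter_upwards [hf, hg] with q h1 h2
  rw [h1, h2]

theorem inner_gvec {a a' : ℂ} (ha : 0 < a.re) (ha' : 0 < a'.re) (b b' : ℂ) :
    ⟪gvec ha b, gvec ha' b'⟫_ℂ =
      (Real.pi / (conj a + a')) ^ (1 / 2 : ℂ) *
        Complex.exp ((conj b + b') ^ 2 / (4 * (conj a + a'))) := by
  rw [inner_eq_integral_of_ae (coeFn_gvec ha b) (coeFn_gvec ha' b')]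
  simp only [conj_gfun, gfun_mul]
  exact integral_gfun (by simp; linarith) _

theorem half_re_pos : 0 < (1 / 2 : ℂ).re := by norm_num

/-- The unnormalised coherent state `exp(-q²/2 + z q)`. -/
def coh (z : ℂ) : L2 := gvec half_re_pos z

theorem coeFn_coh (z : ℂ) : coh z =ᵐ[volume] gfun (1 / 2) z := coeFn_gvec _ _

theorem inner_coh (w z : ℂ) :
    ⟪coh w, coh z⟫_ℂ = (√Real.pi : ℝ) * Complex.exp ((conj w + z) ^ 2 / 4) := by
  rw [coh, coh, inner_gvec]
  have : conj (1 / 2 : ℂ) + 1 / 2 = 1 := by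
    rw [map_div₀, map_one, map_ofNat]; norm_num
  rw [this, Real.sqrt_eq_rpow, Complex.ofReal_cpow Real.pi_pos.le]
  simp

/-! ### The Fourier transform on L² and totality of the coherent vectors. -/

open FourierTransform in
/-- On integrable functions of `L²(ℝ)`, the `L²` Fourier transform is the Fourier integral. -/
theorem coeFn_fourier_toLp {f : ℝ → ℂ} (hf : Integrable f) (hf2 : MemLp f 2 (volume : Measure ℝ)) :
    (Lp.fourierTransformₗᵢ ℝ ℂ (hf2.toLp f) : L2) =ᵐ[volume] (𝓕 f : ℝ → ℂ) := by
  have hcont : Continuous (𝓕 f : ℝ → ℂ) :=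
    VectorFourier.fourierIntegral_continuous Real.continuous_fourierChar
      (by exact continuous_inner) hf
  -- Both sides are tested against a smooth compactly supported `g`. The L² transform passes to `g`
  -- through tempered distributions, the Fourier integral through Fubini, and both give the integral
  -- of `f` against the transform of `g`.
  refine ae_eq_of_integral_contDiff_smul_eq ((Lp.memLp _).locallyIntegrable (by norm_num))
    hcont.locallyIntegrable fun g g_smooth g_cpt => ?_
  have hg₁ : HasCompactSupport (Complex.ofRealCLM ∘ g) := g_cpt.comp_left rfl
  have hg₂ : ContDiff ℝ ∞ (Complex.ofRealCLM ∘ g) := by fun_prop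
  set G := hg₁.toSchwartzMap hg₂
  have h1 := congrArg (fun T => T G) (Lp.fourier_toTemperedDistribution_eq (hf2.toLp f))
  simp only [TemperedDistribution.fourier_apply, Lp.toTemperedDistribution_apply] at h1
  have h2 : ∫ ξ, (𝓕 (G : ℝ → ℂ)) ξ • f ξ = ∫ x, G x • (𝓕 f : ℝ → ℂ) x := by
    have := VectorFourier.integral_fourierIntegral_smul_eq_flip (L := innerₗ ℝ)
      Real.continuous_fourierChar continuous_inner (G.integrable (μ := volume)) hf
    simpa using! this
  calc ∫ x, g x • (Lp.fourierTransformₗᵢ ℝ ℂ (hf2.toLp f) : L2) x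
      = ∫ x, G x • (𝓕 (hf2.toLp f) : L2) x := by
        refine integral_congr_ae (ae_of_all _ fun x => ?_)
        simp only [G]; simp; exact Or.inl rfl
    _ = ∫ ξ, (𝓕 (G : ℝ → ℂ)) ξ • f ξ := by
        rw [← h1]
        refine integral_congr_ae ?_
        filter_upwards [hf2.coeFn_toLp] with x hx
        rw [hx, SchwartzMap.fourier_coe]
    _ = _ := by
        rw [h2]
        refine integral_congr_ae (ae_of_all _ fun x => ?_)
        simp [G]

open FourierTransform in
/-- The coherent states are total. -/
theorem eq_zero_of_inner_coh_eq_zero {h : L2} (H : ∀ z, ⟪coh z, h⟫_ℂ = 0) : h = 0 := by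
  set k : ℝ → ℂ := fun q => gfun (1 / 2) 0 q * h q with hk
  have hk1 : Integrable k := (memLp_gfun half_re_pos 0).integrable_mul (Lp.memLp h)
  have hk2 : MemLp k 2 (volume : Measure ℝ) := by
    refine (Lp.memLp h).of_le hk1.1 (ae_of_all _ fun q => ?_)
    rw [hk, norm_mul, norm_gfun]
    refine mul_le_of_le_one_left (norm_nonneg _) (Real.exp_le_one_iff.2 ?_)
    simp; nlinarith [sq_nonneg q]
  have hF : (𝓕 k : ℝ → ℂ) = 0 := by
    ext w
    rw [Real.fourier_real_eq_integral_exp_smul]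
    -- At imaginary labels the overlap with a coherent vector is the Fourier integral of `k`, the
    -- product of `h` with a Gaussian. So `k` has zero transform, and the Gaussian factor can be
    -- divided out.
    have := H (2 * Real.pi * w * Complex.I)
    rw [inner_eq_integral_of_ae (coeFn_coh _) (ae_eq_refl _)] at this
    rw [Pi.zero_apply, ← this]
    congr 1; ext q
    rw [hk, conj_gfun, smul_eq_mul, ← mul_assoc]
    congr 1
    unfold gfun; rw [← Complex.exp_add]; congr 1
    simp [Complex.conj_ofNat]; ring
  have h0 : (Lp.fourierTransformₗᵢ ℝ ℂ (hk2.toLp k) : L2) = 0 := by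
    rw [Lp.eq_zero_iff_ae_eq_zero]
    exact (coeFn_fourier_toLp hk1 hk2).trans (by rw [hF])
  have h1 : hk2.toLp k = 0 := by simpa using h0
  rw [Lp.eq_zero_iff_ae_eq_zero]
  have h2 := hk2.coeFn_toLp
  rw [h1] at h2
  filter_upwards [h2, Lp.coeFn_zero ℂ 2 (volume : Measure ℝ)] with q hq hq0
  rw [hq0] at hq
  simpa [hk, gfun_ne_zero] using hq.symm

theorem ext_coh {h h' : L2} (H : ∀ z, ⟪coh z, h⟫_ℂ = ⟪coh z, h'⟫_ℂ) : h = h' := by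
  rw [← sub_eq_zero]
  exact eq_zero_of_inner_coh_eq_zero fun z => by rw [inner_sub_right, H, sub_self]

/-- For adjoints the hypothesis becomes equality of inner products with coherent vectors, where
totality applies. -/
theorem clm_ext_coh {T T' : L2 →L[ℂ] L2} (H : ∀ z, T (coh z) = T' (coh z)) : T = T' := by
  have : T.adjoint = T'.adjoint := by
    ext1 h
    refine ext_coh fun z => ?_
    rw [ContinuousLinearMap.adjoint_inner_right, ContinuousLinearMap.adjoint_inner_right, H]
  simpa using congrArg ContinuousLinearMap.adjoint this

/-! ### Affine substitutions and the Fourier transform as unitaries. -/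

theorem quasiMeasurePreserving_affine {l : ℝ} (hl : l ≠ 0) (s : ℝ) :
    Measure.QuasiMeasurePreserving (fun q : ℝ => l * q + s) volume volume := by
  refine (measurePreserving_add_right volume s).quasiMeasurePreserving.comp
    (g := fun q : ℝ => q + s) (f := fun q : ℝ => l * q) ⟨by fun_prop, ?_⟩
  rw [Real.map_volume_mul_left hl]
  exact Measure.smul_absolutelyContinuous

theorem integral_comp_affine {E : Type*} [NormedAddCommGroup E] [NormedSpace ℝ E]
    (l s : ℝ) (F : ℝ → E) : ∫ q : ℝ, F (l * q + s) = |l⁻¹| • ∫ q : ℝ, F q := by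
  rw [Measure.integral_comp_mul_left (fun q => F (q + s)) l,
    integral_add_right_eq_self (fun q => F q) s]

theorem integrable_comp_affine {E : Type*} [NormedAddCommGroup E]
    {l : ℝ} (hl : l ≠ 0) (s : ℝ) {F : ℝ → E} (hF : Integrable F) :
    Integrable fun q : ℝ => F (l * q + s) :=
  (hF.comp_add_right s).comp_mul_left' hl

/-- Weighted composition with an affine map, `ψ ↦ √|l| exp(i φ(q)) ψ(l q + s)`, on functions. -/
def wfun (φ : ℝ → ℝ) (l s : ℝ) (ψ : ℝ → ℂ) (q : ℝ) : ℂ :=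
  (√|l| : ℝ) * Complex.exp (Complex.I * φ q) * ψ (l * q + s)

theorem norm_wfun (φ : ℝ → ℝ) (l s : ℝ) (ψ : ℝ → ℂ) (q : ℝ) :
    ‖wfun φ l s ψ q‖ = √|l| * ‖ψ (l * q + s)‖ := by
  rw [wfun, norm_mul, norm_mul, mul_comm Complex.I, Complex.norm_exp_ofReal_mul_I,
    Complex.norm_real, Real.norm_of_nonneg (Real.sqrt_nonneg _), mul_one]

theorem wfun_congr {φ : ℝ → ℝ} {l s : ℝ} (hl : l ≠ 0) {ψ ψ' : ℝ → ℂ} (h : ψ =ᵐ[volume] ψ') :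
    wfun φ l s ψ =ᵐ[volume] wfun φ l s ψ' := by
  filter_upwards [(quasiMeasurePreserving_affine hl s).ae_eq_comp h] with q hq
  simp only [Function.comp] at hq
  rw [wfun, wfun, hq]

theorem aestronglyMeasurable_wfun {φ : ℝ → ℝ} (hφ : Continuous φ) {l s : ℝ} (hl : l ≠ 0)
    {ψ : ℝ → ℂ} (h : AEStronglyMeasurable ψ) : AEStronglyMeasurable (wfun φ l s ψ) := by
  refine AEStronglyMeasurable.mul (Continuous.aestronglyMeasurable (by fun_prop)) ?_
  exact h.comp_quasiMeasurePreserving (quasiMeasurePreserving_affine hl s)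

theorem memLp_wfun {φ : ℝ → ℝ} (hφ : Continuous φ) {l s : ℝ} (hl : l ≠ 0)
    {ψ : ℝ → ℂ} (h : MemLp ψ 2 (volume : Measure ℝ)) :
    MemLp (wfun φ l s ψ) 2 (volume : Measure ℝ) := by
  rw [memLp_two_iff_integrable_sq_norm (aestronglyMeasurable_wfun hφ hl h.1)]
  simp only [norm_wfun, mul_pow]
  exact (integrable_comp_affine hl s (h.integrable_norm_pow two_ne_zero)).const_mul _

theorem wfun_wfun_inv (φ : ℝ → ℝ) {l : ℝ} (hl : l ≠ 0) (s : ℝ) (ψ : ℝ → ℂ) :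
    wfun φ l s (wfun (fun q => -φ (l⁻¹ * q + -(l⁻¹ * s))) l⁻¹ (-(l⁻¹ * s)) ψ) = ψ := by
  ext q
  have h1 : l⁻¹ * (l * q + s) + -(l⁻¹ * s) = q := by field_simp; ring
  have h2 : √|l| * √|l⁻¹| = 1 := by
    rw [← Real.sqrt_mul (abs_nonneg _), ← abs_mul, mul_inv_cancel₀ hl]; simp
  simp only [wfun, h1]
  rw [show ∀ a b c d e : ℂ, a * b * (c * d * e) = (a * c) * (b * d) * e by intros; ring,
    ← Complex.ofReal_mul, h2, ← Complex.exp_add]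
  simp

theorem wfun_inv_wfun (φ : ℝ → ℝ) {l : ℝ} (hl : l ≠ 0) (s : ℝ) (ψ : ℝ → ℂ) :
    wfun (fun q => -φ (l⁻¹ * q + -(l⁻¹ * s))) l⁻¹ (-(l⁻¹ * s)) (wfun φ l s ψ) = ψ := by
  -- The parameters of the inverse, inverted once more, are the original ones.
  have := wfun_wfun_inv (fun q => -φ (l⁻¹ * q + -(l⁻¹ * s))) (inv_ne_zero hl) (-(l⁻¹ * s)) ψ
  have h1 : ∀ q, l⁻¹ * (l * q + l * (l⁻¹ * s)) + -(l⁻¹ * s) = q := by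
    intro q; field_simp; ring
  have h2 : ∀ q, l⁻¹ * (l * q + s) + -(l⁻¹ * s) = q := by
    intro q; field_simp; ring
  simpa [h1, h2, mul_inv_cancel_left₀ hl] using this

/-- Weighted composition with an affine map as a unitary. -/
def wcomp {φ : ℝ → ℝ} (hφ : Continuous φ) {l : ℝ} (hl : l ≠ 0) (s : ℝ) : L2 ≃ₗᵢ[ℂ] L2 where
  toFun ψ := (memLp_wfun hφ hl (s := s) (Lp.memLp ψ)).toLp _
  invFun ψ := (memLp_wfun (φ := fun q => -φ (l⁻¹ * q + -(l⁻¹ * s))) (by fun_prop)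
    (inv_ne_zero hl) (s := -(l⁻¹ * s)) (Lp.memLp ψ)).toLp _
  map_add' ψ χ := by
    rw [← MemLp.toLp_add, MemLp.toLp_eq_toLp_iff]
    refine (wfun_congr hl (Lp.coeFn_add ψ χ)).trans (ae_of_all _ fun q => ?_)
    simp [wfun, mul_add]
  map_smul' c ψ := by
    rw [RingHom.id_apply, ← MemLp.toLp_const_smul, MemLp.toLp_eq_toLp_iff]
    refine (wfun_congr hl (Lp.coeFn_smul c ψ)).trans (ae_of_all _ fun q => ?_)
    simp [wfun]; ring
  left_inv ψ := by
    refine Eq.trans ?_ (Lp.toLp_coeFn ψ (Lp.memLp ψ))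
    rw [MemLp.toLp_eq_toLp_iff]
    refine (wfun_congr (inv_ne_zero hl) (MemLp.coeFn_toLp _)).trans ?_
    rw [wfun_inv_wfun _ hl]
  right_inv ψ := by
    refine Eq.trans ?_ (Lp.toLp_coeFn ψ (Lp.memLp ψ))
    rw [MemLp.toLp_eq_toLp_iff]
    refine (wfun_congr hl (MemLp.coeFn_toLp _)).trans ?_
    rw [wfun_wfun_inv _ hl]
  norm_map' ψ := by
    change ‖(memLp_wfun hφ hl (s := s) (Lp.memLp ψ)).toLp _‖ = ‖ψ‖
    set f := (memLp_wfun hφ hl (s := s) (Lp.memLp ψ)).toLp _ with hf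
    have hsq : ∀ g : L2, ‖g‖ ^ 2 = ∫ q, ‖g q‖ ^ 2 := fun g => by
      have := inner_self_eq_norm_sq_to_K (𝕜 := ℂ) g
      rw [inner_eq_integral] at this
      have h2 : ∀ q, conj (g q) * g q = ((‖g q‖ ^ 2 : ℝ) : ℂ) := fun q => by
        rw [Complex.conj_mul']; push_cast; rfl
      simp only [h2] at this
      rw [integral_complex_ofReal] at this
      exact (Complex.ofReal_injective (this.trans (by push_cast; rfl))).symm
    have : ‖f‖ ^ 2 = ‖ψ‖ ^ 2 := by
      rw [hsq, hsq]
      calc ∫ q, ‖f q‖ ^ 2 = ∫ q, |l| * ‖ψ (l * q + s)‖ ^ 2 := by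
            refine integral_congr_ae ?_
            filter_upwards [MemLp.coeFn_toLp (memLp_wfun hφ hl (s := s) (Lp.memLp ψ))] with q hq
            rw [hf, hq, norm_wfun, mul_pow, Real.sq_sqrt (abs_nonneg _)]
        _ = _ := by
            rw [integral_const_mul, integral_comp_affine l s (fun q => ‖ψ q‖ ^ 2), smul_eq_mul,
              ← mul_assoc, ← abs_mul, mul_inv_cancel₀ hl]
            simp
    exact (sq_eq_sq₀ (norm_nonneg _) (norm_nonneg _)).1 this

theorem coeFn_wcomp {φ : ℝ → ℝ} (hφ : Continuous φ) {l : ℝ} (hl : l ≠ 0) (s : ℝ) (ψ : L2) :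
    wcomp hφ hl s ψ =ᵐ[volume] wfun φ l s ψ :=
  MemLp.coeFn_toLp (memLp_wfun hφ hl (Lp.memLp ψ))

theorem coeFn_wcomp_of_ae {φ : ℝ → ℝ} (hφ : Continuous φ) {l : ℝ} (hl : l ≠ 0) (s : ℝ) {ψ : L2}
    {f : ℝ → ℂ} (h : ψ =ᵐ[volume] f) : wcomp hφ hl s ψ =ᵐ[volume] wfun φ l s f :=
  (coeFn_wcomp hφ hl s ψ).trans (wfun_congr hl h)

theorem coeFn_wcomp_symm {φ : ℝ → ℝ} (hφ : Continuous φ) {l : ℝ} (hl : l ≠ 0) (s : ℝ) (ψ : L2) :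
    (wcomp hφ hl s).symm ψ =ᵐ[volume]
      wfun (fun q => -φ (l⁻¹ * q + -(l⁻¹ * s))) l⁻¹ (-(l⁻¹ * s)) ψ :=
  MemLp.coeFn_toLp (memLp_wfun (by fun_prop) (inv_ne_zero hl) (Lp.memLp ψ))

/-- The Fourier transform `(2π)^{-1/2} ∫ exp(-i q q') ψ(q') dq'` as a unitary. -/
def fourierU : L2 ≃ₗᵢ[ℂ] L2 :=
  (Lp.fourierTransformₗᵢ ℝ ℂ).trans
    (wcomp (φ := fun _ => 0) continuous_const (l := (2 * Real.pi)⁻¹) (by positivity) 0)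

theorem coeFn_fourierU {f : ℝ → ℂ} (hf : Integrable f) {ψ : L2} (hψ : ψ =ᵐ[volume] f) :
    fourierU ψ =ᵐ[volume] fun q : ℝ => (√(2 * Real.pi) : ℝ)⁻¹ *
      ∫ q' : ℝ, Complex.exp (-(Complex.I * q * q')) * f q' := by
  have hf2 : MemLp f 2 (volume : Measure ℝ) := (memLp_congr_ae hψ).1 (Lp.memLp ψ)
  obtain rfl : ψ = hf2.toLp f := by
    rw [← Lp.toLp_coeFn ψ (Lp.memLp ψ), MemLp.toLp_eq_toLp_iff]; exact hψ
  refine (coeFn_wcomp_of_ae (φ := fun _ => 0) continuous_const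
    (l := (2 * Real.pi)⁻¹) (by positivity) 0 (coeFn_fourier_toLp hf hf2)).trans (ae_of_all _ fun q => ?_)
  simp only [wfun, Real.fourier_real_eq_integral_exp_smul]
  have : √|(2 * Real.pi)⁻¹| = (√(2 * Real.pi))⁻¹ := by
    rw [abs_of_pos (by positivity), Real.sqrt_inv]
  rw [this]
  simp only [Complex.ofReal_zero, mul_zero, Complex.exp_zero, mul_one, Complex.ofReal_inv,
    smul_eq_mul]
  congr 2; ext v; congr 2
  have : (Real.pi : ℂ) ≠ 0 := by exact_mod_cast Real.pi_ne_zero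
  push_cast; field_simp; ring

/-! ### Integral kernels and the action of Gaussian kernels on Gaussians. -/

/-- If a bounded operator has an integral kernel with square-integrable sections on the coherent
states, then it has this kernel on all of `L²(ℝ)`. -/
theorem ae_eq_inner_of_coh (A : L2 →L[ℂ] L2) (k : ℝ → L2)
    (h : ∀ z, A (coh z) =ᵐ[volume] fun q => ⟪k q, coh z⟫_ℂ) (ψ : L2) :
    A ψ =ᵐ[volume] fun q => ⟪k q, ψ⟫_ℂ := by
  let S : Submodule ℂ L2 :=
    { carrier := {ψ | A ψ =ᵐ[volume] fun q => ⟪k q, ψ⟫_ℂ}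
      add_mem' := fun {ψ χ} hψ hχ => by
        simp only [Set.mem_ofPred_eq, map_add] at *
        filter_upwards [hψ, hχ, Lp.coeFn_add (A ψ) (A χ)] with q h1 h2 h3
        rw [h3, Pi.add_apply, h1, h2, inner_add_right]
      zero_mem' := by
        simp only [Set.mem_ofPred_eq, map_zero, inner_zero_right]
        exact Lp.coeFn_zero ℂ 2 volume
      smul_mem' := fun c ψ hψ => by
        simp only [Set.mem_ofPred_eq, map_smul] at *
        filter_upwards [hψ, Lp.coeFn_smul c (A ψ)] with q h1 h2
        rw [h2, Pi.smul_apply, h1, inner_smul_right, smul_eq_mul] }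
  have hclosed : IsClosed (S : Set L2) := by
    refine IsSeqClosed.isClosed fun u ψ hu hlim => ?_
    have h1 : Tendsto (fun n => A (u n)) atTop (𝓝 (A ψ)) := (A.continuous.tendsto ψ).comp hlim
    -- Pointwise limits are available only along a subsequence. This suffices, since for each fixed
    -- `q` the right-hand side is continuous in the vector.
    obtain ⟨ns, hns, hae⟩ := (tendstoInMeasure_of_tendsto_Lp h1).exists_seq_tendsto_ae
    have h2 : ∀ᵐ q, ∀ n, A (u n) q = ⟪k q, u n⟫_ℂ := ae_all_iff.2 hu
    change A ψ =ᵐ[volume] _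
    filter_upwards [hae, h2] with q hq1 hq2
    refine tendsto_nhds_unique hq1 ?_
    simp only [hq2]
    exact tendsto_const_nhds.inner (hlim.comp hns.tendsto_atTop)
  have htop : S.topologicalClosure = ⊤ := by
    rw [Submodule.topologicalClosure_eq_top_iff, Submodule.eq_bot_iff]
    intro x hx
    refine eq_zero_of_inner_coh_eq_zero fun z => ?_
    exact (Submodule.mem_orthogonal _ _).1 hx _ (h z)
  rw [IsClosed.submodule_topologicalClosure_eq hclosed] at htop
  exact (htop ▸ Submodule.mem_top : ψ ∈ S)

variable (σ : Matrix (Fin 2) (Fin 2) ℝ) (d : Fin 2 → ℝ)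

/-- The coefficient of `-q'²` in the exponent of a Gaussian kernel. -/
def kerK : ℂ := ((1 + 4 * σ.det) / (8 * σ 0 0) : ℝ) + (σ 0 1 / (2 * σ 0 0) : ℝ) * Complex.I

/-- The coefficient of `q q'` in the exponent of a Gaussian kernel. -/
def kerX : ℝ := (4 * σ.det - 1) / (4 * σ 0 0)

/-- The coefficient of `q'` in the exponent of a Gaussian kernel. -/
def kerL : ℂ := (d 0 / (2 * σ 0 0) : ℝ) - (d 1 - σ 0 1 * d 0 / σ 0 0 : ℝ) * Complex.I

/-- The prefactor of a Gaussian kernel. -/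
def kerN : ℝ := (√(2 * Real.pi * σ 0 0))⁻¹ * Real.exp (-d 0 ^ 2 / (2 * σ 0 0))

variable {σ d}

theorem posDef_pos (hσ : σ.PosDef) : 0 < σ 0 0 := hσ.diag_pos

theorem kerN_pos (hσ : σ.PosDef) : 0 < kerN σ d := by
  have := posDef_pos hσ
  unfold kerN; positivity

theorem kerK_re : (kerK σ).re = (1 + 4 * σ.det) / (8 * σ 0 0) := by
  simp only [kerK, Complex.add_re, Complex.ofReal_re, Complex.re_ofReal_mul, Complex.I_re]; simp

theorem kerK_re_pos (hσ : σ.PosDef) : 0 < (kerK σ).re := by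
  have := posDef_pos hσ; have := hσ.det_pos
  rw [kerK_re]; positivity

/-- The gap between the two sides is det σ / σ₀₀². It ensures that a Gaussian kernel maps
normalisable Gaussians to normalisable ones. -/
theorem kerX_sq_lt (hσ : σ.PosDef) : kerX σ ^ 2 < 4 * (kerK σ).re ^ 2 := by
  have h1 := posDef_pos hσ; have h2 := hσ.det_pos
  rw [kerK_re, kerX, div_pow, div_pow, ← mul_div_assoc, div_lt_div_iff₀ (by positivity) (by positivity)]
  have : 0 < σ 0 0 ^ 2 * σ.det := by positivity
  nlinarith

/-- In the coordinates `q`, `q'` the only coupling is the real coefficient `kerX`. It vanishes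
exactly when det σ = 1/4, and then the kernel is a product, that is, a rank-one operator. -/
theorem gaussianKernel_eq (hσ : σ 0 0 ≠ 0) (q q' : ℝ) :
    gaussianKernel σ d (q' - q) ((q + q') / 2) =
      kerN σ d * gfun (conj (kerK σ)) (conj (kerL σ d)) q *
        gfun (kerK σ) (kerL σ d + kerX σ * q) q' := by
  have h : (σ 0 0 : ℂ) ≠ 0 := by exact_mod_cast hσ
  simp only [gaussianKernel, kerN, gfun, Complex.ofReal_mul, Complex.ofReal_exp, mul_assoc,
    ← Complex.exp_add]
  congr 2
  simp only [kerK, kerL, kerX, map_add, map_sub, map_mul, Complex.conj_ofReal, Complex.conj_I]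
  push_cast
  field_simp
  ring

theorem re_inv_le {w : ℂ} (hw : 0 < w.re) : (w⁻¹).re ≤ w.re⁻¹ := by
  rw [Complex.inv_re, div_le_iff₀ (Complex.normSq_pos.2 (by rintro rfl; simp at hw)),
    Complex.normSq_apply, ← div_eq_inv_mul, le_div_iff₀ hw]
  nlinarith [sq_nonneg w.im]

theorem inv_re_pos {w : ℂ} (hw : 0 < w.re) : 0 < (w⁻¹).re := by
  rw [Complex.inv_re]
  exact div_pos hw (Complex.normSq_pos.2 (by rintro rfl; simp at hw))

/-- Since Re(1/w) ≤ 1/Re w, the subtracted term has real part at most X²/(4 Re K), which is below Re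
K by `kerX_sq_lt`. -/
theorem re_out_pos (hσ : σ.PosDef) {a : ℂ} (ha : 0 < a.re) :
    0 < (conj (kerK σ) - kerX σ ^ 2 / (4 * (kerK σ + a))).re := by
  have hK := kerK_re_pos hσ
  have hX := kerX_sq_lt hσ
  have hw : 0 < (kerK σ + a).re := by rw [Complex.add_re]; linarith
  have h1 := re_inv_le hw
  have h2 : ((kerX σ : ℂ) ^ 2 / (4 * (kerK σ + a))) = ((kerX σ ^ 2 / 4 : ℝ) : ℂ) * (kerK σ + a)⁻¹ := by
    push_cast; rw [div_eq_mul_inv, mul_inv]; ring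
  rw [Complex.sub_re, Complex.conj_re, h2, Complex.re_ofReal_mul]
  have h3 : (kerK σ + a).re⁻¹ ≤ (kerK σ).re⁻¹ := by
    rw [Complex.add_re]; gcongr; linarith
  have h4 : kerX σ ^ 2 / 4 * ((kerK σ + a)⁻¹).re ≤ kerX σ ^ 2 / 4 * (kerK σ).re⁻¹ := by
    gcongr; exact h1.trans h3
  have h5 : kerX σ ^ 2 / 4 * (kerK σ).re⁻¹ < (kerK σ).re := by
    rw [← div_eq_mul_inv, div_lt_iff₀ hK]; linarith
  linarith

theorem integral_gfun_affine {A : ℂ} (hA : 0 < A.re) (L X : ℂ) (q : ℝ) :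
    ∫ q', gfun A (L + X * q) q' = (Real.pi / A) ^ (1 / 2 : ℂ) * Complex.exp (L ^ 2 / (4 * A)) *
      gfun (-(X ^ 2 / (4 * A))) (X * L / (2 * A)) q := by
  rw [integral_gfun hA, mul_assoc, gfun, ← Complex.exp_add]
  have : A ≠ 0 := by rintro rfl; simp at hA
  congr 2; field_simp; ring

/-- The action of a Gaussian kernel on a Gaussian wave function. -/
theorem integral_gaussianKernel_gfun (hσ : σ.PosDef) {a : ℂ} (ha : 0 < a.re) (b : ℂ) (q : ℝ) :
    ∫ q' : ℝ, gaussianKernel σ d (q' - q) ((q + q') / 2) * gfun a b q' =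
      kerN σ d * (Real.pi / (kerK σ + a)) ^ (1 / 2 : ℂ) *
          Complex.exp ((kerL σ d + b) ^ 2 / (4 * (kerK σ + a))) *
        gfun (conj (kerK σ) - kerX σ ^ 2 / (4 * (kerK σ + a)))
          (conj (kerL σ d) + kerX σ * (kerL σ d + b) / (2 * (kerK σ + a))) q := by
  have hw : 0 < (kerK σ + a).re := by
    have := kerK_re_pos hσ
    rw [Complex.add_re]; linarith
  simp only [gaussianKernel_eq (posDef_pos hσ).ne', mul_assoc (_ * _) (gfun _ _ _), gfun_mul]
  rw [integral_const_mul, show ∀ x : ℂ, kerL σ d + kerX σ * q + x = (kerL σ d + x) + kerX σ * q by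
    intro x; ring, integral_gfun_affine hw, sub_eq_add_neg, ← gfun_mul]
  ring

/-- Writes the kernel operator in the form required by `ae_eq_inner_of_coh`, so that Gaussianity of
an operator can be checked on coherent vectors alone. -/
theorem integral_kernel_eq_inner (hσ : σ.PosDef) (q : ℝ) (ψ : L2) :
    ∫ q' : ℝ, gaussianKernel σ d (q' - q) ((q + q') / 2) * ψ q' =
      ⟪conj (kerN σ d * gfun (conj (kerK σ)) (conj (kerL σ d)) q) •
        gvec (a := conj (kerK σ)) (by simpa using kerK_re_pos hσ)
          (conj (kerL σ d + kerX σ * q)), ψ⟫_ℂ := by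
  rw [inner_smul_left, inner_eq_integral_of_ae (coeFn_gvec _ _) (ae_eq_refl _), Complex.conj_conj,
    ← integral_const_mul]
  congr 1; ext q'
  rw [gaussianKernel_eq (posDef_pos hσ).ne', conj_gfun, Complex.conj_conj, Complex.conj_conj]
  ring

theorem isGaussianStateWith_of_coh {ρ : L2 →L[ℂ] L2} (hσ : σ.PosDef) (hρ : ρ.IsPositive)
    (h : ∀ z, ρ (coh z) =ᵐ[volume]
      fun q => ∫ q' : ℝ, gaussianKernel σ d (q' - q) ((q + q') / 2) * gfun (1 / 2) z q') :
    IsGaussianStateWith ρ σ d := by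
  refine ⟨hσ, hρ, fun ψ => ?_⟩
  simp only [integral_kernel_eq_inner hσ]
  refine ae_eq_inner_of_coh ρ _ (fun z => (h z).trans (ae_of_all _ fun q => ?_)) ψ
  simp only [← integral_kernel_eq_inner hσ]
  refine integral_congr_ae ?_
  filter_upwards [coeFn_coh z] with q' hq'
  rw [hq']

/-! ### Affine substitutions with quadratic phase are Gaussian. -/

theorem unitaryChannel_apply (U : L2 ≃ₗᵢ[ℂ] L2) (ρ : L2 →L[ℂ] L2) (ψ : L2) :
    unitaryChannel U ρ ψ = U (ρ (U.symm ψ)) := rfl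

theorem isPositive_unitaryChannel (U : L2 ≃ₗᵢ[ℂ] L2) {ρ : L2 →L[ℂ] L2} (h : ρ.IsPositive) :
    (unitaryChannel U ρ).IsPositive := by
  have := h.conj_adjoint U.toContinuousLinearEquiv.toContinuousLinearMap
  rwa [LinearIsometryEquiv.adjoint_eq_symm] at this

theorem unitaryChannel_trans (U V : L2 ≃ₗᵢ[ℂ] L2) (ρ : L2 →L[ℂ] L2) :
    unitaryChannel (U.trans V) ρ = unitaryChannel V (unitaryChannel U ρ) := by
  ext1 ψ
  simp only [unitaryChannel_apply, LinearIsometryEquiv.trans_apply,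
    LinearIsometryEquiv.symm_trans]

theorem isGaussianUnitary_trans {U V : L2 ≃ₗᵢ[ℂ] L2} (hU : IsGaussianUnitary U)
    (hV : IsGaussianUnitary V) : IsGaussianUnitary (U.trans V) := by
  intro ρ hρ
  rw [unitaryChannel_trans]
  exact hV _ (hU ρ hρ)

/-- The covariance matrix with position variance `v`, covariance `c` and determinant `D`. -/
def covMat (v c D : ℝ) : Matrix (Fin 2) (Fin 2) ℝ := !![v, c; c, (D + c ^ 2) / v]

@[simp] theorem covMat_zero_zero (v c D : ℝ) : covMat v c D 0 0 = v := rfl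

@[simp] theorem covMat_zero_one (v c D : ℝ) : covMat v c D 0 1 = c := rfl

theorem det_covMat {v : ℝ} (hv : v ≠ 0) (c D : ℝ) : (covMat v c D).det = D := by
  rw [covMat, Matrix.det_fin_two_of]; field_simp; ring

theorem posDef_covMat {v D : ℝ} (hv : 0 < v) (hD : 0 < D) (c : ℝ) : (covMat v c D).PosDef := by
  refine Matrix.PosDef.of_dotProduct_mulVec_pos ?_ fun x hx => ?_
  · ext i j; fin_cases i <;> fin_cases j <;> simp [covMat]
  · have h : star x ⬝ᵥ (covMat v c D).mulVec x = v * (x 0 + c / v * x 1) ^ 2 + D / v * x 1 ^ 2 := by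
      simp [covMat, dotProduct, Matrix.mulVec, Fin.sum_univ_two]; field_simp; ring
    rw [h]
    by_cases h1 : x 1 = 0
    · have h0 : x 0 ≠ 0 := fun h0 => hx (by ext i; fin_cases i <;> simp [h0, h1])
      rw [h1]; simp; positivity
    · positivity

/-- On phase space the unitary acts by q ↦ (q - s)/l and p ↦ lp + φ'(q), with φ' evaluated at the
new position. This gives the new moments; the determinant is unchanged. -/
theorem isGaussianUnitary_wcomp {p₁ p₂ l : ℝ} {φ : ℝ → ℝ} (hφ : Continuous φ)
    (hφ' : ∀ q, φ q = p₁ * q ^ 2 + p₂ * q) (hl : l ≠ 0) (s : ℝ) :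
    IsGaussianUnitary (wcomp hφ hl s) := by
  rintro ρ ⟨σ, d, hσ, hρ, hk⟩
  have hv := posDef_pos hσ
  have hv' : 0 < σ 0 0 / l ^ 2 := by positivity
  refine ⟨covMat (σ 0 0 / l ^ 2) (σ 0 1 + 2 * p₁ * (σ 0 0 / l ^ 2)) σ.det,
    ![(d 0 - s) / l, l * d 1 + p₂ + 2 * p₁ * ((d 0 - s) / l)],
    posDef_covMat hv' hσ.det_pos _, isPositive_unitaryChannel _ hρ, fun ψ => ?_⟩
  refine (coeFn_wcomp_of_ae hφ hl s (hk ((wcomp hφ hl s).symm ψ))).trans (ae_of_all _ fun q => ?_)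
  -- After the substitution q' = lt + s the integrands agree pointwise; the factor |l| is the
  -- Jacobian.
  have key : ∀ t : ℝ, ((√|l| : ℝ) : ℂ) * Complex.exp (Complex.I * φ q) * ((|l| : ℝ) *
      (gaussianKernel σ d (l * t + s - (l * q + s)) ((l * q + s + (l * t + s)) / 2) *
      (((√|l⁻¹| : ℝ) : ℂ) * Complex.exp (Complex.I * (-φ t : ℝ)) * ψ t))) =
    gaussianKernel (covMat (σ 0 0 / l ^ 2) (σ 0 1 + 2 * p₁ * (σ 0 0 / l ^ 2)) σ.det)
      ![(d 0 - s) / l, l * d 1 + p₂ + 2 * p₁ * ((d 0 - s) / l)] (t - q) ((q + t) / 2) * ψ t := by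
    intro t
    have h2 : √|l| * √|l⁻¹| = 1 := by
      rw [← Real.sqrt_mul (abs_nonneg _), ← abs_mul, mul_inv_cancel₀ hl]; simp
    have h3 : (√(2 * Real.pi * (σ 0 0 / l ^ 2)))⁻¹ = |l| * (√(2 * Real.pi * σ 0 0))⁻¹ := by
      rw [← mul_div_assoc, Real.sqrt_div' _ (by positivity), Real.sqrt_sq_eq_abs, inv_div,
        div_eq_mul_inv]
    simp only [gaussianKernel, covMat_zero_zero, covMat_zero_one, det_covMat hv'.ne', h3,
      Matrix.cons_val_zero, Matrix.cons_val_one]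
    rw [show ∀ a b c d e f g ψ' : ℂ, a * b * (c * (d * e * (f * g * ψ'))) =
      (a * f) * ((c * d) * (b * e * g)) * ψ' by intros; ring, ← Complex.ofReal_mul, h2,
      ← Complex.exp_add, ← Complex.exp_add, Complex.ofReal_one, one_mul, ← Complex.ofReal_mul]
    congr 3
    rw [hφ', hφ']
    have hl' : (l : ℂ) ≠ 0 := by exact_mod_cast hl
    have hv'' : (σ 0 0 : ℂ) ≠ 0 := by exact_mod_cast hv.ne'
    push_cast
    field_simp
    ring
  simp only [← key]
  rw [integral_const_mul, wfun, integral_const_mul]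
  congr 1
  rw [integral_congr_ae (g := fun q' => gaussianKernel σ d (q' - (l * q + s)) ((l * q + s + q') / 2)
    * wfun (fun q => -φ (l⁻¹ * q + -(l⁻¹ * s))) l⁻¹ (-(l⁻¹ * s)) ψ q')]
  · set F : ℝ → ℂ := fun q' => gaussianKernel σ d (q' - (l * q + s)) ((l * q + s + q') / 2)
      * wfun (fun q => -φ (l⁻¹ * q + -(l⁻¹ * s))) l⁻¹ (-(l⁻¹ * s)) ψ q' with hF
    have := integral_comp_affine l s F
    have h4 : ∫ q', F q' = (|l| : ℝ) * ∫ t, F (l * t + s) := by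
      rw [this, Complex.real_smul, ← mul_assoc, ← Complex.ofReal_mul, ← abs_mul, mul_inv_cancel₀ hl]
      simp
    rw [h4]
    congr 2; ext t
    have h5 : l⁻¹ * (l * t + s) + -(l⁻¹ * s) = t := by field_simp; ring
    simp only [hF, wfun, h5]
  · filter_upwards [coeFn_wcomp_symm hφ hl s ψ] with q' hq'
    rw [hq']

/-! ### The Fourier transform is Gaussian. -/

theorem ne_zero_of_re_pos {a : ℂ} (ha : 0 < a.re) : a ≠ 0 := by
  rintro rfl; simp at ha

theorem coeFn_fourierU_gfun {a : ℂ} (ha : 0 < a.re) (b c : ℂ) {ψ : L2}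
    (hψ : ψ =ᵐ[volume] fun q => c * gfun a b q) :
    fourierU ψ =ᵐ[volume] fun q => c * ((√(2 * Real.pi) : ℝ)⁻¹ * (Real.pi / a) ^ (1 / 2 : ℂ) *
      Complex.exp (b ^ 2 / (4 * a))) * gfun (1 / (4 * a)) (-(Complex.I * b) / (2 * a)) q := by
  refine (coeFn_fourierU ((integrable_gfun ha b).const_mul c) hψ).trans (ae_of_all _ fun q => ?_)
  have h : ∀ q' : ℝ, Complex.exp (-(Complex.I * q * q')) * (c * gfun a b q') =
      c * gfun a (b + -Complex.I * q) q' := by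
    intro q'
    rw [mul_left_comm]
    congr 1
    unfold gfun; rw [← Complex.exp_add]; ring_nf
  simp only [h]
  rw [integral_const_mul, integral_gfun_affine ha]
  simp only [neg_sq, Complex.I_sq, neg_div, neg_neg, neg_mul]
  ring

/-- Both arguments lie strictly between -π/2 and π/2, so their sum stays within the principal
branch. -/
theorem cpow_half_mul {x y : ℂ} (hx : 0 < x.re) (hy : 0 < y.re) :
    x ^ (1 / 2 : ℂ) * y ^ (1 / 2 : ℂ) = (x * y) ^ (1 / 2 : ℂ) := by
  have hx0 := ne_zero_of_re_pos hx
  have hy0 := ne_zero_of_re_pos hy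
  have h1 := abs_lt.1 (Complex.abs_arg_lt_pi_div_two_iff.2 (Or.inl hx))
  have h2 := abs_lt.1 (Complex.abs_arg_lt_pi_div_two_iff.2 (Or.inl hy))
  rw [Complex.cpow_def_of_ne_zero hx0, Complex.cpow_def_of_ne_zero hy0,
    Complex.cpow_def_of_ne_zero (mul_ne_zero hx0 hy0), ← Complex.exp_add,
    Complex.log_mul hx0 hy0 ⟨by linarith, by linarith⟩, add_mul]

theorem cpow_half_ofReal {x : ℝ} (hx : 0 ≤ x) : (x : ℂ) ^ (1 / 2 : ℂ) = (√x : ℝ) := by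
  rw [Real.sqrt_eq_rpow, Complex.ofReal_cpow hx]; simp

theorem pi_div_re_pos {a : ℂ} (ha : 0 < a.re) : 0 < ((Real.pi : ℂ) / a).re := by
  rw [div_eq_mul_inv, Complex.re_ofReal_mul]
  exact mul_pos Real.pi_pos (inv_re_pos ha)

theorem fourierU_symm_coh (z : ℂ) :
    fourierU.symm (coh z) = Complex.exp (z ^ 2 / 2) • coh (Complex.I * z) := by
  rw [LinearIsometryEquiv.symm_apply_eq]
  refine Lp.ext ((coeFn_coh z).trans ?_)
  have h1 : (Complex.exp (z ^ 2 / 2) • coh (Complex.I * z) : L2) =ᵐ[volume]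
      fun q => Complex.exp (z ^ 2 / 2) * gfun (1 / 2) (Complex.I * z) q := by
    filter_upwards [Lp.coeFn_smul (Complex.exp (z ^ 2 / 2)) (coh (Complex.I * z)),
      coeFn_coh (Complex.I * z)] with q h1 h2
    rw [h1, Pi.smul_apply, h2, smul_eq_mul]
  refine ((coeFn_fourierU_gfun half_re_pos _ _ h1).trans (ae_of_all _ fun q => ?_)).symm
  have h2 : (Real.pi / (1 / 2) : ℂ) = ((2 * Real.pi : ℝ) : ℂ) := by push_cast; ring
  have h3 : ((√(2 * Real.pi) : ℝ) : ℂ) ≠ 0 := by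
    exact_mod_cast (Real.sqrt_pos.2 (by positivity)).ne'
  have h4 : (Complex.I * z) ^ 2 / (4 * (1 / 2)) = -(z ^ 2 / 2) := by
    rw [mul_pow, Complex.I_sq]; ring
  have h5 : -(Complex.I * (Complex.I * z)) / (2 * (1 / 2)) = z := by
    rw [← mul_assoc, Complex.I_mul_I]; ring
  dsimp only
  rw [h2, cpow_half_ofReal (by positivity), Complex.ofReal_inv, inv_mul_cancel₀ h3, one_mul, ← Complex.exp_add, h4, h5]
  norm_num

/-- This and the next two identities compare the quadratic, linear and constant coefficients of the
exponent in `isGaussianUnitary_fourierU`. There P/(8v) and Q/(8w) are `kerK` + 1/2 before and after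
the transform, and J stands for the imaginary unit. -/
theorem kernel_quadratic_identity {v w c J D P Q : ℂ} (hv : v ≠ 0) (hP0 : P ≠ 0) (hJ : J ^ 2 = -1)
    (hD : D = v * w - c ^ 2) (hP : P = 1 + 4 * D + 4 * v + 4 * c * J)
    (hQ : Q = 1 + 4 * D + 4 * w - 4 * c * J) :
    (1 + 4 * D - 4 * c * J) / (8 * v) - ((4 * D - 1) / (4 * v)) ^ 2 / (4 * (P / (8 * v))) =
      Q / (2 * P) := by
  have : (1 + 4 * D - 4 * c * J) * P - (4 * D - 1) ^ 2 = 4 * v * Q := by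
    subst hP hQ hD; grind
  field_simp
  linear_combination 128 * this

theorem kernel_linear_identity {v w c m p z J D P Q : ℂ} (hv : v ≠ 0) (hw : w ≠ 0) (hJ : J ^ 2 = -1)
    (hD : D = v * w - c ^ 2) (hP : P = 1 + 4 * D + 4 * v + 4 * c * J)
    (hQ : Q = 1 + 4 * D + 4 * w - 4 * c * J) :
    -J * ((m / (2 * v) + (p - c * m / v) * J) * P +
        (4 * D - 1) * ((m / (2 * v) - (p - c * m / v) * J) + J * z)) =
      (p / (2 * w) + (-m + c * p / w) * J) * Q +
        (4 * D - 1) * ((p / (2 * w) - (-m + c * p / w) * J) + z) := by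
  subst hP hQ hD; field_simp; grind

theorem kernel_const_identity {v w c m p z J D P Q : ℂ} (hv : v ≠ 0) (hw : w ≠ 0) (hJ : J ^ 2 = -1)
    (hD : D = v * w - c ^ 2) (hP : P = 1 + 4 * D + 4 * v + 4 * c * J)
    (hQ : Q = 1 + 4 * D + 4 * w - 4 * c * J) :
    (z ^ 2 / 2 - m ^ 2 / (2 * v) + p ^ 2 / (2 * w)) * 2 * P * Q +
        4 * v * (m / (2 * v) - (p - c * m / v) * J + J * z) ^ 2 * Q +
        ((m / (2 * v) + (p - c * m / v) * J) * P +
          (4 * D - 1) * ((m / (2 * v) - (p - c * m / v) * J) + J * z)) ^ 2 =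
      4 * w * (p / (2 * w) - (-m + c * p / w) * J + z) ^ 2 * P := by
  subst hP hQ hD; field_simp; grind

/-- A Gaussian state maps Gaussian wave functions to Gaussian wave functions. -/
theorem coeFn_gaussian_apply {ρ : L2 →L[ℂ] L2} {σ : Matrix (Fin 2) (Fin 2) ℝ} {d : Fin 2 → ℝ}
    (h : IsGaussianStateWith ρ σ d) {a b : ℂ} (ha : 0 < a.re) {ψ : L2}
    (hψ : ψ =ᵐ[volume] gfun a b) :
    ρ ψ =ᵐ[volume] fun q => kerN σ d * (Real.pi / (kerK σ + a)) ^ (1 / 2 : ℂ) *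
          Complex.exp ((kerL σ d + b) ^ 2 / (4 * (kerK σ + a))) *
        gfun (conj (kerK σ) - kerX σ ^ 2 / (4 * (kerK σ + a)))
          (conj (kerL σ d) + kerX σ * (kerL σ d + b) / (2 * (kerK σ + a))) q := by
  obtain ⟨hσ, -, hk⟩ := h
  filter_upwards [hk ψ] with q hq
  rw [hq, ← integral_gaussianKernel_gfun hσ ha b q]
  refine integral_congr_ae ?_
  filter_upwards [hψ] with q' hq'
  rw [hq']

/-- The transform rotates phase space by (q, p) ↦ (p, -q). By totality it suffices to follow a
coherent vector through the inverse transform, the Gaussian kernel and the transform: all three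
stages stay Gaussian, so only coefficients have to be compared. -/
theorem isGaussianUnitary_fourierU : IsGaussianUnitary fourierU := by
  rintro ρ ⟨σ, d, hσ, hρ, hk⟩
  have hv := posDef_pos hσ
  have hw : 0 < σ 1 1 := hσ.diag_pos
  have hD := hσ.det_pos
  have hsym : σ 1 0 = σ 0 1 := by simpa using hσ.1.apply 0 1
  have hdet : σ.det = σ 0 0 * σ 1 1 - σ 0 1 ^ 2 := by rw [Matrix.det_fin_two, hsym]; ring
  set σ' := covMat (σ 1 1) (-σ 0 1) σ.det with hσ'
  set d' : Fin 2 → ℝ := ![d 1, -d 0] with hd'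
  have hσp : σ'.PosDef := posDef_covMat hw hD _
  refine ⟨σ', d', isGaussianStateWith_of_coh hσp (isPositive_unitaryChannel _ hρ) fun z => ?_⟩
  rw [unitaryChannel_apply, fourierU_symm_coh, map_smul]
  have h1 := coeFn_gaussian_apply ⟨hσ, hρ, hk⟩ half_re_pos (coeFn_coh (Complex.I * z))
  have h2 : (Complex.exp (z ^ 2 / 2) • ρ (coh (Complex.I * z)) : L2) =ᵐ[volume] fun q =>
      Complex.exp (z ^ 2 / 2) * (kerN σ d * (Real.pi / (kerK σ + 1 / 2)) ^ (1 / 2 : ℂ) *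
          Complex.exp ((kerL σ d + Complex.I * z) ^ 2 / (4 * (kerK σ + 1 / 2)))) *
        gfun (conj (kerK σ) - kerX σ ^ 2 / (4 * (kerK σ + 1 / 2)))
          (conj (kerL σ d) + kerX σ * (kerL σ d + Complex.I * z) / (2 * (kerK σ + 1 / 2))) q := by
    filter_upwards [h1, Lp.coeFn_smul (Complex.exp (z ^ 2 / 2)) (ρ (coh (Complex.I * z)))]
      with q h3 h4
    rw [h4, Pi.smul_apply, h3, smul_eq_mul, mul_assoc (Complex.exp _)]
  refine (coeFn_fourierU_gfun (re_out_pos hσ half_re_pos) _ _ h2).trans (ae_of_all _ fun q => ?_)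
  dsimp only
  rw [integral_gaussianKernel_gfun hσp half_re_pos z q]
  obtain ⟨v, hve⟩ : ∃ v : ℂ, v = σ 0 0 := ⟨_, rfl⟩
  obtain ⟨w, hwe⟩ : ∃ w : ℂ, w = σ 1 1 := ⟨_, rfl⟩
  obtain ⟨c, hce⟩ : ∃ c : ℂ, c = σ 0 1 := ⟨_, rfl⟩
  obtain ⟨D, hDe⟩ : ∃ D : ℂ, D = σ.det := ⟨_, rfl⟩
  obtain ⟨m, hme⟩ : ∃ m : ℂ, m = d 0 := ⟨_, rfl⟩
  obtain ⟨p, hpe⟩ : ∃ p : ℂ, p = d 1 := ⟨_, rfl⟩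
  obtain ⟨P, hP⟩ : ∃ P : ℂ, P = 1 + 4 * D + 4 * v + 4 * c * Complex.I := ⟨_, rfl⟩
  obtain ⟨Q, hQ⟩ : ∃ Q : ℂ, Q = 1 + 4 * D + 4 * w - 4 * c * Complex.I := ⟨_, rfl⟩
  have hv0 : v ≠ 0 := by rw [hve]; exact_mod_cast hv.ne'
  have hw0 : w ≠ 0 := by rw [hwe]; exact_mod_cast hw.ne'
  have hDD : D = v * w - c ^ 2 := by rw [hDe, hve, hwe, hce, hdet]; push_cast; ring
  have hA : kerK σ + 1 / 2 = P / (8 * v) := by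
    simp only [kerK]; push_cast; rw [← hve, ← hce, ← hDe, hP]; field_simp; ring
  have hA' : kerK σ' + 1 / 2 = Q / (8 * w) := by
    simp only [kerK, hσ', det_covMat hw.ne', covMat_zero_zero, covMat_zero_one]
    push_cast; rw [← hwe, ← hce, ← hDe, hQ]; field_simp; ring
  have hX : (kerX σ : ℂ) = (4 * D - 1) / (4 * v) := by
    simp only [kerX]; push_cast; rw [← hve, ← hDe]
  have hX' : (kerX σ' : ℂ) = (4 * D - 1) / (4 * w) := by
    simp only [kerX, hσ', det_covMat hw.ne', covMat_zero_zero]; push_cast; rw [← hwe, ← hDe]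
  have hKc : conj (kerK σ) = (1 + 4 * D - 4 * c * Complex.I) / (8 * v) := by
    simp only [kerK, map_add, map_mul, Complex.conj_ofReal, Complex.conj_I]
    push_cast; rw [← hve, ← hce, ← hDe]; field_simp; ring
  have hKc' : conj (kerK σ') = (1 + 4 * D - 4 * (-c) * Complex.I) / (8 * w) := by
    simp only [kerK, map_add, map_mul, Complex.conj_ofReal, Complex.conj_I, hσ',
      det_covMat hw.ne', covMat_zero_zero, covMat_zero_one]
    push_cast; rw [← hwe, ← hce, ← hDe]; field_simp; ring
  have hL : kerL σ d = m / (2 * v) - (p - c * m / v) * Complex.I := by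
    simp only [kerL]; push_cast; rw [← hve, ← hce, ← hme, ← hpe]
  have hLc : conj (kerL σ d) = m / (2 * v) + (p - c * m / v) * Complex.I := by
    simp only [kerL, map_sub, map_mul, Complex.conj_ofReal, Complex.conj_I]
    push_cast; rw [← hve, ← hce, ← hme, ← hpe]; ring
  have hL' : kerL σ' d' = p / (2 * w) - (-m + c * p / w) * Complex.I := by
    simp only [kerL, hσ', hd', covMat_zero_zero, covMat_zero_one, Matrix.cons_val_zero,
      Matrix.cons_val_one]
    push_cast; rw [← hwe, ← hce, ← hme, ← hpe]; ring
  have hLc' : conj (kerL σ' d') = p / (2 * w) + (-m + c * p / w) * Complex.I := by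
    rw [hL', hwe, hme, hpe, hce]
    simp only [map_sub, map_add, map_neg, map_mul, map_div₀, Complex.conj_ofReal, Complex.conj_I,
      map_ofNat]
    ring
  have hre : 0 < (kerK σ + 1 / 2).re := by
    rw [Complex.add_re]; linarith [kerK_re_pos hσ, half_re_pos]
  have hre' : 0 < (kerK σ' + 1 / 2).re := by
    rw [Complex.add_re]; linarith [kerK_re_pos hσp, half_re_pos]
  have hP0 : P ≠ 0 := by
    intro h; rw [h, zero_div] at hA; exact ne_zero_of_re_pos hre hA
  have hQ0 : Q ≠ 0 := by
    intro h; rw [h, zero_div] at hA'; exact ne_zero_of_re_pos hre' hA'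
  have hq := kernel_quadratic_identity hv0 hP0 Complex.I_sq hDD hP hQ
  -- Rotating phase space exchanges v with w, and P with Q, and changes the sign of c, so the same
  -- identity gives the primed width.
  have hq' := kernel_quadratic_identity (v := w) (w := v) (c := -c) (D := D) (P := Q) (Q := P)
    hw0 hQ0 Complex.I_sq (by rw [hDD]; ring) (by rw [hQ]; ring) (by rw [hP]; ring)
  have hli := kernel_linear_identity (m := m) (p := p) (z := z) hv0 hw0 Complex.I_sq hDD hP hQ
  have hco := kernel_const_identity (m := m) (p := p) (z := z) hv0 hw0 Complex.I_sq hDD hP hQ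
  have hout := re_out_pos hσ half_re_pos
  have hA2 : conj (kerK σ) - kerX σ ^ 2 / (4 * (kerK σ + 1 / 2)) = Q / (2 * P) := by
    rw [hKc, hX, hA, hq]
  have hA2' : conj (kerK σ') - kerX σ' ^ 2 / (4 * (kerK σ' + 1 / 2)) = P / (2 * Q) := by
    rw [hKc', hX', hA', hq']
  set R := (m / (2 * v) + (p - c * m / v) * Complex.I) * P +
    (4 * D - 1) * (m / (2 * v) - (p - c * m / v) * Complex.I + Complex.I * z) with hR
  have hB2 : conj (kerL σ d) + kerX σ * (kerL σ d + Complex.I * z) / (2 * (kerK σ + 1 / 2)) =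
      R / P := by
    rw [hLc, hX, hL, hA, hR]; field_simp; ring
  have hB2' : conj (kerL σ' d') + kerX σ' * (kerL σ' d' + z) / (2 * (kerK σ' + 1 / 2)) =
      -Complex.I * R / Q := by
    rw [hli, hLc', hX', hL', hA']; field_simp; ring
  rw [hA2] at hout
  -- All the bases have positive real part, so the roots multiply without a sign ambiguity; both
  -- products of bases equal 16π²v/Q.
  have hroot : ((Real.pi : ℂ) / (kerK σ + 1 / 2)) ^ (1 / 2 : ℂ) *
      ((Real.pi : ℂ) / (Q / (2 * P))) ^ (1 / 2 : ℂ) =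
      (√(2 * Real.pi * σ 0 0) * (√(σ 1 1))⁻¹ : ℝ) *
        ((Real.pi : ℂ) / (kerK σ' + 1 / 2)) ^ (1 / 2 : ℂ) := by
    have h0 : √(2 * Real.pi * σ 0 0) * (√(σ 1 1))⁻¹ = √(2 * Real.pi * σ 0 0 / σ 1 1) := by
      rw [Real.sqrt_div' _ hw.le, div_eq_mul_inv]
    rw [h0, ← cpow_half_ofReal (by positivity), cpow_half_mul (pi_div_re_pos hre)
      (pi_div_re_pos hout), cpow_half_mul (by rw [Complex.ofReal_re]; positivity)
      (pi_div_re_pos hre'), hA, hA']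
    congr 1
    push_cast
    rw [← hve, ← hwe]
    field_simp
  have hexp : z ^ 2 / 2 + -m ^ 2 / (2 * v) + (kerL σ d + Complex.I * z) ^ 2 / (4 * (P / (8 * v))) +
      (R / P) ^ 2 / (4 * (Q / (2 * P))) =
      -p ^ 2 / (2 * w) + (kerL σ' d' + z) ^ 2 / (4 * (Q / (8 * w))) := by
    rw [hL, hL']
    have e1 : ∀ x : ℂ, x ^ 2 / (4 * (P / (8 * v))) = 4 * v * x ^ 2 * Q / (2 * P * Q) := by
      intro x; field_simp; ring
    have e2 : ∀ x : ℂ, x ^ 2 / (4 * (Q / (8 * w))) = 4 * w * x ^ 2 * P / (2 * P * Q) := by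
      intro x; field_simp; ring
    have e3 : (R / P) ^ 2 / (4 * (Q / (2 * P))) = R ^ 2 / (2 * P * Q) := by
      field_simp; ring
    rw [e1, e2, e3, ← hco]
    field_simp
    ring
  have hN : kerN σ d = (√(2 * Real.pi * σ 0 0))⁻¹ * Real.exp (-d 0 ^ 2 / (2 * σ 0 0)) := rfl
  have hN' : kerN σ' d' =
      (√(2 * Real.pi))⁻¹ * (√(σ 1 1))⁻¹ * Real.exp (-d 1 ^ 2 / (2 * σ 1 1)) := by
    rw [← mul_inv, ← Real.sqrt_mul (by positivity)]; rfl
  have hroots : √(2 * Real.pi * σ 0 0) ≠ 0 := (Real.sqrt_pos.2 (by positivity)).ne'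
  have hc1 : (1 / (4 * (Q / (2 * P))) : ℂ) = P / (2 * Q) := by field_simp; ring
  have hc2 : -(Complex.I * (R / P)) / (2 * (Q / (2 * P))) = -Complex.I * R / Q := by field_simp
  rw [hA2, hB2, hA2', hB2', hc1, hc2, hN, hN']
  congr 1
  have hexp' := congrArg Complex.exp hexp
  simp only [Complex.exp_add, ← hA, ← hA'] at hexp'
  rw [hme, hpe, hve, hwe] at hexp'
  push_cast at hroot ⊢
  have hr1 : ((√(2 * Real.pi * σ 0 0) : ℝ) : ℂ) ≠ 0 := by exact_mod_cast hroots
  generalize ((√(2 * Real.pi * σ 0 0) : ℝ) : ℂ) = r1 at *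
  calc _ = (r1⁻¹ * (((√(2 * Real.pi) : ℝ) : ℂ))⁻¹) *
        (((Real.pi : ℂ) / (kerK σ + 1 / 2)) ^ (1 / 2 : ℂ) *
          ((Real.pi : ℂ) / (Q / (2 * P))) ^ (1 / 2 : ℂ)) * (Complex.exp (z ^ 2 / 2) *
        Complex.exp (-(d 0 : ℂ) ^ 2 / (2 * (σ 0 0 : ℂ))) *
        Complex.exp ((kerL σ d + Complex.I * z) ^ 2 / (4 * (kerK σ + 1 / 2))) *
        Complex.exp ((R / P) ^ 2 / (4 * (Q / (2 * P))))) := by ring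
    _ = _ := by
      rw [hroot, hexp']
      field_simp

/-! ### Rank-one Gaussian states and Gaussian vectors. -/

open InnerProductSpace in
/-- The coherent state `|z⟩⟨z|` is a Gaussian state. -/
theorem isGaussianStateWith_coh (z : ℂ) :
    IsGaussianStateWith
      ((((√Real.pi)⁻¹ * Real.exp (-z.re ^ 2) : ℝ) : ℂ) • rankOne ℂ (coh z) (coh z))
      (covMat (1 / 2) 0 (1 / 4)) ![z.re, z.im] := by
  have hσ : (covMat (1 / 2) 0 (1 / 4)).PosDef := posDef_covMat (by norm_num) (by norm_num) 0
  have hdet : (covMat (1 / 2) 0 (1 / 4)).det = 1 / 4 := det_covMat (by norm_num) _ _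
  refine isGaussianStateWith_of_coh hσ ?_ fun y => ?_
  · refine (isPositive_rankOne_self (coh z)).smul_of_nonneg ?_
    rw [Complex.zero_le_real]; positivity
  · have hK : kerK (covMat (1 / 2) 0 (1 / 4)) = 1 / 2 := by
      simp only [kerK, hdet, covMat_zero_zero, covMat_zero_one]; norm_num
    have hX : kerX (covMat (1 / 2) 0 (1 / 4)) = 0 := by
      simp only [kerX, hdet]; norm_num
    have hL : kerL (covMat (1 / 2) 0 (1 / 4)) ![z.re, z.im] = conj z := by
      simp only [kerL, covMat_zero_zero, covMat_zero_one]
      apply Complex.ext <;> simp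
    have hN : kerN (covMat (1 / 2) 0 (1 / 4)) ![z.re, z.im] =
        (√Real.pi)⁻¹ * Real.exp (-z.re ^ 2) := by
      simp only [kerN, covMat_zero_zero, Matrix.cons_val_zero]
      rw [show 2 * Real.pi * (1 / 2) = Real.pi by ring, show 2 * (1 / 2 : ℝ) = 1 by ring, div_one]
    simp only [integral_gaussianKernel_gfun hσ half_re_pos, hK, hX, hL, hN]
    rw [smul_apply, rankOne_apply, inner_coh]
    filter_upwards [coeFn_coh z, Lp.coeFn_smul (((√Real.pi)⁻¹ * Real.exp (-z.re ^ 2) : ℝ) : ℂ)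
      (((√Real.pi : ℝ) * Complex.exp ((conj z + y) ^ 2 / 4)) • coh z),
      Lp.coeFn_smul ((√Real.pi : ℝ) * Complex.exp ((conj z + y) ^ 2 / 4)) (coh z)] with q h1 h2 h3
    rw [h2, Pi.smul_apply, h3, Pi.smul_apply, h1]
    have h4 : ((Real.pi : ℂ) / (1 / 2 + 1 / 2)) ^ (1 / 2 : ℂ) = (√Real.pi : ℝ) := by
      rw [← cpow_half_ofReal Real.pi_pos.le]; norm_num
    rw [h4]
    have h5 : conj (1 / 2 : ℂ) = 1 / 2 := by rw [map_div₀, map_one, map_ofNat]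
    rw [h5]
    simp
    norm_num
    ring

/-- Continuous functions that agree almost everywhere agree; moduli at 0, 1 and -1 then determine
the real parts. -/
theorem re_eq_of_gfun_ae_eq {a b a' b' k k' : ℂ} (hk : k ≠ 0)
    (h : (fun q => k * gfun a b q) =ᵐ[volume] fun q => k' * gfun a' b' q) :
    a.re = a'.re ∧ b.re = b'.re := by
  have h1 := (Continuous.ae_eq_iff_eq volume ((continuous_gfun a b).const_mul k)
    ((continuous_gfun a' b').const_mul k')).1 h
  have h2 : ∀ q : ℝ, ‖k‖ * Real.exp (-a.re * q ^ 2 + b.re * q) =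
      ‖k'‖ * Real.exp (-a'.re * q ^ 2 + b'.re * q) := fun q => by
    have := congrArg norm (congrFun h1 q)
    simpa only [norm_mul, norm_gfun] using this
  have h0 : ‖k‖ = ‖k'‖ := by simpa using h2 0
  have h3 : ∀ q : ℝ, -a.re * q ^ 2 + b.re * q = -a'.re * q ^ 2 + b'.re * q := fun q => by
    have := h2 q
    rw [← h0] at this
    exact Real.exp_injective (mul_left_cancel₀ (norm_ne_zero_iff.2 hk) this)
  have := h3 1
  have := h3 (-1)
  constructor <;> linarith

open InnerProductSpace in
/-- A vector whose projector is a Gaussian state is a Gaussian wave function. -/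
theorem exists_gvec_of_rankOne {σ : Matrix (Fin 2) (Fin 2) ℝ} {d : Fin 2 → ℝ} {c : ℂ} {ψ : L2}
    (h : IsGaussianStateWith (c • rankOne ℂ ψ ψ) σ d) :
    ∃ (a b k : ℂ) (ha : 0 < a.re), k ≠ 0 ∧ ψ = k • gvec ha b ∧ b.re = 2 * a.re * d 0 := by
  have hσ := h.1
  have hv := posDef_pos hσ
  have hA : 0 < (kerK σ + 1 / 2).re := by
    rw [Complex.add_re]; linarith [kerK_re_pos hσ, half_re_pos]
  set A2 := conj (kerK σ) - kerX σ ^ 2 / (4 * (kerK σ + 1 / 2)) with hA2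
  set B2 : ℂ → ℂ :=
    fun z => conj (kerL σ d) + kerX σ * (kerL σ d + z) / (2 * (kerK σ + 1 / 2)) with hB2
  have key : ∀ z, ∃ k : ℂ, k ≠ 0 ∧ ψ =ᵐ[volume] fun q => k * gfun A2 (B2 z) q := by
    intro z
    have h1 := coeFn_gaussian_apply h half_re_pos (coeFn_coh z)
    rw [smul_apply, rankOne_apply, smul_smul] at h1
    set C := kerN σ d * (Real.pi / (kerK σ + 1 / 2)) ^ (1 / 2 : ℂ) *
          Complex.exp ((kerL σ d + z) ^ 2 / (4 * (kerK σ + 1 / 2))) with hC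
    have hC0 : C ≠ 0 := by
      refine mul_ne_zero (mul_ne_zero ?_ ?_) (Complex.exp_ne_zero _)
      · exact_mod_cast (kerN_pos hσ).ne'
      · rw [Complex.cpow_ne_zero_iff]
        exact Or.inl (ne_zero_of_re_pos (pi_div_re_pos hA))
    -- The operator sends every coherent vector to a multiple of `ψ`, and by its Gaussian kernel to
    -- a nonzero Gaussian.
    set e := c * ⟪ψ, coh z⟫_ℂ with he
    have h2 : (fun q => e * ψ q) =ᵐ[volume] fun q => C * gfun A2 (B2 z) q := by
      filter_upwards [h1, Lp.coeFn_smul e ψ] with q h3 h4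
      rw [← h3, h4, Pi.smul_apply, smul_eq_mul]
    have he0 : e ≠ 0 := by
      intro he0
      obtain ⟨q, hq⟩ := h2.exists
      simp only [he0, zero_mul] at hq
      exact mul_ne_zero hC0 (gfun_ne_zero _ _ _) hq.symm
    refine ⟨e⁻¹ * C, mul_ne_zero (inv_ne_zero he0) hC0, ?_⟩
    filter_upwards [h2] with q hq
    rw [mul_assoc, ← hq, inv_mul_cancel_left₀ he0]
  obtain ⟨k0, hk0, hψ0⟩ := key 0
  obtain ⟨k1, -, hψ1⟩ := key 1
  -- The Gaussians obtained from z = 0 and z = 1 are both proportional to `ψ`, but their linear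
  -- coefficients differ by X/(2(K + 1/2)), whose real part vanishes only if X = 0.
  have hX : kerX σ = 0 := by
    have h2 := (re_eq_of_gfun_ae_eq hk0 (hψ0.symm.trans hψ1)).2
    have h3 : B2 1 = B2 0 + ((kerX σ / 2 : ℝ) : ℂ) * (kerK σ + 1 / 2)⁻¹ := by
      simp only [hB2]; push_cast
      have := ne_zero_of_re_pos hA
      field_simp; ring
    rw [h3, Complex.add_re (B2 0), Complex.re_ofReal_mul] at h2
    have h4 := inv_re_pos hA
    have h5 : kerX σ / 2 * ((kerK σ + 1 / 2)⁻¹).re = 0 := by linarith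
    rcases mul_eq_zero.1 h5 with h6 | h6
    · linarith
    · exact absurd h6 h4.ne'
  have hA2' : A2 = conj (kerK σ) := by rw [hA2, hX]; simp
  have hB2' : B2 0 = conj (kerL σ d) := by simp only [hB2, hX]; simp
  rw [hA2', hB2'] at hψ0
  refine ⟨conj (kerK σ), conj (kerL σ d), k0, by simpa using kerK_re_pos hσ, hk0, ?_, ?_⟩
  · refine Lp.ext (hψ0.trans ?_)
    filter_upwards [Lp.coeFn_smul k0 (gvec (a := conj (kerK σ)) (by simpa using kerK_re_pos hσ)
      (conj (kerL σ d))), coeFn_gvec (a := conj (kerK σ)) (by simpa using kerK_re_pos hσ)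
      (conj (kerL σ d))] with q h1 h2
    rw [h1, Pi.smul_apply, h2, smul_eq_mul]
  · have hD : σ.det = 1 / 4 := by
      rw [kerX, div_eq_zero_iff] at hX
      rcases hX with h | h <;> linarith
    have hL : (kerL σ d).re = d 0 / (2 * σ 0 0) := by
      simp only [kerL, Complex.sub_re, Complex.ofReal_re, Complex.re_ofReal_mul, Complex.I_re]; simp
    rw [Complex.conj_re, Complex.conj_re, kerK_re, hD, hL]
    field_simp; ring

open InnerProductSpace in
theorem unitaryChannel_rankOne (U : L2 ≃ₗᵢ[ℂ] L2) (c : ℂ) (ψ : L2) :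
    unitaryChannel U (c • rankOne ℂ ψ ψ) = c • rankOne ℂ (U ψ) (U ψ) := by
  ext1 χ
  rw [unitaryChannel_apply, smul_apply, smul_apply,
    rankOne_apply, rankOne_apply, map_smul, map_smul, ← U.inner_map_map ψ,
    LinearIsometryEquiv.apply_symm_apply]

theorem exists_gvec_of_isGaussianUnitary {U : L2 ≃ₗᵢ[ℂ] L2} (hU : IsGaussianUnitary U) (z : ℂ) :
    ∃ (a b k : ℂ) (ha : 0 < a.re), k ≠ 0 ∧ U (coh z) = k • gvec ha b := by
  obtain ⟨σ, d, h⟩ := hU _ ⟨_, _, isGaussianStateWith_coh z⟩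
  rw [unitaryChannel_rankOne] at h
  obtain ⟨a, b, k, ha, hk, h1, -⟩ :=
    exists_gvec_of_rankOne h
  exact ⟨a, b, k, ha, hk, h1⟩

/-! ### Rigidity: fixed width and affine linear coefficient. -/

/-- `⟪h, coh z⟫` is an entire function of `z`. -/
theorem differentiable_inner_coh (h : L2) : Differentiable ℂ fun z => ⟪h, coh z⟫_ℂ := by
  intro z₀
  have heq : (fun z => ⟪h, coh z⟫_ℂ) = fun z => ∫ q, conj (h q) * gfun (1 / 2) z q :=
    funext fun z => inner_eq_integral_of_ae (ae_eq_refl _) (coeFn_coh z)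
  rw [heq]
  have hmeas : ∀ f : ℝ → ℂ, Continuous f → AEStronglyMeasurable (fun q => conj (h q) * f q) :=
    fun f hf => (Complex.continuous_conj.comp_aestronglyMeasurable
      (Lp.aestronglyMeasurable h)).mul hf.aestronglyMeasurable
  -- One unit covers the ball of radius 1 around z₀, the other the factor |q| ≤ exp |q| from the
  -- derivative. The bound exp(c|q|) is split as exp(cq) + exp(-cq) to stay within Gaussian
  -- functions.
  set c := ‖z₀‖ + 2 with hc
  have key := hasDerivAt_integral_of_dominated_loc_of_deriv_le (μ := (volume : Measure ℝ)) (𝕜 := ℂ)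
    (F := fun z q => conj (h q) * gfun (1 / 2) z q)
    (F' := fun z q => conj (h q) * (q * gfun (1 / 2) z q)) (x₀ := z₀)
    (bound := fun q => ‖h q‖ * (‖gfun (1 / 2) c q‖ + ‖gfun (1 / 2) (-c) q‖))
    (Metric.ball_mem_nhds z₀ one_pos)
    (Eventually.of_forall fun z => hmeas _ (continuous_gfun _ _)) ?_ ?_ ?_ ?_ ?_
  · exact key.2.differentiableAt
  · exact (MemLp.star (Lp.memLp h)).integrable_mul (memLp_gfun half_re_pos z₀)
  · exact hmeas _ (Complex.continuous_ofReal.mul (continuous_gfun _ _))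
  · refine ae_of_all _ fun q z hz => ?_
    rw [norm_mul, RCLike.norm_conj, norm_mul, Complex.norm_real]
    refine mul_le_mul_of_nonneg_left ?_ (norm_nonneg _)
    have hz1 : |z.re| ≤ ‖z₀‖ + 1 := by
      rw [Metric.mem_ball, dist_eq_norm] at hz
      have h1 := Complex.abs_re_le_norm z
      have h2 := norm_le_norm_add_norm_sub' z z₀
      linarith
    have h1 : z.re * q ≤ (‖z₀‖ + 1) * |q| := by
      calc z.re * q ≤ |z.re * q| := le_abs_self _
        _ = |z.re| * |q| := abs_mul _ _
        _ ≤ _ := by gcongr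
    have h2 : ‖q‖ ≤ Real.exp |q| := by
      rw [Real.norm_eq_abs]; linarith [Real.add_one_le_exp |q|]
    have h3 : (1 / 2 : ℂ).re = 1 / 2 := by norm_num
    simp only [norm_gfun, h3, Complex.neg_re, Complex.ofReal_re]
    calc ‖q‖ * Real.exp (-(1 / 2) * q ^ 2 + z.re * q)
        ≤ Real.exp |q| * Real.exp (-(1 / 2) * q ^ 2 + (‖z₀‖ + 1) * |q|) := by gcongr
      _ = Real.exp (-(1 / 2) * q ^ 2 + c * |q|) := by rw [← Real.exp_add, hc]; ring_nf
      _ ≤ _ := by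
        rcases abs_cases q with ⟨hq, -⟩ | ⟨hq, -⟩
        · rw [hq]; exact le_add_of_nonneg_right (Real.exp_nonneg _)
        · rw [hq, show c * -q = -c * q by ring]; exact le_add_of_nonneg_left (Real.exp_nonneg _)
  · simp only [mul_add]
    exact ((Lp.memLp h).norm.integrable_mul (memLp_gfun half_re_pos _).norm).add
      ((Lp.memLp h).norm.integrable_mul (memLp_gfun half_re_pos _).norm)
  · refine ae_of_all _ fun q z _ => ?_
    have h1 : HasDerivAt (fun z => gfun (1 / 2) z q) (q * gfun (1 / 2) z q) z := by
      unfold gfun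
      have := (((hasDerivAt_id z).mul_const (q : ℂ)).const_add (-(1 / 2) * (q : ℂ) ^ 2)).cexp
      simpa [mul_comm] using this
    exact h1.const_mul _

/-- A small `t` brings both exponents into the strip where exp is injective. -/
theorem eq_of_exp_real_mul_eq {P Q : ℂ}
    (h : ∀ t : ℝ, Complex.exp (t * P) = Complex.exp (t * Q)) : P = Q := by
  set t : ℝ := (1 + ‖P‖ + ‖Q‖)⁻¹ with ht
  have hpos : 0 < 1 + ‖P‖ + ‖Q‖ := by positivity
  have ht0 : 0 < t := inv_pos.2 hpos
  have him : ∀ R : ℂ, ‖R‖ ≤ 1 + ‖P‖ + ‖Q‖ → |(t * R : ℂ).im| ≤ 1 := fun R hR => by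
    refine (Complex.abs_im_le_norm _).trans ?_
    rw [norm_mul, Complex.norm_real, Real.norm_of_nonneg ht0.le, ht, inv_mul_le_iff₀ hpos, mul_one]
    exact hR
  have h1 := abs_le.1 (him P (by linarith [norm_nonneg Q]))
  have h2 := abs_le.1 (him Q (by linarith [norm_nonneg P]))
  have h3 := Real.pi_gt_three
  have := Complex.exp_inj_of_neg_pi_lt_of_le_pi (by linarith) (by linarith) (by linarith)
    (by linarith) (h t)
  exact mul_left_cancel₀ (by exact_mod_cast ht0.ne') this

/-- A map preserving the coherent-state kernel `exp(conj w z / 2)` up to scale is complex linear. -/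
theorem exists_linear_of_exp_conj_mul {D : ℂ → ℂ} {r : ℝ} (hr : 0 < r)
    (h : ∀ w z, Complex.exp (conj (D w) * D z / (4 * r)) = Complex.exp (conj w * z / 2)) :
    ∃ b : ℂ, Complex.normSq b = 2 * r ∧ ∀ z, D z = b * z := by
  have hrc : (r : ℂ) ≠ 0 := by exact_mod_cast hr.ne'
  have hre : ∀ w z, (conj (D w) * D z / (4 * r)).re = (conj w * z / 2).re := fun w z => by
    have := congrArg norm (h w z)
    rw [Complex.norm_exp, Complex.norm_exp] at this
    exact Real.exp_injective this
  have hsq : ∀ z, Complex.normSq (D z) = 2 * r * Complex.normSq z := fun z => by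
    have h1 := hre z z
    rw [← Complex.normSq_eq_conj_mul_self, ← Complex.normSq_eq_conj_mul_self] at h1
    have h2 : ((Complex.normSq (D z) / (4 * r) : ℝ) : ℂ).re =
        ((Complex.normSq z / 2 : ℝ) : ℂ).re := by
      push_cast; exact h1
    rw [Complex.ofReal_re, Complex.ofReal_re] at h2
    field_simp at h2
    linarith
  have hu : Complex.normSq (D 1) = 2 * r := by simpa using hsq 1
  have hu0 : D 1 ≠ 0 := by
    intro h0; rw [h0, map_zero] at hu; linarith
  have huc : conj (D 1) * D 1 = 2 * r := by
    rw [← Complex.normSq_eq_conj_mul_self, hu]; push_cast; ring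
  -- Moduli alone give |D z|² = 2r|z|² and the real part of conj(D 1) D t. For real `t` these are
  -- the equality case of Cauchy–Schwarz, so the imaginary part vanishes.
  have hreal : ∀ t : ℝ, D t = D 1 * t := fun t => by
    set x := conj (D 1) * D t / (4 * r) with hx
    have h1 : x.re = t / 2 := by
      rw [hx, hre 1 t, map_one, one_mul]
      norm_num
    have h2 : Complex.normSq x = t ^ 2 / 4 := by
      rw [hx, Complex.normSq_div, Complex.normSq_mul, Complex.normSq_conj, hu, hsq,
        Complex.normSq_ofReal, Complex.normSq_mul, Complex.normSq_ofReal]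
      norm_num
      field_simp
      ring
    have h3 : x.im = 0 := by
      rw [Complex.normSq_apply, h1] at h2
      nlinarith
    have h4 : x = (t : ℂ) / 2 := by
      apply Complex.ext
      · rw [h1]; simp
      · rw [h3]; simp
    rw [hx] at h4
    refine mul_left_cancel₀ ((map_ne_zero _).2 hu0 : conj (D 1) ≠ 0) ?_
    rw [← mul_assoc, huc]
    field_simp at h4
    linear_combination 2⁻¹ * h4
  refine ⟨D 1, hu, fun z => ?_⟩
  have h1 : conj (D 1) * D z / (4 * r) = z / 2 := eq_of_exp_real_mul_eq fun t => by
    have h2 := h t z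
    rw [hreal, map_mul, Complex.conj_ofReal] at h2
    rw [show (t : ℂ) * (conj (D 1) * D z / (4 * r)) = conj (D 1) * t * D z / (4 * r) by ring, h2]
    ring_nf
  refine mul_left_cancel₀ ((map_ne_zero _).2 hu0 : conj (D 1) ≠ 0) ?_
  rw [← mul_assoc, huc]
  field_simp at h1
  linear_combination 2⁻¹ * h1

theorem inner_coh_gvec {a : ℂ} (ha : 0 < a.re) (w b : ℂ) :
    ⟪coh w, gvec ha b⟫_ℂ = (Real.pi / (1 / 2 + a)) ^ (1 / 2 : ℂ) *
      Complex.exp ((conj w + b) ^ 2 / (4 * (1 / 2 + a))) := by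
  rw [coh, inner_gvec, show conj (1 / 2 : ℂ) = 1 / 2 by rw [map_div₀, map_one, map_ofNat]]

/-- A Gaussian unitary maps coherent states to Gaussians of a fixed width whose linear coefficient
is an affine function of the label. -/
theorem exists_affine_of_isGaussianUnitary {U : L2 ≃ₗᵢ[ℂ] L2} (hU : IsGaussianUnitary U) :
    ∃ (a b b₀ : ℂ) (ha : 0 < a.re), Complex.normSq b = 2 * a.re ∧
      ∀ z, ∃ k : ℂ, k ≠ 0 ∧ U (coh z) = k • gvec ha (b₀ + b * z) := by
  choose A B k hA hk hU' using exists_gvec_of_isGaussianUnitary hU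
  have hA' : ∀ z, 0 < (1 / 2 + A z).re := fun z => by
    rw [Complex.add_re]; linarith [hA z, half_re_pos]
  have hne : ∀ z, (Real.pi / (1 / 2 + A z)) ^ (1 / 2 : ℂ) ≠ 0 := fun z => by
    rw [Complex.cpow_ne_zero_iff]
    exact Or.inl (ne_zero_of_re_pos (pi_div_re_pos (hA' z)))
  set F : ℂ → ℂ → ℂ := fun w z => ⟪coh w, U (coh z)⟫_ℂ with hF
  have hFe : ∀ w z, F w z = k z * (Real.pi / (1 / 2 + A z)) ^ (1 / 2 : ℂ) *
      Complex.exp ((conj w + B z) ^ 2 / (4 * (1 / 2 + A z))) := fun w z => by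
    simp only [hF]; rw [hU', inner_smul_right, inner_coh_gvec, mul_assoc]
  have hF0 : ∀ w z, F w z ≠ 0 := fun w z => by
    rw [hFe]; exact mul_ne_zero (mul_ne_zero (hk z) (hne z)) (Complex.exp_ne_zero _)
  have hFd : ∀ w, Differentiable ℂ (F w) := fun w => by
    have : F w = fun z => ⟪U.symm (coh w), coh z⟫_ℂ := funext fun z => by
      simp only [hF]; rw [← U.inner_map_map (U.symm (coh w)), LinearIsometryEquiv.apply_symm_apply]
    rw [this]; exact differentiable_inner_coh _
  set u : ℂ → ℂ := fun z => (2 * (1 / 2 + A z))⁻¹ with hu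
  -- A second difference in w: the unknown factor k(z) and linear coefficient B(z) cancel, leaving
  -- only the width A(z).
  have hG : ∀ z, F 1 z * F (-1) z / F 0 z ^ 2 = Complex.exp (u z) := fun z => by
    rw [div_eq_iff (pow_ne_zero 2 (hF0 0 z)), hFe, hFe, hFe]
    have := ne_zero_of_re_pos (hA' z)
    rw [show ∀ c x y : ℂ, c * x * (c * y) = c ^ 2 * (x * y) by intros; ring, ← Complex.exp_add,
      mul_pow _ (Complex.exp _), ← Complex.exp_nat_mul, mul_left_comm, ← Complex.exp_add]
    congr 2
    simp only [hu, map_one, map_neg, map_zero]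
    push_cast
    field_simp
    ring
  have hub : ∀ z, ‖u z‖ ≤ 1 := fun z => by
    simp only [hu]
    rw [norm_inv]
    refine inv_le_one_of_one_le₀ (le_trans ?_ (Complex.re_le_norm _))
    have h1 : (2 * (1 / 2 + A z)).re = 1 + 2 * (A z).re := by simp; ring
    rw [h1]; linarith [hA z]
  -- Liouville makes exp u constant, and |Im u| ≤ 1 < π makes u itself constant.
  have hconst : ∀ z, A z = A 0 := fun z => by
    have hd : Differentiable ℂ fun z => Complex.exp (u z) := by
      have : (fun z => Complex.exp (u z)) = fun z => F 1 z * F (-1) z / F 0 z ^ 2 :=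
        funext fun z => (hG z).symm
      rw [this]
      exact ((hFd 1).mul (hFd (-1))).div ((hFd 0).pow 2) fun z => pow_ne_zero 2 (hF0 0 z)
    have hb : Bornology.IsBounded (Set.range fun z => Complex.exp (u z)) := by
      rw [isBounded_iff_forall_norm_le]
      refine ⟨Real.exp 1, ?_⟩
      rintro _ ⟨z, rfl⟩
      rw [Complex.norm_exp]
      exact Real.exp_le_exp.2 ((Complex.re_le_norm _).trans (hub z))
    have h1 := hd.apply_eq_apply_of_bounded hb z 0
    have h2 := abs_le.1 ((Complex.abs_im_le_norm _).trans (hub z))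
    have h3 := abs_le.1 ((Complex.abs_im_le_norm _).trans (hub 0))
    have h4 := Real.pi_gt_three
    have h5 := Complex.exp_inj_of_neg_pi_lt_of_le_pi (by linarith) (by linarith) (by linarith)
      (by linarith) h1
    simp only [hu] at h5
    have h6 := mul_left_cancel₀ two_ne_zero (inv_injective h5)
    exact add_left_cancel h6
  obtain ⟨a, haa⟩ : ∃ a, a = A 0 := ⟨_, rfl⟩
  have ha : 0 < a.re := haa ▸ hA 0
  have hU2 : ∀ z, U (coh z) = k z • gvec ha (B z) := fun z => by
    rw [hU' z]; congr 2; rw [hconst z, haa]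
  have hrc : (a.re : ℂ) ≠ 0 := by exact_mod_cast ha.ne'
  have haa2 : conj a + a = 2 * a.re := by
    rw [add_comm, Complex.add_conj]; push_cast; rfl
  set E : ℂ → ℂ → ℂ := fun w z => conj (k w) * (k z * ((Real.pi / (2 * a.re)) ^ (1 / 2 : ℂ) *
        Complex.exp ((conj (B w) + B z) ^ 2 / (4 * (2 * a.re))))) with hE
  have hin : ∀ w z, E w z = (√Real.pi : ℝ) * Complex.exp ((conj w + z) ^ 2 / 4) := fun w z => by
    rw [← inner_coh, ← U.inner_map_map, hU2, hU2, inner_smul_left, inner_smul_right, inner_gvec,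
      haa2]
  -- The cross ratio E(w,z)E(0,0)/(E(w,0)E(0,z)) of inner products does not depend on the factors k.
  have hexp : ∀ w z, Complex.exp (conj (B w - B 0) * (B z - B 0) / (4 * a.re)) =
      Complex.exp (conj w * z / 2) := fun w z => by
    have h1 : E w z * E 0 0 =
        Complex.exp (conj (B w - B 0) * (B z - B 0) / (4 * a.re)) * (E w 0 * E 0 z) := by
      simp only [hE]
      rw [show ∀ a b c d e f g : ℂ, a * (b * (c * d)) * (e * (f * (c * g))) =
        (a * b * c * e * f * c) * (d * g) by intros; ring,
        show ∀ a b c d e f g x : ℂ, x * (a * (b * (c * d)) * (e * (f * (c * g)))) =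
        (a * f * c * e * b * c) * (x * d * g) by intros; ring, ← Complex.exp_add,
        ← Complex.exp_add, ← Complex.exp_add]
      congr 2
      rw [map_sub]
      field_simp
      ring
    rw [hin, hin, hin, hin] at h1
    have hpi : ((√Real.pi : ℝ) : ℂ) ≠ 0 := by
      exact_mod_cast (Real.sqrt_pos.2 Real.pi_pos).ne'
    have h2 : Complex.exp ((conj w + z) ^ 2 / 4) * Complex.exp ((conj 0 + 0) ^ 2 / 4) =
        Complex.exp (conj w * z / 2) *
          (Complex.exp ((conj w + 0) ^ 2 / 4) * Complex.exp ((conj 0 + z) ^ 2 / 4)) := by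
      rw [← Complex.exp_add, ← Complex.exp_add, ← Complex.exp_add, map_zero]
      congr 1; ring
    have h3 : Complex.exp ((conj w + 0) ^ 2 / 4) * Complex.exp ((conj 0 + z) ^ 2 / 4) ≠ 0 :=
      mul_ne_zero (Complex.exp_ne_zero _) (Complex.exp_ne_zero _)
    refine mul_right_cancel₀ h3 ?_
    rw [← h2]
    refine mul_left_cancel₀ (pow_ne_zero 2 hpi) ?_
    linear_combination -h1
  obtain ⟨b, hb, hlin⟩ := exists_linear_of_exp_conj_mul ha hexp
  refine ⟨a, b, B 0, ha, hb, fun z => ⟨k z, hk z, ?_⟩⟩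
  rw [hU2 z, ← hlin z, add_sub_cancel]

/-! ### Classification of Gaussian unitaries up to a phase. -/

/-- Two unitaries that agree on coherent states up to factors agree up to a phase. -/
theorem exists_phase_of_coh {U V : L2 ≃ₗᵢ[ℂ] L2}
    (h : ∀ z, ∃ k : ℂ, U (coh z) = k • V (coh z)) :
    ∃ θ : ℂ, conj θ * θ = 1 ∧ ∀ ψ, U ψ = θ • V ψ := by
  choose k hk using h
  -- Overlaps of coherent vectors never vanish, so unitarity ties every factor to the one at 0.
  have h1 : ∀ z, conj (k 0) * k z = 1 := fun z => by
    have h2 := U.inner_map_map (coh 0) (coh z)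
    rw [hk, hk, inner_smul_left, inner_smul_right, V.inner_map_map, ← mul_assoc] at h2
    refine mul_right_cancel₀ ?_ (h2.trans (one_mul _).symm)
    rw [inner_coh]
    refine mul_ne_zero ?_ (Complex.exp_ne_zero _)
    exact_mod_cast (Real.sqrt_pos.2 Real.pi_pos).ne'
  have h3 : conj (k 0) ≠ 0 := left_ne_zero_of_mul_eq_one (h1 0)
  have h4 : ∀ z, k z = k 0 := fun z => mul_left_cancel₀ h3 ((h1 z).trans (h1 0).symm)
  refine ⟨k 0, h1 0, fun ψ => ?_⟩
  have := clm_ext_coh (T := (U.toContinuousLinearEquiv.toContinuousLinearMap : L2 →L[ℂ] L2))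
    (T' := k 0 • (V.toContinuousLinearEquiv.toContinuousLinearMap : L2 →L[ℂ] L2)) fun z => by
      rw [smul_apply, ← h4 z]; exact hk z
  exact DFunLike.congr_fun this ψ

theorem continuous_quad (p₁ p₂ : ℝ) : Continuous fun q : ℝ => p₁ * q ^ 2 + p₂ * q := by fun_prop

/-- The unitary `ψ ↦ √|l| exp(i (p₁ q² + p₂ q)) ψ(l q + s)`. -/
def affineU (p₁ p₂ : ℝ) {l : ℝ} (hl : l ≠ 0) (s : ℝ) : L2 ≃ₗᵢ[ℂ] L2 :=
  wcomp (continuous_quad p₁ p₂) hl s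

/-- The unitary with kernel `√(|l| / 2π) exp(i (p₁ q² + p₂ q - l q q' + p₃ q'² + p₄ q'))`. -/
def chirpU (p₁ p₂ p₃ p₄ : ℝ) {l : ℝ} (hl : l ≠ 0) : L2 ≃ₗᵢ[ℂ] L2 :=
  (affineU p₃ p₄ one_ne_zero 0).trans (fourierU.trans (affineU p₁ p₂ hl 0))

theorem isGaussianUnitary_affineU (p₁ p₂ : ℝ) {l : ℝ} (hl : l ≠ 0) (s : ℝ) :
    IsGaussianUnitary (affineU p₁ p₂ hl s) :=
  isGaussianUnitary_wcomp _ (fun _ => rfl) hl s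

theorem isGaussianUnitary_chirpU (p₁ p₂ p₃ p₄ : ℝ) {l : ℝ} (hl : l ≠ 0) :
    IsGaussianUnitary (chirpU p₁ p₂ p₃ p₄ hl) :=
  isGaussianUnitary_trans (isGaussianUnitary_affineU p₃ p₄ one_ne_zero 0)
    (isGaussianUnitary_trans isGaussianUnitary_fourierU (isGaussianUnitary_affineU p₁ p₂ hl 0))

theorem coeFn_affineU_gfun (p₁ p₂ : ℝ) {l : ℝ} (hl : l ≠ 0) (s : ℝ) {ψ : L2} {c a b : ℂ}
    (hψ : ψ =ᵐ[volume] fun q => c * gfun a b q) :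
    affineU p₁ p₂ hl s ψ =ᵐ[volume] fun q => (√|l| : ℝ) * c * gfun a b s *
      gfun (a * l ^ 2 - Complex.I * p₁) (b * l - 2 * a * l * s + Complex.I * p₂) q := by
  refine (coeFn_wcomp_of_ae _ hl s hψ).trans (ae_of_all _ fun q => ?_)
  simp only [wfun, gfun]
  rw [mul_assoc, mul_assoc, mul_assoc, mul_left_comm (Complex.exp _), ← Complex.exp_add,
    ← Complex.exp_add]
  congr 3
  push_cast
  ring

theorem sqrt_abs_ne_zero {l : ℝ} (hl : l ≠ 0) : ((√|l| : ℝ) : ℂ) ≠ 0 := by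
  exact_mod_cast (Real.sqrt_pos.2 (abs_pos.2 hl)).ne'

theorem affineU_coh (p₁ p₂ : ℝ) {l : ℝ} (hl : l ≠ 0) (s : ℝ) (z : ℂ) :
    ∃ k : ℂ, k ≠ 0 ∧ affineU p₁ p₂ hl s (coh z) =ᵐ[volume] fun q =>
      k * gfun (l ^ 2 / 2 - Complex.I * p₁) (-(l * s) + Complex.I * p₂ + l * z) q := by
  have h1 : coh z =ᵐ[volume] fun q => 1 * gfun (1 / 2) z q := by simpa using coeFn_coh z
  have h2 := coeFn_affineU_gfun p₁ p₂ hl s h1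
  rw [show 1 / 2 * (l : ℂ) ^ 2 - Complex.I * p₁ = l ^ 2 / 2 - Complex.I * p₁ by ring,
    show z * (l : ℂ) - 2 * (1 / 2) * l * s + Complex.I * p₂ =
      -(l * s) + Complex.I * p₂ + l * z by ring] at h2
  exact ⟨_, mul_ne_zero (mul_ne_zero (sqrt_abs_ne_zero hl) one_ne_zero) (gfun_ne_zero _ _ _), h2⟩

theorem chirpU_coh (p₁ p₂ p₃ p₄ : ℝ) {l : ℝ} (hl : l ≠ 0) (z : ℂ) :
    ∃ k : ℂ, k ≠ 0 ∧ chirpU p₁ p₂ p₃ p₄ hl (coh z) =ᵐ[volume] fun q =>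
      k * gfun (l ^ 2 / (4 * (1 / 2 - Complex.I * p₃)) - Complex.I * p₁)
        (-(Complex.I * (z + Complex.I * p₄)) / (2 * (1 / 2 - Complex.I * p₃)) * l +
          Complex.I * p₂) q := by
  obtain ⟨k, hk, h1⟩ := affineU_coh p₃ p₄ one_ne_zero 0 z
  have e1 : ((1 : ℝ) : ℂ) ^ 2 / 2 - Complex.I * p₃ = 1 / 2 - Complex.I * p₃ := by simp
  have e2 : -(((1 : ℝ) : ℂ) * (0 : ℝ)) + Complex.I * p₄ + ((1 : ℝ) : ℂ) * z =
      z + Complex.I * p₄ := by simp; ring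
  rw [e1, e2] at h1
  have hre : 0 < (1 / 2 - Complex.I * p₃).re := by
    rw [mul_comm, Complex.sub_re, Complex.re_ofReal_mul, Complex.I_re]; norm_num
  have h2 := coeFn_fourierU_gfun hre _ _ h1
  have h3 := coeFn_affineU_gfun p₁ p₂ hl 0 h2
  rw [one_div_mul_eq_div, Complex.ofReal_zero, mul_zero (2 * _ * _), sub_zero] at h3
  refine ⟨_, mul_ne_zero (mul_ne_zero (sqrt_abs_ne_zero hl) (mul_ne_zero hk (mul_ne_zero
      (mul_ne_zero ?_ ?_) (Complex.exp_ne_zero _)))) (gfun_ne_zero _ _ _), h3⟩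
  · have : (√(2 * Real.pi))⁻¹ ≠ 0 := by positivity
    exact_mod_cast this
  · rw [Complex.cpow_ne_zero_iff]
    exact Or.inl (ne_zero_of_re_pos (pi_div_re_pos hre))

theorem exists_phase_of_gvec {U V : L2 ≃ₗᵢ[ℂ] L2} {a b b₀ : ℂ} (ha : 0 < a.re)
    (hU : ∀ z, ∃ k : ℂ, k ≠ 0 ∧ U (coh z) = k • gvec ha (b₀ + b * z))
    (hV : ∀ z, ∃ k : ℂ, k ≠ 0 ∧ V (coh z) =ᵐ[volume] fun q => k * gfun a (b₀ + b * z) q) :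
    ∃ θ : ℂ, conj θ * θ = 1 ∧ ∀ ψ, U ψ = θ • V ψ := by
  refine exists_phase_of_coh fun z => ?_
  obtain ⟨k, -, h1⟩ := hU z
  obtain ⟨k', hk', h2⟩ := hV z
  have h3 : V (coh z) = k' • gvec ha (b₀ + b * z) := by
    refine Lp.ext (h2.trans ?_)
    filter_upwards [Lp.coeFn_smul k' (gvec ha (b₀ + b * z)), coeFn_gvec ha (b₀ + b * z)]
      with q h4 h5
    rw [h4, Pi.smul_apply, h5, smul_eq_mul]
  exact ⟨k * k'⁻¹, by rw [h1, h3, smul_smul, mul_assoc, inv_mul_cancel₀ hk', mul_one]⟩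

/-- Every Gaussian unitary is, up to a phase, an affine substitution or a chirped Fourier
transform. -/
theorem affineU_or_chirpU_of_isGaussianUnitary {U : L2 ≃ₗᵢ[ℂ] L2} (hU : IsGaussianUnitary U) :
    (∃ (p₁ p₂ l s : ℝ) (θ : ℂ) (hl : l ≠ 0), conj θ * θ = 1 ∧
      ∀ ψ, U ψ = θ • affineU p₁ p₂ hl s ψ) ∨
    (∃ (p₁ p₂ p₃ p₄ l : ℝ) (θ : ℂ) (hl : l ≠ 0), conj θ * θ = 1 ∧
      ∀ ψ, U ψ = θ • chirpU p₁ p₂ p₃ p₄ hl ψ) := by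
  obtain ⟨a, b, b₀, ha, hb, h⟩ := exists_affine_of_isGaussianUnitary hU
  rw [Complex.normSq_apply] at hb
  by_cases him : b.im = 0
  · left
    rw [him] at hb
    have hl : b.re ≠ 0 := by rintro h0; rw [h0] at hb; linarith
    have hbr : (b.re : ℂ) = b := by apply Complex.ext <;> simp [him]
    -- Read off from `affineU_coh`: its linear coefficient has slope l, which must be b, and the
    -- width l²/2 agrees with Re a because |b|² = 2 Re a.
    refine ⟨-a.im, b₀.im, b.re, -b₀.re / b.re, ?_⟩
    obtain ⟨θ, h1, h2⟩ := exists_phase_of_gvec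
      (V := affineU (-a.im) b₀.im hl (-b₀.re / b.re)) ha h fun z => by
        obtain ⟨k, hk, h3⟩ := affineU_coh (-a.im) b₀.im hl (-b₀.re / b.re) z
        refine ⟨k, hk, h3.trans (ae_of_all _ fun q => ?_)⟩
        dsimp only
        congr 2
        · have : (b.re : ℂ) ^ 2 / 2 = (a.re : ℂ) := by
            rw [show a.re = b.re ^ 2 / 2 by linarith]; push_cast; ring
          rw [this]
          apply Complex.ext <;> simp
        · have h5 : -((b.re : ℂ) * (-b₀.re / b.re : ℝ)) + Complex.I * b₀.im = b₀ := by
            rw [← Complex.ofReal_mul, mul_div_cancel₀ _ hl]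
            apply Complex.ext <;> simp
          rw [h5, hbr]
    exact ⟨θ, hl, h1, h2⟩
  · right
    have hb0 : b ≠ 0 := by rintro rfl; simp at him
    have hbc : conj b ≠ 0 := (map_ne_zero _).2 hb0
    have himc : (b.im : ℂ) ≠ 0 := by exact_mod_cast him
    have hnsq : (b.re * b.re + b.im * b.im : ℝ) ≠ 0 := by rw [hb]; linarith
    -- By `chirpU_coh` the slope is -il/(1 - 2ip₃). Equating it with b gives 1/b = (2p₃ + i)/l,
    -- whose imaginary and real parts determine l and p₃; this is where Im b ≠ 0 is needed.
    set l : ℝ := -(b.re * b.re + b.im * b.im) / b.im with hl_def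
    set p₃ : ℝ := -b.re / (2 * b.im) with hp₃
    have hl : l ≠ 0 := div_ne_zero (neg_ne_zero.2 hnsq) him
    have ha1 : 1 / 2 - Complex.I * p₃ = Complex.I * conj b / (2 * b.im) := by
      rw [hp₃, eq_div_iff (by simpa using himc)]
      have hcb : conj b = b.re - b.im * Complex.I := by apply Complex.ext <;> simp
      rw [hcb]
      push_cast
      field_simp
      linear_combination (b.im : ℂ) * Complex.I_sq
    have hbb : ((b.re * b.re + b.im * b.im : ℝ) : ℂ) = conj b * b := by
      rw [← Complex.normSq_apply, Complex.normSq_eq_conj_mul_self]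
    have hlc : (l : ℂ) = -(conj b * b) / b.im := by
      rw [← hbb, hl_def]; push_cast; ring
    have hq : (l : ℂ) ^ 2 / (4 * (1 / 2 - Complex.I * p₃)) =
        -(Complex.I * b * (2 * a.re : ℝ)) / (2 * b.im) := by
      rw [ha1, hlc, ← hb, hbb]
      have := Complex.I_ne_zero
      field_simp
      rw [Complex.I_sq]; ring
    have hlin : ∀ x : ℂ, -(Complex.I * x) / (2 * (1 / 2 - Complex.I * p₃)) * l = b * x := by
      intro x
      rw [ha1, hlc]
      have := Complex.I_ne_zero
      field_simp
    have hqre : ((l : ℂ) ^ 2 / (4 * (1 / 2 - Complex.I * p₃))).re = a.re := by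
      have : -(Complex.I * b * (2 * a.re : ℝ)) / (2 * b.im) =
          ((-(a.re / b.im) : ℝ) : ℂ) * (Complex.I * b) := by
        push_cast; field_simp
      rw [hq, this, Complex.re_ofReal_mul, Complex.I_mul_re]
      field_simp
    set p₁ : ℝ := ((l : ℂ) ^ 2 / (4 * (1 / 2 - Complex.I * p₃))).im - a.im with hp₁
    set p₄ : ℝ := -b₀.re / b.im with hp₄
    set p₂ : ℝ := b₀.im - p₄ * b.re with hp₂
    obtain ⟨θ, h1, h2⟩ := exists_phase_of_gvec (V := chirpU p₁ p₂ p₃ p₄ hl) ha h fun z => by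
      obtain ⟨k, hk, h3⟩ := chirpU_coh p₁ p₂ p₃ p₄ hl z
      refine ⟨k, hk, h3.trans (ae_of_all _ fun q => ?_)⟩
      dsimp only
      congr 2
      · apply Complex.ext
        · rw [Complex.sub_re, hqre]; simp
        · rw [Complex.sub_im]; simp [hp₁]
      · rw [hlin]
        have : b₀ = b * (Complex.I * p₄) + Complex.I * p₂ := by
          apply Complex.ext
          · simp [hp₄]; field_simp
          · simp [hp₂]; ring
        conv_rhs => rw [this]
        ring
    exact ⟨p₁, p₂, p₃, p₄, l, θ, hl, h1, h2⟩

/-- An affine substitution that, up to a phase, is a channel without displacement of the position,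
has no offset. -/
theorem offset_eq_zero_of_noPositionDisplacement {U : L2 ≃ₗᵢ[ℂ] L2} {p₁ p₂ l s : ℝ} {θ : ℂ}
    (hl : l ≠ 0) (h : ∀ ψ, U ψ = θ • affineU p₁ p₂ hl s ψ)
    (hU : NoPositionDisplacement U) : s = 0 := by
  have h0 := isGaussianStateWith_coh 0
  rw [show ![(0 : ℂ).re, (0 : ℂ).im] = 0 by ext i; fin_cases i <;> simp] at h0
  obtain ⟨σ, d, hd, h1⟩ := hU _ _ h0
  rw [unitaryChannel_rankOne] at h1
  obtain ⟨a, b, k, ha, hk, h2, h3⟩ := exists_gvec_of_rankOne h1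
  rw [hd, mul_zero] at h3
  obtain ⟨k', hk', h4⟩ := affineU_coh p₁ p₂ hl s 0
  have h5 : (fun q => k * gfun a b q) =ᵐ[volume] fun q => (θ * k') *
      gfun (l ^ 2 / 2 - Complex.I * p₁) (-(l * s) + Complex.I * p₂ + l * 0) q := by
    have h6 := (h (coh 0)).symm.trans h2
    filter_upwards [h4, Lp.coeFn_smul θ (affineU p₁ p₂ hl s (coh 0)), Lp.coeFn_smul k (gvec ha b),
      coeFn_gvec ha b] with q h7 h8 h9 h10
    rw [h6, h9, Pi.smul_apply, h10, Pi.smul_apply, h7, smul_eq_mul, smul_eq_mul] at h8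
    rw [h8, mul_assoc]
  -- The image of the vacuum has linear coefficient with real part -ls, and mean position 0 requires
  -- this to vanish.
  have h6 := (re_eq_of_gfun_ae_eq hk h5).2
  rw [h3] at h6
  simp at h6
  tauto

/-! ### The channel kernel of a chirped Fourier transform. -/

theorem hasKernel_of_phase {U V : L2 ≃ₗᵢ[ℂ] L2} {θ : ℂ} (hθ : conj θ * θ = 1)
    (h : ∀ ψ, U ψ = θ • V ψ) {J : ℝ → ℝ → ℝ → ℝ → ℝ → ℂ} :
    HasKernel U J ↔ HasKernel V J := by
  have key : ∀ f₁ f₂ g₁ g₂ : L2, ⟪g₁, U f₁⟫_ℂ * ⟪U f₂, g₂⟫_ℂ = ⟪g₁, V f₁⟫_ℂ * ⟪V f₂, g₂⟫_ℂ := by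
    intro f₁ f₂ g₁ g₂
    rw [h, h, inner_smul_left, inner_smul_right]
    linear_combination ⟪g₁, V f₁⟫_ℂ * ⟪V f₂, g₂⟫_ℂ * hθ
  simp only [HasKernel, key]

/-- The change from two positions to relative and centre coordinates has Jacobian 1. -/
theorem integral_center_relative {A B : ℝ → ℂ} (hA : Integrable A) (hB : Integrable B) :
    ∫ x : ℝ, ∫ r : ℝ, A (r - x / 2) * B (r + x / 2) = (∫ q, A q) * ∫ q, B q := by
  have h1 : ∀ x : ℝ, ∫ r : ℝ, A (r - x / 2) * B (r + x / 2) = ∫ r : ℝ, A r * B (r + x) := by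
    intro x
    rw [← integral_sub_right_eq_self (fun r => A r * B (r + x)) (x / 2)]
    congr 1; ext r; congr 2; ring
  simp only [h1]
  have h2 : Integrable (fun p : ℝ × ℝ => A p.1 * B (p.1 + p.2)) (volume.prod volume) :=
    (measurePreserving_prod_add (volume : Measure ℝ) (volume : Measure ℝ)).integrable_comp_of_integrable
      (hA.mul_prod hB)
  rw [integral_integral_swap (f := fun x r => A r * B (r + x)) h2.swap]
  simp only [integral_const_mul]
  rw [← integral_mul_const]
  congr 1; ext r; congr 1
  exact integral_add_left_eq_self B r

theorem integral_center_relative_conj {A B : ℝ → ℂ} (hA : Integrable A) (hB : Integrable B) :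
    ∫ x : ℝ, ∫ r : ℝ, A (r - x / 2) * conj (B (r + x / 2)) = (∫ q, A q) * conj (∫ q, B q) := by
  have hB' : Integrable fun q => conj (B q) :=
    hB.mono (Complex.continuous_conj.comp_aestronglyMeasurable hB.1) (ae_of_all _ fun q => by simp)
  rw [integral_center_relative hA hB', integral_conj]

theorem IsTest.integrable {f : ℝ → ℂ} (hf : IsTest f) : Integrable f :=
  hf.1.continuous.integrable_of_hasCompactSupport hf.2

theorem IsTest.coeFn_toL2 {f : ℝ → ℂ} (hf : IsTest f) : hf.toL2 =ᵐ[volume] f :=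
  MemLp.coeFn_toLp _

/-- The integral kernel of `chirpU`. -/
def chirpKer (p₁ p₂ p₃ p₄ l : ℝ) (q q' : ℝ) : ℂ :=
  (√|l| * (√(2 * Real.pi))⁻¹ : ℝ) * Complex.exp
    (Complex.I * (p₁ * q ^ 2 + p₂ * q - l * q * q' + p₃ * q' ^ 2 + p₄ * q' : ℝ))

theorem coeFn_chirpU {f : ℝ → ℂ} (hf : IsTest f) (p₁ p₂ p₃ p₄ : ℝ) {l : ℝ} (hl : l ≠ 0) :
    chirpU p₁ p₂ p₃ p₄ hl hf.toL2 =ᵐ[volume]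
      fun q => ∫ q', chirpKer p₁ p₂ p₃ p₄ l q q' * f q' := by
  have h1 := coeFn_wcomp_of_ae (continuous_quad p₃ p₄) one_ne_zero 0 hf.coeFn_toL2
  have h2 : Integrable (wfun (fun q => p₃ * q ^ 2 + p₄ * q) 1 0 f) := by
    refine Integrable.mono hf.integrable (aestronglyMeasurable_wfun (continuous_quad p₃ p₄) one_ne_zero
      hf.integrable.1) (ae_of_all _ fun q => ?_)
    rw [norm_wfun]; simp
  refine (coeFn_wcomp_of_ae (continuous_quad p₁ p₂) hl 0 (coeFn_fourierU h2 h1)).trans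
    (ae_of_all _ fun q => ?_)
  simp only [wfun]
  rw [← integral_const_mul, ← integral_const_mul]
  congr 1; ext q'
  simp only [chirpKer, abs_one, Real.sqrt_one, one_mul, add_zero, Complex.ofReal_one]
  rw [show ∀ a b c d e g : ℂ, a * b * (c * (d * (e * g))) = a * c * (b * d * e) * g by
    intros; ring, ← Complex.exp_add, ← Complex.exp_add]
  push_cast
  congr 3
  ring

/-- In the phase difference, (r - x/2)² - (r + x/2)² = -2xr, and -lqq' contributes l(x_f r_i + x_i
r_f). Hence no squares survive, and `b2` and `b3` are both l. -/
theorem hasKernel_chirpU {p₁ p₂ p₃ p₄ l : ℝ} (hl : l ≠ 0) {κ : Coeffs ℝ} (ha1 : κ.a1 = 0)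
    (ha2 : κ.a2 = 0) (ha3 : κ.a3 = 0) (hb1 : κ.b1 = -2 * p₁) (hb2 : κ.b2 = l) (hb3 : κ.b3 = l)
    (hb4 : κ.b4 = -2 * p₃) (hc1 : κ.c1 = -p₂) (hc2 : κ.c2 = -p₄) :
    HasKernel (chirpU p₁ p₂ p₃ p₄ hl) (kernelG κ) := by
  intro f₁ f₂ g₁ g₂ hf₁ hf₂ hg₁ hg₂
  refine tendsto_const_nhds.congr fun ε => ?_
  set k := chirpKer p₁ p₂ p₃ p₄ l with hk
  have hkc : ∀ q, Continuous (k q) := fun q => by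
    simp only [hk]; unfold chirpKer; fun_prop
  have hkn : ∀ q q', ‖k q q'‖ = √|l| * (√(2 * Real.pi))⁻¹ := fun q q' => by
    simp only [hk]; unfold chirpKer
    rw [norm_mul, mul_comm Complex.I, Complex.norm_exp_ofReal_mul_I, mul_one, Complex.norm_real,
      Real.norm_of_nonneg (by positivity)]
  have hint : ∀ {f : ℝ → ℂ}, IsTest f → ∀ q, Integrable fun q' => k q q' * f q' :=
    fun hf q => hf.integrable.bdd_mul (hkc q).aestronglyMeasurable
      (ae_of_all _ fun q' => (hkn q q').le)
  have hJ : ∀ xf rf xi ri : ℝ, kernelG κ ε xf rf xi ri =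
      k (rf - xf / 2) (ri - xi / 2) * conj (k (rf + xf / 2) (ri + xi / 2)) := by
    intro xf rf xi ri
    simp only [hk, chirpKer, kernelG, map_mul, Complex.conj_ofReal, ← Complex.exp_conj]
    rw [show ∀ a b c : ℂ, a * b * (a * c) = (a * a) * (b * c) by intros; ring, ← Complex.exp_add,
      ← Complex.ofReal_mul]
    congr 2
    · rw [hb3, mul_mul_mul_comm, Real.mul_self_sqrt (abs_nonneg _), ← mul_inv,
        Real.mul_self_sqrt (by positivity), div_eq_mul_inv]
    · simp only [Coeffs.exponent, Coeffs.toComplex, ha1, ha2, ha3, hb1, hb2, hb3, hb4, hc1, hc2,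
        Complex.conj_I]
      push_cast
      ring
  have hV : ∀ {f g : ℝ → ℂ} (hf : IsTest f) (hg : IsTest g),
      Integrable (fun q => conj (g q) * ∫ q', k q q' * f q') ∧
      ∫ q, conj (g q) * ∫ q', k q q' * f q' = ⟪hg.toL2, chirpU p₁ p₂ p₃ p₄ hl hf.toL2⟫_ℂ := by
    intro f g hf hg
    have h1 := coeFn_chirpU hf p₁ p₂ p₃ p₄ hl
    refine ⟨?_, (inner_eq_integral_of_ae hg.coeFn_toL2 h1).symm⟩
    exact (MemLp.star hg.memLp).integrable_mul ((memLp_congr_ae h1).1 (Lp.memLp _))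
  have hinner : ∀ xf rf : ℝ, (∫ xi : ℝ, ∫ ri : ℝ, kernelG κ ε xf rf xi ri *
      (f₁ (ri - xi / 2) * conj (f₂ (ri + xi / 2))) *
          (conj (g₁ (rf - xf / 2)) * g₂ (rf + xf / 2))) =
      (conj (g₁ (rf - xf / 2)) * ∫ q', k (rf - xf / 2) q' * f₁ q') *
        conj (conj (g₂ (rf + xf / 2)) * ∫ q', k (rf + xf / 2) q' * f₂ q') := by
    intro xf rf
    have h1 := integral_center_relative_conj
      ((hint hf₁ (rf - xf / 2)).const_mul (conj (g₁ (rf - xf / 2))))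
      ((hint hf₂ (rf + xf / 2)).const_mul (conj (g₂ (rf + xf / 2))))
    rw [integral_const_mul, integral_const_mul] at h1
    rw [← h1]
    congr 1; ext xi; congr 1; ext ri
    rw [hJ]; simp only [map_mul, Complex.conj_conj]; ring
  simp only [hinner]
  rw [integral_center_relative_conj (hV hf₁ hg₁).1 (hV hf₂ hg₂).1, (hV hf₁ hg₁).2, (hV hf₂ hg₂).2, inner_conj_symm]

/-! ### The channel kernel of an affine substitution. -/

/-- A family of measurable functions that converges pointwise under a fixed bound. -/
structure DomConv {Z : Type*} [MeasurableSpace Z] (F : ℝ → Z → ℂ) (F₀ : Z → ℂ) (B : Z → ℝ) :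
    Prop where
  stronglyMeasurable : ∀ ε, StronglyMeasurable (F ε)
  norm_le : ∀ ε z, ‖F ε z‖ ≤ B z
  tendsto : ∀ z, Tendsto (fun ε => F ε z) (𝓝[>] 0) (𝓝 (F₀ z))

/-- Dominated convergence in one variable reproduces the same structure in the others, so it can be
iterated through nested integrals. -/
theorem DomConv.integral {Z : Type*} [MeasurableSpace Z] {F : ℝ → Z × ℝ → ℂ} {F₀ : Z × ℝ → ℂ}
    {A : Z → ℝ} {b : ℝ → ℝ} (h : DomConv F F₀ fun p => A p.1 * b p.2) (hb : Integrable b) :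
    DomConv (fun ε z => ∫ t, F ε (z, t)) (fun z => ∫ t, F₀ (z, t)) fun z => A z * ∫ t, b t where
  stronglyMeasurable ε := (h.stronglyMeasurable ε).integral_prod_right'
  norm_le ε z := by
    rw [← integral_const_mul]
    exact norm_integral_le_of_norm_le (hb.const_mul _) (ae_of_all _ fun t => h.norm_le ε (z, t))
  tendsto z := tendsto_integral_filter_of_dominated_convergence (fun t => A z * b t)
    (Eventually.of_forall fun ε =>
      ((h.stronglyMeasurable ε).comp_measurable measurable_prodMk_left).aestronglyMeasurable)
    (Eventually.of_forall fun ε => ae_of_all _ fun t => h.norm_le ε (z, t)) (hb.const_mul _)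
    (ae_of_all _ fun t => h.tendsto (z, t))

/-- The normalised Gaussian weight. -/
def weight (t : ℝ) : ℝ := (√Real.pi)⁻¹ * Real.exp (-t ^ 2)

theorem weight_nonneg (t : ℝ) : 0 ≤ weight t := by unfold weight; positivity

theorem continuous_weight : Continuous weight := by unfold weight; fun_prop

theorem integrable_weight : Integrable weight := by
  have h := (integrable_exp_neg_mul_sq one_pos).const_mul (√Real.pi)⁻¹
  simp only [neg_mul, one_mul] at h
  exact h

theorem integral_weight : ∫ t, weight t = 1 := by
  have h := integral_gaussian 1
  simp only [neg_mul, one_mul, div_one] at h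
  simp only [weight]
  rw [integral_const_mul, h, inv_mul_cancel₀ (by positivity)]

theorem deltaReg_mul (ε t : ℝ) (hε : ε ≠ 0) : deltaReg ε (ε * t) = ε⁻¹ * weight t := by
  simp only [deltaReg, weight, mul_inv, mul_div_cancel_left₀ t hε, mul_assoc]

/-- The substitution r = (a - εt)/η moves ε from the singular weight into the argument of `H`. -/
theorem integral_deltaReg_mul {η : ℝ} (hη : η ≠ 0) {ε : ℝ} (hε : 0 < ε) (a : ℝ) (H : ℝ → ℂ) :
    ∫ r, (deltaReg ε (a - η * r) : ℂ) * H r =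
      |η⁻¹| * ∫ t, (weight t : ℂ) * H ((a - ε * t) / η) := by
  have h := integral_comp_affine (-ε / η) (a / η)
    fun r => (deltaReg ε (a - η * r) : ℂ) * H r
  have h1 : ∀ t : ℝ, (deltaReg ε (a - η * (-ε / η * t + a / η)) : ℂ) * H (-ε / η * t + a / η) =
      ε⁻¹ * ((weight t : ℂ) * H ((a - ε * t) / η)) := by
    intro t
    have e1 : a - η * (-ε / η * t + a / η) = ε * t := by field_simp; ring
    have e2 : -ε / η * t + a / η = (a - ε * t) / η := by ring
    rw [e1, e2, deltaReg_mul _ _ hε.ne', Complex.ofReal_mul, Complex.ofReal_inv, mul_assoc]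
  simp only [h1] at h
  rw [integral_const_mul, Complex.real_smul, Complex.ofReal_inv] at h
  have hε' : (ε : ℂ) ≠ 0 := by exact_mod_cast hε.ne'
  rw [(inv_mul_eq_iff_eq_mul₀ hε').1 h, ← mul_assoc, ← mul_assoc, ← Complex.ofReal_mul, ← Complex.ofReal_mul]
  have : |η⁻¹| * ε * |(-ε / η)⁻¹| = 1 := by
    rw [abs_inv, abs_inv, abs_div, abs_neg, abs_of_pos hε]
    have := abs_ne_zero.2 hη
    field_simp
  rw [this]; simp

/-- The test functions in the pairing of a kernel, in centre and relative coordinates. -/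
def testProd (f₁ f₂ g₁ g₂ : ℝ → ℂ) (xf rf xi ri : ℝ) : ℂ :=
  (f₁ (ri - xi / 2) * conj (f₂ (ri + xi / 2))) * (conj (g₁ (rf - xf / 2)) * g₂ (rf + xf / 2))

theorem IsTest.exists_bound {f : ℝ → ℂ} (hf : IsTest f) : ∃ R, ∀ q, R < |q| → f q = 0 := by
  obtain ⟨R, hR⟩ := hf.2.isCompact.isBounded.subset_closedBall 0
  refine ⟨R, fun q hq => by_contra fun h => ?_⟩
  have := hR (subset_tsupport f h)
  simp at this
  linarith

theorem exists_testProd_support {f₁ f₂ g₁ g₂ : ℝ → ℂ} (hf₁ : IsTest f₁) (hf₂ : IsTest f₂)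
    (hg₁ : IsTest g₁) (hg₂ : IsTest g₂) : ∃ R, 0 < R ∧ ∀ xf rf xi ri : ℝ,
      testProd f₁ f₂ g₁ g₂ xf rf xi ri ≠ 0 → |xf| ≤ R ∧ |rf| ≤ R ∧ |xi| ≤ R ∧ |ri| ≤ R := by
  obtain ⟨R₁, h₁⟩ := hf₁.exists_bound
  obtain ⟨R₂, h₂⟩ := hf₂.exists_bound
  obtain ⟨R₃, h₃⟩ := hg₁.exists_bound
  obtain ⟨R₄, h₄⟩ := hg₂.exists_bound
  refine ⟨|R₁| + |R₂| + |R₃| + |R₄| + 1, by positivity, fun xf rf xi ri h => ?_⟩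
  have k₁ : |ri - xi / 2| ≤ R₁ := by
    by_contra hh; exact h (by simp [testProd, h₁ _ (not_le.1 hh)])
  have k₂ : |ri + xi / 2| ≤ R₂ := by
    by_contra hh; exact h (by simp [testProd, h₂ _ (not_le.1 hh)])
  have k₃ : |rf - xf / 2| ≤ R₃ := by
    by_contra hh; exact h (by simp [testProd, h₃ _ (not_le.1 hh)])
  have k₄ : |rf + xf / 2| ≤ R₄ := by
    by_contra hh; exact h (by simp [testProd, h₄ _ (not_le.1 hh)])
  have := le_abs_self R₁
  have := le_abs_self R₂
  have := le_abs_self R₃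
  have := le_abs_self R₄
  simp only [abs_le] at k₁ k₂ k₃ k₄ ⊢
  refine ⟨⟨?_, ?_⟩, ⟨?_, ?_⟩, ⟨?_, ?_⟩, ⟨?_, ?_⟩⟩ <;> linarith [abs_nonneg R₁, abs_nonneg R₂, abs_nonneg R₃, abs_nonneg R₄]

theorem continuous_exponent (κ : Coeffs ℂ) :
    Continuous fun z : ℝ × ℝ × ℝ × ℝ => κ.exponent z.1 z.2.1 z.2.2.1 z.2.2.2 := by
  unfold Coeffs.exponent; fun_prop

theorem continuous_testProd {f₁ f₂ g₁ g₂ : ℝ → ℂ} (hf₁ : IsTest f₁) (hf₂ : IsTest f₂)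
    (hg₁ : IsTest g₁) (hg₂ : IsTest g₂) :
    Continuous fun z : ℝ × ℝ × ℝ × ℝ => testProd f₁ f₂ g₁ g₂ z.1 z.2.1 z.2.2.1 z.2.2.2 := by
  have := hf₁.1.continuous
  have := hf₂.1.continuous
  have := hg₁.1.continuous
  have := hg₂.1.continuous
  unfold testProd; fun_prop

theorem exists_bound_exp_testProd {f₁ f₂ g₁ g₂ : ℝ → ℂ} (hf₁ : IsTest f₁) (hf₂ : IsTest f₂)
    (hg₁ : IsTest g₁) (hg₂ : IsTest g₂) (κ : Coeffs ℂ) : ∃ M R, 0 ≤ M ∧ ∀ xf rf xi ri : ℝ,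
      ‖Complex.exp (κ.exponent xf rf xi ri) * testProd f₁ f₂ g₁ g₂ xf rf xi ri‖ ≤
        M * (Set.Icc (-R) R).indicator 1 xf * (Set.Icc (-R) R).indicator 1 rf := by
  obtain ⟨R, hR, h⟩ := exists_testProd_support hf₁ hf₂ hg₁ hg₂
  have hK : IsCompact ((Set.Icc (-R) R) ×ˢ (Set.Icc (-R) R) ×ˢ (Set.Icc (-R) R) ×ˢ
      (Set.Icc (-R) R)) := isCompact_Icc.prod (isCompact_Icc.prod (isCompact_Icc.prod isCompact_Icc))
  obtain ⟨M, hM⟩ := hK.exists_bound_of_continuousOn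
    (((continuous_exponent κ).cexp).mul (continuous_testProd hf₁ hf₂ hg₁ hg₂)).continuousOn
  have hM0 : 0 ≤ M := (norm_nonneg _).trans (hM (0, 0, 0, 0) (by simp [hR.le]))
  refine ⟨M, R, hM0, fun xf rf xi ri => ?_⟩
  by_cases h0 : testProd f₁ f₂ g₁ g₂ xf rf xi ri = 0
  · rw [h0, mul_zero, norm_zero]
    exact mul_nonneg (mul_nonneg hM0 (Set.indicator_nonneg (by simp) _))
      (Set.indicator_nonneg (by simp) _)
  · obtain ⟨h1, h2, h3, h4⟩ := h _ _ _ _ h0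
    rw [Set.indicator_of_mem (Set.mem_Icc.2 (abs_le.1 h1)),
      Set.indicator_of_mem (Set.mem_Icc.2 (abs_le.1 h2))]
    simpa using hM (xf, rf, xi, ri) ⟨abs_le.1 h1, abs_le.1 h2, abs_le.1 h3, abs_le.1 h4⟩

theorem tendsto_kernelII {α β γ η s : ℝ} (hβ : β ≠ 0) (hη : η ≠ 0) (κ : Coeffs ℝ)
    {f₁ f₂ g₁ g₂ : ℝ → ℂ} (hf₁ : IsTest f₁) (hf₂ : IsTest f₂) (hg₁ : IsTest g₁) (hg₂ : IsTest g₂) :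
    Tendsto (fun ε : ℝ => ∫ xf : ℝ, ∫ rf : ℝ, ∫ xi : ℝ, ∫ ri : ℝ,
        kernelII α β γ η s κ ε xf rf xi ri * (f₁ (ri - xi / 2) * conj (f₂ (ri + xi / 2))) *
          (conj (g₁ (rf - xf / 2)) * g₂ (rf + xf / 2))) (𝓝[>] 0)
      (𝓝 ((|γ / η| : ℝ) * ∫ xf : ℝ, ∫ rf : ℝ,
        Complex.exp (κ.toComplex.exponent xf rf (α * xf / β) ((γ * rf - s) / η)) *
          testProd f₁ f₂ g₁ g₂ xf rf (α * xf / β) ((γ * rf - s) / η))) := by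
  set G : ℝ → ℝ → ℝ → ℝ → ℂ := fun xf rf xi ri =>
    Complex.exp (κ.toComplex.exponent xf rf xi ri) * testProd f₁ f₂ g₁ g₂ xf rf xi ri with hG
  have hGc : Continuous fun z : ℝ × ℝ × ℝ × ℝ => G z.1 z.2.1 z.2.2.1 z.2.2.2 :=
    ((continuous_exponent _).cexp).mul (continuous_testProd hf₁ hf₂ hg₁ hg₂)
  obtain ⟨M, R, hM, hb⟩ := exists_bound_exp_testProd hf₁ hf₂ hg₁ hg₂ κ.toComplex
  -- The integrand after both deltas are rescaled: continuous also at ε = 0, and dominated by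
  -- indicators in x_f, r_f and Gaussian weights in the other two variables. The factor `Unit` is
  -- what remains after four applications of `DomConv.integral`.
  let F : ℝ → (((Unit × ℝ) × ℝ) × ℝ) × ℝ → ℂ := fun ε p =>
    (weight p.1.2 : ℂ) * ((weight p.2 : ℂ) *
      G p.1.1.1.2 p.1.1.2 ((α * p.1.1.1.2 - ε * p.1.2) / β) ((γ * p.1.1.2 - s - ε * p.2) / η))
  have hw := continuous_weight
  have hFc : Continuous fun z : ℝ × ((((Unit × ℝ) × ℝ) × ℝ) × ℝ) => F z.1 z.2 := by
    refine Continuous.mul (by fun_prop) (Continuous.mul (by fun_prop) ?_)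
    exact hGc.comp (f := fun z : ℝ × ((((Unit × ℝ) × ℝ) × ℝ) × ℝ) => (z.2.1.1.1.2, z.2.1.1.2,
      (α * z.2.1.1.1.2 - z.1 * z.2.1.2) / β, (γ * z.2.1.1.2 - s - z.1 * z.2.2) / η)) (by fun_prop)
  have hD : DomConv F (F 0) fun p => M * (Set.Icc (-R) R).indicator 1 p.1.1.1.2 *
      (Set.Icc (-R) R).indicator 1 p.1.1.2 * weight p.1.2 * weight p.2 := by
    refine ⟨fun ε => (hFc.comp (Continuous.prodMk_right ε)).stronglyMeasurable, fun ε p => ?_,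
      fun p => ?_⟩
    · simp only [F, norm_mul, Complex.norm_real, Real.norm_of_nonneg (weight_nonneg _)]
      calc _ ≤ weight p.1.2 * (weight p.2 * (M * (Set.Icc (-R) R).indicator 1 p.1.1.1.2 *
            (Set.Icc (-R) R).indicator 1 p.1.1.2)) :=
            mul_le_mul_of_nonneg_left (mul_le_mul_of_nonneg_left (hb _ _ _ _) (weight_nonneg _))
              (weight_nonneg _)
        _ = _ := by ring
    · exact ((hFc.comp (Continuous.prodMk_left p)).tendsto 0).mono_left nhdsWithin_le_nhds
  have hI : Integrable ((Set.Icc (-R) R).indicator (1 : ℝ → ℝ)) :=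
    (integrable_indicator_iff measurableSet_Icc).2 (integrableOn_const (by simp))
  set c := ∫ t, (Set.Icc (-R) R).indicator (1 : ℝ → ℝ) t
  have D1 := hD.integral (A := fun z : ((Unit × ℝ) × ℝ) × ℝ => M * (Set.Icc (-R) R).indicator 1 z.1.1.2 *
    (Set.Icc (-R) R).indicator 1 z.1.2 * weight z.2) integrable_weight
  simp only [integral_weight, mul_one] at D1
  have D2 := D1.integral (A := fun z : (Unit × ℝ) × ℝ => M * (Set.Icc (-R) R).indicator 1 z.1.2 *
    (Set.Icc (-R) R).indicator 1 z.2) integrable_weight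
  simp only [integral_weight, mul_one] at D2
  have D3 := D2.integral (A := fun z : Unit × ℝ => M * (Set.Icc (-R) R).indicator 1 z.2) hI
  have hB : (fun z : Unit × ℝ => M * (Set.Icc (-R) R).indicator 1 z.2 * c) =
      fun p => M * c * (Set.Icc (-R) R).indicator 1 p.2 := by ext z; ring
  rw [hB] at D3
  have D4 := (D3.integral (A := fun _ : Unit => M * c) hI).tendsto ()
  have e0 : ∀ xf rf : ℝ, ∫ u : ℝ, ∫ t : ℝ, F 0 (((((), xf), rf), u), t) =
      G xf rf (α * xf / β) ((γ * rf - s) / η) := by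
    intro xf rf
    simp only [F, zero_mul, sub_zero]
    simp only [integral_mul_const, integral_const_mul, integral_complex_ofReal, integral_weight,
      Complex.ofReal_one, one_mul]
  simp only [e0] at D4
  refine (D4.const_mul ((|γ / η| : ℝ) : ℂ)).congr' ?_
  filter_upwards [self_mem_nhdsWithin] with ε hε
  have e1 : ∀ xf rf xi : ℝ, (∫ ri : ℝ,
      kernelII α β γ η s κ ε xf rf xi ri * (f₁ (ri - xi / 2) * conj (f₂ (ri + xi / 2))) *
        (conj (g₁ (rf - xf / 2)) * g₂ (rf + xf / 2))) = (deltaReg ε (α * xf - β * xi) : ℂ) *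
      (|β * γ| * (|η⁻¹| * ∫ t, (weight t : ℂ) * G xf rf xi ((γ * rf - s - ε * t) / η))) := by
    intro xf rf xi
    rw [← integral_deltaReg_mul hη hε, ← integral_const_mul, ← integral_const_mul]
    congr 1; ext ri
    simp only [kernelII, hG, testProd]
    push_cast
    rw [show γ * rf - η * ri - s = γ * rf - s - η * ri by ring]
    ring
  simp only [e1, integral_deltaReg_mul hβ hε]
  simp only [F, ← integral_const_mul]
  congr 1; ext xf; congr 1; ext rf; congr 1; ext u; congr 1; ext t
  rw [show ∀ a b c d e g : ℂ, a * (b * (c * (d * (e * g)))) = a * c * d * (b * (e * g)) by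
    intros; ring]
  congr 1
  rw [abs_mul, abs_inv, abs_inv, abs_div]
  have : ((|β| : ℝ) : ℂ) ≠ 0 := by exact_mod_cast abs_ne_zero.2 hβ
  push_cast
  field_simp

/-- The deltas set x_i = l x_f and r_i = l r_f + t, that is, q' = lq + t for both positions. Only
the exponent on this set matters, and it must be i times the difference of the phase φ at r - x/2
and r + x/2. -/
theorem hasKernel_affineU {p₁ p₂ l t : ℝ} (hl : l ≠ 0) {α β γ η s : ℝ} {κ : Coeffs ℝ} (hβ : β ≠ 0)
    (hη : η ≠ 0) (hl1 : α / β = l) (hl2 : γ / η = l) (ht : -s / η = t)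
    (h : ∀ xf rf : ℝ, κ.toComplex.exponent xf rf (l * xf) (l * rf + t) =
      -(Complex.I * (2 * p₁ * xf * rf + p₂ * xf : ℝ))) :
    HasKernel (affineU p₁ p₂ hl t) (kernelII α β γ η s κ) := by
  intro f₁ f₂ g₁ g₂ hf₁ hf₂ hg₁ hg₂
  have hlim := tendsto_kernelII (α := α) (γ := γ) (s := s) hβ hη κ hf₁ hf₂ hg₁ hg₂
  set φ : ℝ → ℝ := fun q => p₁ * q ^ 2 + p₂ * q
  have hV : ∀ {f g : ℝ → ℂ} (hf : IsTest f) (hg : IsTest g),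
      Integrable (fun q => conj (g q) * wfun φ l t f q) ∧
      ∫ q, conj (g q) * wfun φ l t f q = ⟪hg.toL2, affineU p₁ p₂ hl t hf.toL2⟫_ℂ := by
    intro f g hf hg
    refine ⟨(MemLp.star hg.memLp).integrable_mul (memLp_wfun (continuous_quad p₁ p₂) hl hf.memLp),
      (inner_eq_integral_of_ae hg.coeFn_toL2
        (coeFn_wcomp_of_ae (continuous_quad p₁ p₂) hl t hf.coeFn_toL2)).symm⟩
  rw [← (hV hf₁ hg₁).2, ← inner_conj_symm, ← (hV hf₂ hg₂).2,
    ← integral_center_relative_conj (hV hf₁ hg₁).1 (hV hf₂ hg₂).1]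
  convert hlim using 2
  rw [← integral_const_mul]
  congr 1; ext xf
  rw [← integral_const_mul]
  congr 1; ext rf
  rw [show α * xf / β = l * xf by rw [← hl1]; ring,
    show (γ * rf - s) / η = l * rf + t by rw [← hl2, ← ht]; ring, h, hl2, testProd]
  simp only [wfun, map_mul, Complex.conj_conj, Complex.conj_ofReal, ← Complex.exp_conj,
    Complex.conj_I]
  rw [show l * (rf - xf / 2) + t = l * rf + t - l * xf / 2 by ring,
    show l * (rf + xf / 2) + t = l * rf + t + l * xf / 2 by ring,
    show ((|l| : ℝ) : ℂ) = (√|l| : ℝ) * (√|l| : ℝ) by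
      rw [← Complex.ofReal_mul, Real.mul_self_sqrt (abs_nonneg l)],
    show -(Complex.I * (2 * p₁ * xf * rf + p₂ * xf : ℝ)) =
      Complex.I * φ (rf - xf / 2) + -Complex.I * φ (rf + xf / 2) by
        simp only [φ]; push_cast; ring, Complex.exp_add]
  ring

/-! ### The forms of Gaussian unitary kernels, and the converse. -/

theorem exists_kernel_of_isGaussianUnitary {U : L2 ≃ₗᵢ[ℂ] L2} (hU : IsGaussianUnitary U) :
    (∃ κ : Coeffs ℝ, κ.a1 = 0 ∧ κ.a2 = 0 ∧ κ.a3 = 0 ∧ κ.b3 ≠ 0 ∧ κ.b2 = κ.b3 ∧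
      HasKernel U (kernelG κ)) ∨
    (∃ (α β γ η s : ℝ) (κ : Coeffs ℝ), κ.a1 = 0 ∧ κ.a2 = 0 ∧ κ.a3 = 0 ∧
      κ.e1 = 0 ∧ κ.e2 = 0 ∧ κ.e3 = 0 ∧ κ.d1 = 0 ∧ κ.d2 = 0 ∧
      β ≠ 0 ∧ γ ≠ 0 ∧ α * η = β * γ ∧ (NoPositionDisplacement U → s = 0) ∧
      HasKernel U (kernelII α β γ η s κ)) := by
  rcases affineU_or_chirpU_of_isGaussianUnitary hU with ⟨p₁, p₂, l, s, θ, hl, hθ, h⟩ |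
    ⟨p₁, p₂, p₃, p₄, l, θ, hl, hθ, h⟩
  · refine Or.inr ⟨l, 1, l, 1, -s, ⟨0, 0, 0, -2 * p₁, 0, 0, 0, -p₂, 0, 0, 0, 0, 0, 0⟩, rfl, rfl,
      rfl, rfl, rfl, rfl, rfl, rfl, one_ne_zero, hl, by ring, fun hn => ?_, ?_⟩
    · rw [offset_eq_zero_of_noPositionDisplacement hl h hn, neg_zero]
    · rw [hasKernel_of_phase hθ h]
      refine hasKernel_affineU hl one_ne_zero one_ne_zero (by simp) (by simp) (by simp)
        fun xf rf => ?_
      simp only [Coeffs.exponent, Coeffs.toComplex]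
      push_cast
      ring
  · refine Or.inl ⟨⟨0, 0, 0, -2 * p₁, l, l, -2 * p₃, -p₂, -p₄, 0, 0, 0, 0, 0⟩, rfl, rfl,
      rfl, hl, rfl, ?_⟩
    rw [hasKernel_of_phase hθ h]
    exact hasKernel_chirpU hl rfl rfl rfl rfl rfl rfl rfl rfl rfl

theorem exists_isGaussianUnitary_kernelG {κ : Coeffs ℝ} (ha1 : κ.a1 = 0) (ha2 : κ.a2 = 0)
    (ha3 : κ.a3 = 0) (hb : κ.b3 ≠ 0) (hbb : κ.b2 = κ.b3) :
    ∃ U : L2 ≃ₗᵢ[ℂ] L2, IsGaussianUnitary U ∧ HasKernel U (kernelG κ) :=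
  ⟨chirpU (-κ.b1 / 2) (-κ.c1) (-κ.b4 / 2) (-κ.c2) hb, isGaussianUnitary_chirpU _ _ _ _ hb,
    hasKernel_chirpU hb ha1 ha2 ha3 (by ring) hbb rfl (by ring) (by ring) (by ring)⟩

theorem exists_isGaussianUnitary_kernelII {α β γ η : ℝ} {κ : Coeffs ℝ} (hβ : β ≠ 0) (hγ : γ ≠ 0)
    (he : κ.e1 * (η / γ) ^ 2 + κ.e2 * (η / γ) + κ.e3 = 0) (hd : κ.d1 * (η / γ) + κ.d2 = 0)
    (ha1 : κ.a1 = 0) (ha2 : κ.a2 = 0) (ha3 : κ.a3 = 0) (hαη : α * η = β * γ) :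
    ∃ U : L2 ≃ₗᵢ[ℂ] L2, IsGaussianUnitary U ∧ HasKernel U (kernelII α β γ η 0 κ) := by
  have hη : η ≠ 0 := by rintro rfl; simp_all
  have hl : γ / η ≠ 0 := div_ne_zero hγ hη
  set l := γ / η with hl_def
  refine ⟨affineU (-(κ.b1 + κ.b2 * l + κ.b3 * l + κ.b4 * l ^ 2) / 2) (-(κ.c1 + κ.c2 * l)) hl 0,
    isGaussianUnitary_affineU _ _ hl 0, hasKernel_affineU hl hβ hη ?_ rfl (by simp) fun xf rf => ?_⟩
  · rw [hl_def]; field_simp; linarith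
  · have hη' : η / γ = l⁻¹ := by rw [hl_def, inv_div]
    rw [hη'] at he hd
    -- With l = γ/η, the trace conditions say exactly that the real terms of the exponent cancel on
    -- the support r_i = l r_f.
    have he' : κ.e1 + κ.e2 * l + κ.e3 * l ^ 2 = 0 := by field_simp at he; linarith
    have hd' : κ.d1 + κ.d2 * l = 0 := by field_simp at hd; linarith
    have he'' : (κ.e1 + κ.e2 * l + κ.e3 * l ^ 2 : ℂ) = 0 := by exact_mod_cast he'
    have hd'' : (κ.d1 + κ.d2 * l : ℂ) = 0 := by exact_mod_cast hd'
    simp only [Coeffs.exponent, Coeffs.toComplex, ha1, ha2, ha3]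
    push_cast
    linear_combination (-(rf : ℂ) ^ 2) * he'' - rf * hd''

/-! ### The noise of a trace-preserving one-delta operation. -/

/-- The regularised delta picks out the value of a continuous function of Gaussian growth. -/
theorem tendsto_integral_deltaReg_mul {h : ℝ → ℂ} (hc : Continuous h) {K k : ℝ} (hk : 0 ≤ k)
    (hb : ∀ y, ‖h y‖ ≤ K * Real.exp (k * y ^ 2)) {β : ℝ} (hβ : β ≠ 0) (a : ℝ) :
    Tendsto (fun ε => ∫ x, (deltaReg ε (a - β * x) : ℂ) * h x) (𝓝[>] 0)
      (𝓝 (|β⁻¹| * h (a / β))) := by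
  have h1 : Tendsto (fun ε : ℝ => ∫ t, (weight t : ℂ) * h ((a - ε * t) / β)) (𝓝[>] 0)
      (𝓝 (∫ t, (weight t : ℂ) * h ((a - 0 * t) / β))) := by
    have hK : 0 ≤ K := by simpa using (norm_nonneg _).trans (hb 0)
    refine tendsto_integral_filter_of_dominated_convergence
      (fun t => (√Real.pi)⁻¹ * K * Real.exp (2 * k * a ^ 2 / β ^ 2) * Real.exp (-(1 / 2) * t ^ 2))
      (Eventually.of_forall fun ε => ?_) ?_
      ((integrable_exp_neg_mul_sq (by norm_num)).const_mul _) (ae_of_all _ fun t => ?_)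
    · have := continuous_weight
      exact Continuous.aestronglyMeasurable (by fun_prop)
    · have hev : ∀ᶠ ε : ℝ in 𝓝[>] 0, 2 * k * ε ^ 2 / β ^ 2 < 1 / 2 := by
        have : Tendsto (fun ε : ℝ => 2 * k * ε ^ 2 / β ^ 2) (𝓝[>] 0)
            (𝓝 (2 * k * 0 ^ 2 / β ^ 2)) :=
          (Continuous.tendsto (by fun_prop) 0).mono_left nhdsWithin_le_nhds
        exact this.eventually_lt_const (by norm_num)
      filter_upwards [hev] with ε hε
      refine ae_of_all _ fun t => ?_
      rw [norm_mul, Complex.norm_real, Real.norm_of_nonneg (weight_nonneg t), weight]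
      calc _ ≤ (√Real.pi)⁻¹ * Real.exp (-t ^ 2) * (K * Real.exp (k * ((a - ε * t) / β) ^ 2)) := by
            gcongr; exact hb _
        _ = (√Real.pi)⁻¹ * K * Real.exp (-t ^ 2 + k * ((a - ε * t) / β) ^ 2) := by
            rw [Real.exp_add]; ring
        _ ≤ (√Real.pi)⁻¹ * K * Real.exp (2 * k * a ^ 2 / β ^ 2 + -(1 / 2) * t ^ 2) := by
            gcongr ?_ * Real.exp ?_
            have e1 : k * ((a - ε * t) / β) ^ 2 ≤ k * ((2 * a ^ 2 + 2 * (ε * t) ^ 2) / β ^ 2) := by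
              rw [div_pow]
              gcongr
              nlinarith [sq_nonneg (a + ε * t)]
            have e2 : k * ((2 * a ^ 2 + 2 * (ε * t) ^ 2) / β ^ 2) =
              2 * k * a ^ 2 / β ^ 2 + 2 * k * ε ^ 2 / β ^ 2 * t ^ 2 := by ring
            nlinarith [sq_nonneg t]
        _ = _ := by rw [Real.exp_add]; ring
    · exact (Continuous.tendsto (f := fun ε : ℝ => (weight t : ℂ) * h ((a - ε * t) / β))
        (by fun_prop) 0).mono_left nhdsWithin_le_nhds
  have h2 : ∫ t, (weight t : ℂ) * h ((a - 0 * t) / β) = h (a / β) := by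
    simp only [zero_mul, sub_zero]
    rw [integral_mul_const, integral_complex_ofReal, integral_weight, Complex.ofReal_one, one_mul]
  rw [h2] at h1
  refine (h1.const_mul _).congr' ?_
  filter_upwards [self_mem_nhdsWithin] with ε hε
  rw [integral_deltaReg_mul hβ hε]

theorem norm_exp_quadratic_le (p q r : ℂ) (y : ℝ) :
    ‖Complex.exp (p * y ^ 2 + q * y + r)‖ ≤
      Real.exp (‖q‖ + ‖r‖) * Real.exp ((‖p‖ + ‖q‖) * y ^ 2) := by
  rw [Complex.norm_exp, ← Real.exp_add, Real.exp_le_exp]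
  have h1 : (p * y ^ 2 + q * y + r).re ≤ ‖p‖ * y ^ 2 + ‖q‖ * |y| + ‖r‖ := by
    refine (Complex.re_le_norm _).trans ((norm_add₃_le).trans ?_)
    simp
  have h2 : |y| ≤ 1 + y ^ 2 := by nlinarith [sq_nonneg (|y| - 1), sq_abs y, abs_nonneg y]
  nlinarith [norm_nonneg q]

/-- The integral over r_i at fixed x_i: a Gaussian in r with quadratic coefficient (t²σ₀₀ +
n)/(2nσ₀₀), done by completing the square. -/
theorem integral_noise_gaussianKernel {σ : Matrix (Fin 2) (Fin 2) ℝ} (hσ : σ.PosDef)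
    (d : Fin 2 → ℝ) {n : ℝ} (hn : 0 < n) (t D rf x : ℝ) (E : ℂ) :
    ∫ r : ℝ, Complex.exp (Complex.I * (D * r) + E - (rf - t * r) ^ 2 / (2 * n)) *
      gaussianKernel σ d x r =
    (√(n / (t ^ 2 * σ 0 0 + n)) : ℝ) * Complex.exp (E - rf ^ 2 / (2 * n) - d 0 ^ 2 / (2 * σ 0 0)
      - σ.det / (2 * σ 0 0) * x ^ 2 - Complex.I * (x * (d 1 - σ 0 1 / σ 0 0 * d 0))
      + (Complex.I * D + t * rf / n + d 0 / σ 0 0 - Complex.I * x * (σ 0 1 / σ 0 0)) ^ 2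
        * (n * σ 0 0 / (2 * (t ^ 2 * σ 0 0 + n)))) := by
  have hv := posDef_pos hσ
  set v := σ 0 0
  have hV : 0 < t ^ 2 * v + n := by positivity
  set a : ℝ := (t ^ 2 * v + n) / (2 * (n * v)) with ha
  have ha0 : 0 < a := by positivity
  set b : ℂ := Complex.I * D + t * rf / n + d 0 / v - Complex.I * x * (σ 0 1 / v) with hb
  have hnC : (n : ℂ) ≠ 0 := by exact_mod_cast hn.ne'
  have hvC : (v : ℂ) ≠ 0 := by exact_mod_cast hv.ne'
  have hVC : (t ^ 2 * v + n : ℂ) ≠ 0 := by exact_mod_cast hV.ne'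
  have h1 : ∀ r : ℝ, Complex.exp (Complex.I * (D * r) + E - (rf - t * r) ^ 2 / (2 * n)) *
      gaussianKernel σ d x r = ((√(2 * Real.pi * v))⁻¹ : ℝ) *
        Complex.exp (E - rf ^ 2 / (2 * n) - d 0 ^ 2 / (2 * v) - σ.det / (2 * v) * x ^ 2
          - Complex.I * (x * (d 1 - σ 0 1 / v * d 0))) * gfun a b r := by
    intro r
    have hexp : ∀ k x y z w : ℂ, x + y = z + w → Complex.exp x * (k * Complex.exp y) =
        k * Complex.exp z * Complex.exp w := by
      intro k x y z w h
      rw [mul_left_comm, mul_assoc, ← Complex.exp_add, ← Complex.exp_add, h]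
    refine hexp _ _ _ _ _ ?_
    change _ + (((-(r - d 0) ^ 2 / (2 * v) - σ.det / (2 * v) * x ^ 2 : ℝ) : ℂ) -
      Complex.I * ((x * (d 1 + σ 0 1 / v * (r - d 0)) : ℝ) : ℂ)) = _
    rw [hb, ha]
    push_cast
    field_simp
    ring
  simp only [h1]
  rw [integral_const_mul, integral_gfun (by simpa using ha0), ← Complex.ofReal_div Real.pi a,
    cpow_half_ofReal (by positivity), mul_mul_mul_comm, ← Complex.ofReal_mul, ← Complex.exp_add]
  congr 2
  · rw [← Real.sqrt_inv, ← Real.sqrt_mul (by positivity), ha]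
    congr 1
    field_simp
  · rw [ha]
    push_cast
    field_simp
    ring

/-- The image of a Gaussian operator under convolution of the position with a Gaussian of variance
`n`, scaling by `t`, and a quadratic modulation. -/
theorem gaussianKernel_noise {σ : Matrix (Fin 2) (Fin 2) ℝ} (hσ : σ.PosDef) (d : Fin 2 → ℝ)
    {n : ℝ} (hn : 0 < n) (t l B₁ B₂ C A xf rf : ℝ) :
    (((√(2 * Real.pi * n))⁻¹ : ℝ) : ℂ) * ((√(n / (t ^ 2 * σ 0 0 + n)) : ℝ) *
      Complex.exp ((Complex.I * (B₁ * xf * rf + C * xf) - A * xf ^ 2)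
        - rf ^ 2 / (2 * n) - d 0 ^ 2 / (2 * σ 0 0)
      - σ.det / (2 * σ 0 0) * (l * xf : ℝ) ^ 2
      - Complex.I * ((l * xf : ℝ) * (d 1 - σ 0 1 / σ 0 0 * d 0))
      + (Complex.I * (B₂ * xf : ℝ) + t * rf / n + d 0 / σ 0 0 -
        Complex.I * (l * xf : ℝ) * (σ 0 1 / σ 0 0)) ^ 2
        * (n * σ 0 0 / (2 * (t ^ 2 * σ 0 0 + n))))) =
    gaussianKernel (!![t, 0; -(B₁ * t + B₂), l] * σ * (!![t, 0; -(B₁ * t + B₂), l]).transpose +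
      !![n, -B₁ * n; -B₁ * n, B₁ ^ 2 * n + 2 * A])
      ((!![t, 0; -(B₁ * t + B₂), l]).mulVec d + ![0, -C]) xf rf := by
  have hv := posDef_pos hσ
  have hs : σ 1 0 = σ 0 1 := by simpa using (hσ.1.apply 0 1)
  have hV : 0 < t ^ 2 * σ 0 0 + n := by positivity
  set S := !![t, 0; -(B₁ * t + B₂), l] * σ * (!![t, 0; -(B₁ * t + B₂), l]).transpose +
      !![n, -B₁ * n; -B₁ * n, B₁ ^ 2 * n + 2 * A] with hS
  set e := (!![t, 0; -(B₁ * t + B₂), l]).mulVec d + ![0, -C] with he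
  have S00 : S 0 0 = t ^ 2 * σ 0 0 + n := by
    rw [hS, Matrix.eta_fin_two σ]; simp [Matrix.vecMul, dotProduct, Fin.sum_univ_two]; ring
  have S01 : S 0 1 = -(B₁ * t + B₂) * t * σ 0 0 + t * l * σ 0 1 - B₁ * n := by
    rw [hS, Matrix.eta_fin_two σ]; simp [Matrix.vecMul, dotProduct, Fin.sum_univ_two]; ring
  have S10 : S 1 0 = S 0 1 := by
    rw [hS, Matrix.eta_fin_two σ]; simp [Matrix.vecMul, dotProduct, Fin.sum_univ_two, hs]; ring
  have S11 : S 1 1 = (B₁ * t + B₂) ^ 2 * σ 0 0 - 2 * (B₁ * t + B₂) * l * σ 0 1 + l ^ 2 * σ 1 1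
      + B₁ ^ 2 * n + 2 * A := by
    rw [hS, Matrix.eta_fin_two σ]; simp [Matrix.vecMul, dotProduct, Fin.sum_univ_two, hs]; ring
  have e0 : e 0 = t * d 0 := by simp [he, dotProduct, Fin.sum_univ_two]
  have e1 : e 1 = -(B₁ * t + B₂) * d 0 + l * d 1 - C := by
    simp [he, dotProduct, Fin.sum_univ_two]; ring
  rw [gaussianKernel, ← mul_assoc, ← Complex.ofReal_mul]
  congr 2
  · rw [← Real.sqrt_inv, ← Real.sqrt_mul (by positivity), ← Real.sqrt_inv, S00]
    congr 1
    field_simp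
  · rw [Matrix.det_fin_two, Matrix.det_fin_two, S10, S00, S01, S11, e0, e1, hs]
    generalize σ 0 0 = v at *
    generalize σ 0 1 = w at *
    generalize σ 1 1 = u at *
    generalize d 0 = d₀ at *
    generalize d 1 = d₁ at *
    have hnC : (n : ℂ) ≠ 0 := by exact_mod_cast hn.ne'
    have hvC : (v : ℂ) ≠ 0 := by exact_mod_cast hv.ne'
    have hVC : (v * t ^ 2 + n : ℂ) ≠ 0 := by rw [mul_comm]; exact_mod_cast hV.ne'
    push_cast
    field_simp
    linear_combination (xf * n * (v * B₂ - w * l) : ℂ) ^ 2 * Complex.I_sq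

/-- A trace-preserving operation of the one-delta form `δ(α x_f - β x_i) exp Σ` maps Gaussian
operators to Gaussian operators, adding noise of variance `1 / (2 e₁)` to the position. -/
theorem exists_noise_kernelI {α β : ℝ} {κ : Coeffs ℝ} (hβ : β ≠ 0) (he1 : 0 < κ.e1)
    (he : κ.e2 ^ 2 / (4 * κ.e1) - κ.e3 = 0) (hd1 : κ.d1 = 0) (hd2 : κ.d2 = 0) :
    ∃ (T N : Matrix (Fin 2) (Fin 2) ℝ) (τ : Fin 2 → ℝ),
      N.transpose = N ∧ N 0 0 = 1 / (2 * κ.e1) ∧ N ≠ 0 ∧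
      ∀ (σ : Matrix (Fin 2) (Fin 2) ℝ) (d : Fin 2 → ℝ), σ.PosDef → ∀ xf rf : ℝ,
        Tendsto (fun ε : ℝ => ∫ xi : ℝ, ∫ ri : ℝ,
            kernelI ((|β| * √(κ.e1 / Real.pi) : ℝ) : ℂ) ![0, α] ![0, β] κ.toComplex
              ε xf rf xi ri * gaussianKernel σ d xi ri)
          (𝓝[>] 0)
          (𝓝 (gaussianKernel (T * σ * T.transpose + N) (T.mulVec d + τ) xf rf)) := by
  obtain ⟨n, hn⟩ : ∃ n, n = 1 / (2 * κ.e1) := ⟨_, rfl⟩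
  obtain ⟨t, ht⟩ : ∃ t, t = -κ.e2 / (2 * κ.e1) := ⟨_, rfl⟩
  obtain ⟨l, hl⟩ : ∃ l, l = α / β := ⟨_, rfl⟩
  have hn0 : 0 < n := by rw [hn]; positivity
  have e1 : κ.e1 = 1 / (2 * n) := by rw [hn]; field_simp
  have e2 : κ.e2 = -t / n := by rw [hn, ht]; field_simp
  have e3 : κ.e3 = t ^ 2 / (2 * n) := by
    rw [← sub_eq_zero.1 he, hn, ht]; field_simp; norm_num
  set B₁ := κ.b1 + κ.b3 * l
  set B₂ := κ.b2 + κ.b4 * l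
  -- Formally q_f = tq + ξ with ξ of variance n, and p_f = lp - B₁q_f - B₂q - C, the terms `a_n`
  -- adding 2A to the momentum variance. Here B₁, B₂, A and C = c₁ + c₂l are the coefficients
  -- restricted to x_i = l x_f.
  refine ⟨!![t, 0; -(B₁ * t + B₂), l], !![n, -B₁ * n; -B₁ * n,
    B₁ ^ 2 * n + 2 * (κ.a1 + κ.a2 * l + κ.a3 * l ^ 2)], ![0, -(κ.c1 + κ.c2 * l)], ?_, ?_, ?_, ?_⟩
  · ext i j; fin_cases i <;> fin_cases j <;> rfl
  · simp [hn]
  · intro h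
    have := congrFun (congrFun h 0) 0
    simp at this
    exact hn0.ne' this
  intro σ d hσ xf rf
  have hv := posDef_pos hσ
  rw [← gaussianKernel_noise hσ d hn0]
  set E : ℝ → ℂ := fun x => Complex.I * (κ.b1 * xf * rf + κ.b3 * x * rf + κ.c1 * xf + κ.c2 * x)
    - κ.a1 * xf ^ 2 - κ.a2 * xf * x - κ.a3 * x ^ 2 with hE
  set P : ℝ → ℂ := fun x => E x - rf ^ 2 / (2 * n) - d 0 ^ 2 / (2 * σ 0 0)
      - σ.det / (2 * σ 0 0) * x ^ 2 - Complex.I * (x * (d 1 - σ 0 1 / σ 0 0 * d 0))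
      + (Complex.I * (κ.b2 * xf + κ.b4 * x : ℝ) + t * rf / n + d 0 / σ 0 0
        - Complex.I * x * (σ 0 1 / σ 0 0)) ^ 2 * (n * σ 0 0 / (2 * (t ^ 2 * σ 0 0 + n))) with hP
  -- The sign of Re p is not controlled, but Gaussian growth is all that the regularised delta
  -- needs.
  obtain ⟨p, q, r, hpqr⟩ : ∃ p q r : ℂ, ∀ x : ℝ, P x = p * x ^ 2 + q * x + r := by
    refine ⟨-κ.a3 - σ.det / (2 * σ 0 0) + (Complex.I * (κ.b4 - σ 0 1 / σ 0 0)) ^ 2 *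
        (n * σ 0 0 / (2 * (t ^ 2 * σ 0 0 + n))),
      Complex.I * (κ.b3 * rf + κ.c2) - κ.a2 * xf - Complex.I * (d 1 - σ 0 1 / σ 0 0 * d 0) +
        2 * (Complex.I * (κ.b4 - σ 0 1 / σ 0 0)) * (Complex.I * (κ.b2 * xf) + t * rf / n +
          d 0 / σ 0 0) * (n * σ 0 0 / (2 * (t ^ 2 * σ 0 0 + n))),
      Complex.I * (κ.b1 * xf * rf + κ.c1 * xf) - κ.a1 * xf ^ 2 - rf ^ 2 / (2 * n)
        - d 0 ^ 2 / (2 * σ 0 0) + (Complex.I * (κ.b2 * xf) + t * rf / n + d 0 / σ 0 0) ^ 2 *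
          (n * σ 0 0 / (2 * (t ^ 2 * σ 0 0 + n))), fun x => ?_⟩
    simp only [hP, hE]
    push_cast
    ring
  set c : ℂ := ((|β| * √(κ.e1 / Real.pi) : ℝ) : ℂ) * (√(n / (t ^ 2 * σ 0 0 + n)) : ℝ) with hc
  have hinner : ∀ ε xi : ℝ, ∫ ri : ℝ,
      kernelI ((|β| * √(κ.e1 / Real.pi) : ℝ) : ℂ) ![0, α] ![0, β] κ.toComplex ε xf rf xi ri *
        gaussianKernel σ d xi ri =
      (deltaReg ε (α * xf - β * xi) : ℂ) * (c * Complex.exp (P xi)) := by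
    intro ε xi
    have h := integral_noise_gaussianKernel hσ d hn0 t (κ.b2 * xf + κ.b4 * xi) rf xi (E xi)
    rw [hc, mul_assoc, ← h, ← integral_const_mul, ← integral_const_mul]
    congr 1; ext ri
    simp only [kernelI, Coeffs.exponent, Coeffs.toComplex, hd1, hd2, e1, e2, e3, hE,
      Matrix.cons_val_zero, Matrix.cons_val_one]
    rw [zero_mul, zero_mul, zero_add, zero_add,
      show ∀ a b c d : ℂ, a * b * c * d = b * (a * (c * d)) by intros; ring]
    congr 4
    push_cast
    field_simp
    ring
  simp only [hinner]
  have hlim := tendsto_integral_deltaReg_mul (h := fun x => c * Complex.exp (P x))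
    (K := ‖c‖ * Real.exp (‖q‖ + ‖r‖)) (k := ‖p‖ + ‖q‖)
    (by simp only [hpqr]; fun_prop) (by positivity)
    (fun y => by
      rw [norm_mul, hpqr, mul_assoc]
      gcongr
      exact norm_exp_quadratic_le p q r y) hβ (α * xf)
  convert hlim using 2
  rw [show α * xf / β = l * xf by rw [hl]; ring, hc, ← mul_assoc, ← mul_assoc, ← mul_assoc,
    ← Complex.ofReal_mul]
  congr 2
  · simp only [← Complex.ofReal_mul]
    rw [← mul_assoc, ← mul_assoc, ← abs_mul, inv_mul_cancel₀ hβ, abs_one, one_mul,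
      ← Real.sqrt_inv, e1]
    congr 3
    field_simp
  · simp only [hP, hE, B₁, B₂]
    push_cast
    ring

/-! ### Size estimates for one-delta kernels. -/

open scoped ENNReal in
/-- The integral of a function along a segment of lines of slope `c`. -/
def shear (c : ℝ) (I : Set ℝ) (A : ℝ → ℝ≥0∞) (u : ℝ) : ℝ≥0∞ := ∫⁻ t in I, A (u + c * t)

section

open scoped ENNReal

theorem shear_le_of_le {c : ℝ} {I : Set ℝ} {A : ℝ → ℝ≥0∞} {s L : ℝ≥0∞} (h : ∀ u, A u ≤ s)
    (hI : volume I ≤ L) (u : ℝ) : shear c I A u ≤ s * L :=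
  calc shear c I A u ≤ ∫⁻ _ in I, s := lintegral_mono fun _ => h _
    _ = s * volume I := by rw [setLIntegral_const]
    _ ≤ s * L := by gcongr

theorem measurable_shear {c : ℝ} {I : Set ℝ} {A : ℝ → ℝ≥0∞} (hA : Measurable A) :
    Measurable (shear c I A) :=
  (hA.comp (f := fun p : ℝ × ℝ => p.1 + c * p.2) (by fun_prop)).lintegral_prod_right'

theorem lintegral_shear_le {c : ℝ} {I : Set ℝ} {A : ℝ → ℝ≥0∞} {m L : ℝ≥0∞} (hA : Measurable A)
    (hm : ∫⁻ u, A u ≤ m) (hI : volume I ≤ L) : ∫⁻ u, shear c I A u ≤ m * L := by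
  unfold shear
  rw [lintegral_lintegral_swap (f := fun u t => A (u + c * t))
    (hA.comp (f := fun p : ℝ × ℝ => p.1 + c * p.2) (by fun_prop)).aemeasurable]
  simp only [lintegral_add_right_eq_self]
  rw [setLIntegral_const]
  gcongr

theorem shear_le_of_lintegral_le {c : ℝ} (hc : c ≠ 0) {I : Set ℝ} {A : ℝ → ℝ≥0∞} {m : ℝ≥0∞}
    (hA : Measurable A) (hm : ∫⁻ u, A u ≤ m) (u : ℝ) :
    shear c I A u ≤ ENNReal.ofReal |c⁻¹| * m :=
  calc shear c I A u ≤ ∫⁻ t, A (u + c * t) := setLIntegral_le_lintegral _ _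
    _ = ∫⁻ t, A (u + t) ∂(Measure.map (c * ·) volume) := by
      rw [lintegral_map (f := fun t => A (u + t)) (hA.comp (by fun_prop)) (by fun_prop)]
    _ = ENNReal.ofReal |c⁻¹| * ∫⁻ t, A (u + t) := by
      rw [Real.map_volume_mul_left hc, lintegral_smul_measure, smul_eq_mul]
    _ ≤ _ := by rw [lintegral_add_left_eq_self]; gcongr

/-- The integration with nonzero slope uses up the total mass of A at cost 1/|c|. Those inside it
multiply the mass by at most L, those outside it the supremum by at most L. So three factors L
remain whichever slope is nonzero. -/
theorem exists_shear_bound {c₁ c₂ c₃ c₄ : ℝ} (hc : c₁ ≠ 0 ∨ c₂ ≠ 0 ∨ c₃ ≠ 0 ∨ c₄ ≠ 0) :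
    ∃ C : ℝ, 0 ≤ C ∧ ∀ (A : ℝ → ℝ≥0∞) (m L : ℝ≥0∞) (I₁ I₂ I₃ I₄ : Set ℝ), Measurable A →
      ∫⁻ u, A u ≤ m → volume I₁ ≤ L → volume I₂ ≤ L → volume I₃ ≤ L → volume I₄ ≤ L → ∀ u,
        shear c₁ I₁ (shear c₂ I₂ (shear c₃ I₃ (shear c₄ I₄ A))) u ≤
          ENNReal.ofReal C * m * L ^ 3 := by
  rcases hc with h | h | h | h
  · refine ⟨|c₁⁻¹|, abs_nonneg _, fun A m L I₁ I₂ I₃ I₄ hA hm h₁ h₂ h₃ h₄ u => ?_⟩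
    refine (shear_le_of_lintegral_le h (measurable_shear (measurable_shear (measurable_shear hA)))
      (lintegral_shear_le (measurable_shear (measurable_shear hA)) (lintegral_shear_le
        (measurable_shear hA) (lintegral_shear_le hA hm h₄) h₃) h₂) u).trans_eq ?_
    ring
  · refine ⟨|c₂⁻¹|, abs_nonneg _, fun A m L I₁ I₂ I₃ I₄ hA hm h₁ h₂ h₃ h₄ u => ?_⟩
    refine (shear_le_of_le (shear_le_of_lintegral_le h (measurable_shear (measurable_shear hA))
      (lintegral_shear_le (measurable_shear hA) (lintegral_shear_le hA hm h₄) h₃)) h₁ u).trans_eq ?_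
    ring
  · refine ⟨|c₃⁻¹|, abs_nonneg _, fun A m L I₁ I₂ I₃ I₄ hA hm h₁ h₂ h₃ h₄ u => ?_⟩
    refine (shear_le_of_le (shear_le_of_le (shear_le_of_lintegral_le h (measurable_shear hA)
      (lintegral_shear_le hA hm h₄)) h₂) h₁ u).trans_eq ?_
    ring
  · refine ⟨|c₄⁻¹|, abs_nonneg _, fun A m L I₁ I₂ I₃ I₄ hA hm h₁ h₂ h₃ h₄ u => ?_⟩
    refine (shear_le_of_le (shear_le_of_le (shear_le_of_le
      (shear_le_of_lintegral_le h hA hm) h₃) h₂) h₁ u).trans_eq ?_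
    ring

theorem enorm_integral_le_setLIntegral {f : ℝ → ℂ} {I : Set ℝ} {A : ℝ → ℝ≥0∞}
    (h0 : ∀ t ∉ I, f t = 0) (h : ∀ t, ‖f t‖ₑ ≤ A t) : ‖∫ t, f t‖ₑ ≤ ∫⁻ t in I, A t := by
  rw [← setIntegral_eq_integral_of_forall_compl_eq_zero h0]
  exact (enorm_integral_le_lintegral_enorm _).trans (lintegral_mono fun t => h t)

theorem enorm_iterated_integral_le {F : ℝ → ℝ → ℝ → ℝ → ℂ} {I₁ I₂ I₃ I₄ : Set ℝ}
    {A : ℝ → ℝ≥0∞} {c₁ c₂ c₃ c₄ : ℝ}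
    (h0 : ∀ a b c d, F a b c d ≠ 0 → a ∈ I₁ ∧ b ∈ I₂ ∧ c ∈ I₃ ∧ d ∈ I₄)
    (h : ∀ a b c d, ‖F a b c d‖ₑ ≤ A (0 + c₁ * a + c₂ * b + c₃ * c + c₄ * d)) :
    ‖∫ a, ∫ b, ∫ c, ∫ d, F a b c d‖ₑ ≤
      shear c₁ I₁ (shear c₂ I₂ (shear c₃ I₃ (shear c₄ I₄ A))) 0 := by
  have h0' : ∀ a b c d, ¬ (a ∈ I₁ ∧ b ∈ I₂ ∧ c ∈ I₃ ∧ d ∈ I₄) → F a b c d = 0 :=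
    fun a b c d hn => by_contra fun hh => hn (h0 a b c d hh)
  refine enorm_integral_le_setLIntegral (fun a ha => ?_) fun a =>
    enorm_integral_le_setLIntegral (fun b hb => ?_) fun b =>
    enorm_integral_le_setLIntegral (fun c hc => ?_) fun c =>
    enorm_integral_le_setLIntegral (fun d hd => ?_) fun d => h a b c d
  · simp [h0' a _ _ _ fun hh => ha hh.1]
  · simp [h0' a b _ _ fun hh => hb hh.2.1]
  · simp [h0' a b c _ fun hh => hc hh.2.2.1]
  · exact h0' a b c d fun hh => hd hh.2.2.2

theorem measurable_deltaReg (ε : ℝ) : Measurable (deltaReg ε) := by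
  have : Continuous (deltaReg ε) := by unfold deltaReg; fun_prop
  exact this.measurable

theorem deltaReg_nonneg {ε : ℝ} (hε : 0 < ε) (t : ℝ) : 0 ≤ deltaReg ε t := by
  unfold deltaReg; positivity

theorem lintegral_deltaReg {ε : ℝ} (hε : 0 < ε) : ∫⁻ t, ENNReal.ofReal (deltaReg ε t) = 1 := by
  have e : ∀ t, deltaReg ε t = (ε * √Real.pi)⁻¹ * Real.exp (-(ε ^ 2)⁻¹ * t ^ 2) := by
    intro t; simp only [deltaReg]; congr 2; field_simp
  have hi : Integrable (deltaReg ε) := by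
    rw [funext e]; exact (integrable_exp_neg_mul_sq (by positivity)).const_mul _
  rw [← ofReal_integral_eq_lintegral_ofReal hi (ae_of_all _ (deltaReg_nonneg hε)), funext e,
    integral_const_mul, integral_gaussian, div_inv_eq_mul, Real.sqrt_mul Real.pi_pos.le,
    Real.sqrt_sq hε.le, mul_comm ε, inv_mul_cancel₀ (by positivity), ENNReal.ofReal_one]

/-- From exp(-y) ≤ 1/y with y = (t/ε)²: away from 0 the regularised delta is O(ε). -/
theorem deltaReg_le {ε δ t : ℝ} (hε : 0 < ε) (hδ : 0 < δ) (ht : δ ≤ |t|) :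
    deltaReg ε t ≤ ε / (√Real.pi * δ ^ 2) := by
  have h1 : Real.exp (-(t / ε) ^ 2) ≤ (ε / δ) ^ 2 := by
    rw [Real.exp_neg, ← inv_inv ((ε / δ) ^ 2)]
    have h2 : ((ε / δ) ^ 2)⁻¹ ≤ (t / ε) ^ 2 := by
      rw [← inv_pow, inv_div, ← sq_abs (t / ε), abs_div, abs_of_pos hε]
      gcongr
    have h3 := Real.add_one_le_exp ((t / ε) ^ 2)
    gcongr
    linarith
  calc deltaReg ε t ≤ (ε * √Real.pi)⁻¹ * (ε / δ) ^ 2 := by unfold deltaReg; gcongr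
    _ = _ := by field_simp

end

/-- The pairing of a superoperator kernel with four functions. -/
def pairing (J : ℝ → ℝ → ℝ → ℝ → ℂ) (f₁ f₂ g₁ g₂ : ℝ → ℂ) : ℂ :=
  ∫ xf : ℝ, ∫ rf : ℝ, ∫ xi : ℝ, ∫ ri : ℝ,
    J xf rf xi ri * (f₁ (ri - xi / 2) * conj (f₂ (ri + xi / 2))) *
      (conj (g₁ (rf - xf / 2)) * g₂ (rf + xf / 2))

/-- The essential point is the order of quantifiers: C depends only on α and β, so the bound scales
as L³ when the supports shrink, uniformly in ε. -/
theorem exists_norm_pairing_kernelI_le {α β : Fin 2 → ℝ} (h : α ≠ 0 ∨ β ≠ 0) :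
    ∃ C : ℝ, 0 ≤ C ∧ ∀ (𝒩 : ℂ) (κ : Coeffs ℂ) (M L : ℝ) (I₁ I₂ I₃ I₄ : Set ℝ)
      (f₁ f₂ g₁ g₂ : ℝ → ℂ), 0 ≤ M → 0 ≤ L →
      (∀ xf rf xi ri, testProd f₁ f₂ g₁ g₂ xf rf xi ri ≠ 0 →
        xf ∈ I₁ ∧ rf ∈ I₂ ∧ xi ∈ I₃ ∧ ri ∈ I₄) →
      (∀ xf rf xi ri,
        ‖Complex.exp (κ.exponent xf rf xi ri) * testProd f₁ f₂ g₁ g₂ xf rf xi ri‖ ≤ M) →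
      volume I₁ ≤ ENNReal.ofReal L → volume I₂ ≤ ENNReal.ofReal L →
      volume I₃ ≤ ENNReal.ofReal L → volume I₄ ≤ ENNReal.ofReal L →
      ∀ ε : ℝ, 0 < ε → ‖pairing (kernelI 𝒩 α β κ ε) f₁ f₂ g₁ g₂‖ ≤ C * (‖𝒩‖ * M) * L ^ 3 := by
  have hc : α 1 ≠ 0 ∨ α 0 ≠ 0 ∨ -β 1 ≠ 0 ∨ -β 0 ≠ 0 := by
    by_contra! hh
    rcases h with h | h <;> refine h (funext fun i => ?_) <;> fin_cases i <;> simp_all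
  obtain ⟨C, hC, hb⟩ := exists_shear_bound hc
  refine ⟨C, hC, fun 𝒩 κ M L I₁ I₂ I₃ I₄ f₁ f₂ g₁ g₂ hM hL hs hn h₁ h₂ h₃ h₄ ε hε => ?_⟩
  set A : ℝ → ENNReal := fun u => ENNReal.ofReal (‖𝒩‖ * M) * ENNReal.ofReal (deltaReg ε u) with hA
  have hAm : Measurable A := ((measurable_deltaReg ε).ennreal_ofReal).const_mul _
  have hAi : ∫⁻ u, A u ≤ ENNReal.ofReal (‖𝒩‖ * M) := by
    rw [hA, lintegral_const_mul _ (measurable_deltaReg ε).ennreal_ofReal, lintegral_deltaReg hε,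
      mul_one]
  have hF : ∀ xf rf xi ri, kernelI 𝒩 α β κ ε xf rf xi ri *
      (f₁ (ri - xi / 2) * conj (f₂ (ri + xi / 2))) * (conj (g₁ (rf - xf / 2)) * g₂ (rf + xf / 2)) =
      𝒩 * (deltaReg ε (0 + α 1 * xf + α 0 * rf + -β 1 * xi + -β 0 * ri) : ℂ) *
        (Complex.exp (κ.exponent xf rf xi ri) * testProd f₁ f₂ g₁ g₂ xf rf xi ri) := by
    intro xf rf xi ri
    rw [kernelI, testProd, show α 0 * rf + α 1 * xf - (β 0 * ri + β 1 * xi) =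
      0 + α 1 * xf + α 0 * rf + -β 1 * xi + -β 0 * ri by ring]
    ring
  have key : ‖pairing (kernelI 𝒩 α β κ ε) f₁ f₂ g₁ g₂‖ₑ ≤
      ENNReal.ofReal C * ENNReal.ofReal (‖𝒩‖ * M) * ENNReal.ofReal L ^ 3 := by
    refine (enorm_iterated_integral_le (A := A) (c₁ := α 1) (c₂ := α 0) (c₃ := -β 1) (c₄ := -β 0)
      (I₁ := I₁) (I₂ := I₂) (I₃ := I₃) (I₄ := I₄) ?_ ?_).trans
      (hb A _ _ I₁ I₂ I₃ I₄ hAm hAi h₁ h₂ h₃ h₄ 0)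
    · intro a b c d hne
      refine hs a b c d fun h0 => hne ?_
      rw [hF, h0, mul_zero, mul_zero]
    · intro a b c d
      simp only [hA]
      rw [hF, ← ofReal_norm, ← ENNReal.ofReal_mul (by positivity)]
      refine ENNReal.ofReal_le_ofReal ?_
      rw [norm_mul, norm_mul, Complex.norm_real, Real.norm_of_nonneg (deltaReg_nonneg hε _),
        mul_right_comm]
      have := deltaReg_nonneg hε (0 + α 1 * a + α 0 * b + -β 1 * c + -β 0 * d)
      gcongr
      exact hn a b c d
  rw [← ofReal_norm, ← ENNReal.ofReal_pow hL, ← ENNReal.ofReal_mul hC,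
    ← ENNReal.ofReal_mul (by positivity)] at key
  exact (ENNReal.ofReal_le_ofReal_iff (by positivity)).1 key

/-! ### Affine substitutions do not have a one-delta kernel. -/

/-- A bump of width `k` around `s` with a quadratic phase. -/
def wavePacket (b : ContDiffBump (0 : ℝ)) (p₁ p₂ s k : ℝ) (y : ℝ) : ℂ :=
  Complex.exp (Complex.I * (p₁ * y ^ 2 + p₂ * y : ℝ)) * (b ((y - s) / k) : ℝ)

theorem norm_wavePacket_le (b : ContDiffBump (0 : ℝ)) (p₁ p₂ s k y : ℝ) :
    ‖wavePacket b p₁ p₂ s k y‖ ≤ 1 := by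
  rw [wavePacket, norm_mul, mul_comm Complex.I, Complex.norm_exp_ofReal_mul_I, one_mul,
    Complex.norm_real, Real.norm_of_nonneg b.nonneg]
  exact b.le_one

theorem abs_sub_le_of_wavePacket_ne_zero {b : ContDiffBump (0 : ℝ)} {p₁ p₂ s k y : ℝ}
    (hk : k ≠ 0) (h : wavePacket b p₁ p₂ s k y ≠ 0) : |y - s| ≤ b.rOut * |k| := by
  have h1 : (y - s) / k ∈ Function.support b := by
    intro h0; exact h (by rw [wavePacket, h0]; simp)
  rw [b.support_eq, mem_ball_zero_iff, Real.norm_eq_abs, abs_div,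
    div_lt_iff₀ (abs_pos.2 hk)] at h1
  exact h1.le

theorem isTest_wavePacket (b : ContDiffBump (0 : ℝ)) (p₁ p₂ s : ℝ) {k : ℝ} (hk : k ≠ 0) :
    IsTest (wavePacket b p₁ p₂ s k) := by
  constructor
  · have h1 : ContDiff ℝ ∞ fun y : ℝ => ((b ((y - s) / k) : ℝ) : ℂ) :=
      Complex.ofRealCLM.contDiff.comp (b.contDiff.comp (by fun_prop))
    have h2 : ContDiff ℝ ∞ fun y : ℝ => Complex.exp (Complex.I * (p₁ * y ^ 2 + p₂ * y : ℝ)) := by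
      have h3 : ContDiff ℝ ∞ fun y : ℝ => ((p₁ * y ^ 2 + p₂ * y : ℝ) : ℂ) :=
        Complex.ofRealCLM.contDiff.comp (f := fun y : ℝ => p₁ * y ^ 2 + p₂ * y) (by fun_prop)
      exact (contDiff_const.mul h3).cexp
    exact h2.mul h1
  · refine HasCompactSupport.of_support_subset_isCompact
      (isCompact_closedBall s (b.rOut * |k|)) fun y hy => ?_
    rw [Metric.mem_closedBall, Real.dist_eq]
    exact abs_sub_le_of_wavePacket_ne_zero hk hy

/-- The packets are matched: the substitution turns the bump of width lr at s into that of width r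
at 0, and the phases cancel, so the overlap is exactly proportional to r. -/
theorem inner_wavePacket_affineU (b : ContDiffBump (0 : ℝ)) (p₁ p₂ s : ℝ) {l r : ℝ} (hl : l ≠ 0)
    (hr : 0 < r) (hlr : l * r ≠ 0) :
    ⟪(isTest_wavePacket b p₁ p₂ 0 hr.ne').toL2,
      affineU p₁ p₂ hl s (isTest_wavePacket b 0 0 s hlr).toL2⟫_ℂ =
      ((√|l| * (r * ∫ t, b t ^ 2) : ℝ) : ℂ) := by
  refine (inner_eq_integral_of_ae (IsTest.coeFn_toL2 _)
    (coeFn_wcomp_of_ae (continuous_quad p₁ p₂) hl s (IsTest.coeFn_toL2 _))).trans ?_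
  have h1 : ∀ q : ℝ, conj (wavePacket b p₁ p₂ 0 r q) *
      wfun (fun q => p₁ * q ^ 2 + p₂ * q) l s (wavePacket b 0 0 s (l * r)) q =
      ((√|l| * b (q / r) ^ 2 : ℝ) : ℂ) := by
    intro q
    simp only [wavePacket, wfun, map_mul, ← Complex.exp_conj, Complex.conj_I, Complex.conj_ofReal]
    rw [show (l * q + s - s) / (l * r) = q / r by field_simp; ring, sub_zero,
      show ∀ a b c d e : ℂ, a * b * (c * d * (e * b)) = (a * d) * (c * e * b ^ 2) by intros; ring,
      ← Complex.exp_add, neg_mul, neg_add_cancel, Complex.exp_zero]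
    simp
  simp only [h1]
  rw [integral_complex_ofReal, integral_const_mul, Measure.integral_comp_div (fun t => b t ^ 2),
    abs_of_pos hr, smul_eq_mul]

/-- Two matched overlaps have product of order r², against the r³ of
`exists_norm_pairing_kernelI_le`; small r gives the contradiction. -/
theorem not_hasKernel_affineU_kernelI {p₁ p₂ l s : ℝ} (hl : l ≠ 0) {𝒩 : ℂ} {α β : Fin 2 → ℝ}
    {κ : Coeffs ℂ} (h : α ≠ 0 ∨ β ≠ 0) :
    ¬ HasKernel (affineU p₁ p₂ hl s) (kernelI 𝒩 α β κ) := by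
  intro hk
  obtain ⟨C, hC, hb⟩ := exists_norm_pairing_kernelI_le h
  let b : ContDiffBump (0 : ℝ) := ⟨1, 2, one_pos, one_lt_two⟩
  set K := ∫ t, b t ^ 2 with hK
  have hK0 : 0 < K := by
    have hc : Continuous fun t => b t ^ 2 := b.continuous.pow 2
    refine hc.integral_pos_of_hasCompactSupport_nonneg_nonzero ?_ (fun t => sq_nonneg _)
      (x := 0) ?_
    · exact b.hasCompactSupport.comp_left (g := fun x : ℝ => x ^ 2) (by simp)
    · have : b 0 = 1 := b.one_of_mem_closedBall (by simp [b.rIn_pos.le])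
      simp [this]
  have hcomp : IsCompact ((Set.Icc (-4 : ℝ) 4) ×ˢ (Set.Icc (-2 : ℝ) 2) ×ˢ
      (Set.Icc (-(4 * |l|)) (4 * |l|)) ×ˢ (Set.Icc (s - 2 * |l|) (s + 2 * |l|))) :=
    isCompact_Icc.prod (isCompact_Icc.prod (isCompact_Icc.prod isCompact_Icc))
  -- This compact box contains the supports for every r ≤ 1, so M does not depend on r.
  obtain ⟨M, hM⟩ := hcomp.exists_bound_of_continuousOn ((continuous_exponent κ).cexp).continuousOn
  have hM0 : 0 ≤ M := (norm_nonneg _).trans (hM (0, 0, 0, s) (by simp))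
  have hle : ∀ r : ℝ, 0 < r → r ≤ 1 →
      |l| * K ^ 2 ≤ C * (‖𝒩‖ * M) * (8 * (1 + |l|)) ^ 3 * r := by
    intro r hr hr1
    have hlr : l * r ≠ 0 := mul_ne_zero hl hr.ne'
    set f := wavePacket b 0 0 s (l * r) with hf
    set g := wavePacket b p₁ p₂ 0 r with hg
    have hsupp : ∀ xf rf xi ri : ℝ, testProd f f g g xf rf xi ri ≠ 0 →
        xf ∈ Set.Icc (-(4 * r)) (4 * r) ∧ rf ∈ Set.Icc (-(2 * r)) (2 * r) ∧
        xi ∈ Set.Icc (-(4 * (|l| * r))) (4 * (|l| * r)) ∧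
        ri ∈ Set.Icc (s - 2 * (|l| * r)) (s + 2 * (|l| * r)) := by
      intro xf rf xi ri hne
      simp only [testProd, mul_ne_zero_iff, map_ne_zero] at hne
      have k1 := abs_sub_le_of_wavePacket_ne_zero hlr hne.1.1
      have k2 := abs_sub_le_of_wavePacket_ne_zero hlr hne.1.2
      have k3 := abs_sub_le_of_wavePacket_ne_zero hr.ne' hne.2.1
      have k4 := abs_sub_le_of_wavePacket_ne_zero hr.ne' hne.2.2
      rw [abs_mul, abs_of_pos hr] at k1 k2
      rw [abs_of_pos hr] at k3 k4
      change _ ≤ 2 * _ at k1 k2 k3 k4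
      rw [abs_le] at k1 k2 k3 k4
      simp only [Set.mem_Icc]
      refine ⟨⟨?_, ?_⟩, ⟨?_, ?_⟩, ⟨?_, ?_⟩, ⟨?_, ?_⟩⟩ <;> linarith
    have hn : ∀ xf rf xi ri : ℝ,
        ‖Complex.exp (κ.exponent xf rf xi ri) * testProd f f g g xf rf xi ri‖ ≤ M := by
      intro xf rf xi ri
      by_cases h0 : testProd f f g g xf rf xi ri = 0
      · rw [h0, mul_zero, norm_zero]; exact hM0
      · obtain ⟨⟨m1, m1'⟩, ⟨m2, m2'⟩, ⟨m3, m3'⟩, ⟨m4, m4'⟩⟩ := hsupp _ _ _ _ h0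
        have hlr1 : |l| * r ≤ |l| := mul_le_of_le_one_right (abs_nonneg l) hr1
        have hexp := hM (xf, rf, xi, ri) ⟨⟨by linarith, by linarith⟩, ⟨by linarith, by linarith⟩,
          ⟨by linarith, by linarith⟩, ⟨by linarith, by linarith⟩⟩
        have ht : ‖testProd f f g g xf rf xi ri‖ ≤ 1 := by
          simp only [testProd, norm_mul, RCLike.norm_conj]
          refine mul_le_one₀ (mul_le_one₀ ?_ ?_ ?_) ?_ (mul_le_one₀ ?_ ?_ ?_) <;>
            first | positivity | exact norm_wavePacket_le _ _ _ _ _ _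
        rw [norm_mul]
        exact (mul_le_mul hexp ht (norm_nonneg _) hM0).trans_eq (mul_one M)
    have hvol : ∀ a c : ℝ, c - a ≤ 8 * (1 + |l|) * r →
        volume (Set.Icc a c) ≤ ENNReal.ofReal (8 * (1 + |l|) * r) := fun a c hac => by
      rw [Real.volume_Icc]; exact ENNReal.ofReal_le_ofReal hac
    have hl0 := mul_nonneg (abs_nonneg l) hr.le
    have hbound := hb 𝒩 κ M (8 * (1 + |l|) * r) _ _ _ _ f f g g hM0 (by positivity) hsupp hn
      (hvol _ _ (by linarith)) (hvol _ _ (by linarith)) (hvol _ _ (by linarith))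
      (hvol _ _ (by linarith))
    have hlim := hk f f g g (isTest_wavePacket b 0 0 s hlr) (isTest_wavePacket b 0 0 s hlr)
      (isTest_wavePacket b p₁ p₂ 0 hr.ne') (isTest_wavePacket b p₁ p₂ 0 hr.ne')
    rw [← inner_conj_symm (affineU p₁ p₂ hl s _), inner_wavePacket_affineU b p₁ p₂ s hl hr hlr,
      Complex.conj_ofReal, ← Complex.ofReal_mul] at hlim
    have := le_of_tendsto hlim.norm (eventually_mem_nhdsWithin.mono fun ε hε => hbound ε hε)
    rw [Complex.norm_real, Real.norm_of_nonneg (mul_self_nonneg _), ← hK] at this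
    have e1 : √|l| * (r * K) * (√|l| * (r * K)) = |l| * K ^ 2 * r ^ 2 := by
      rw [mul_mul_mul_comm, Real.mul_self_sqrt (abs_nonneg l)]; ring
    rw [e1] at this
    have hr2 : 0 < r ^ 2 := by positivity
    refine le_of_mul_le_mul_right (this.trans_eq ?_) hr2
    ring
  set D := C * (‖𝒩‖ * M) * (8 * (1 + |l|)) ^ 3
  have hD : 0 ≤ D := by positivity
  have hE : 0 < |l| * K ^ 2 := mul_pos (abs_pos.2 hl) (by positivity)
  have h1 := hle (min 1 (|l| * K ^ 2 / (2 * (D + 1)))) (by positivity) (min_le_left _ _)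
  have h2 : D * min 1 (|l| * K ^ 2 / (2 * (D + 1))) ≤ D * (|l| * K ^ 2 / (2 * (D + 1))) :=
    mul_le_mul_of_nonneg_left (min_le_right _ _) hD
  have h3 : D * (|l| * K ^ 2 / (2 * (D + 1))) < |l| * K ^ 2 := by
    rw [← mul_div_assoc, div_lt_iff₀ (by positivity)]
    nlinarith
  linarith

/-! ### Chirped Fourier transforms do not have a one-delta kernel. -/

theorem norm_chirpKer (p₁ p₂ p₃ p₄ l q q' : ℝ) :
    ‖chirpKer p₁ p₂ p₃ p₄ l q q'‖ = √|l| * (√(2 * Real.pi))⁻¹ := by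
  unfold chirpKer
  rw [norm_mul, mul_comm Complex.I, Complex.norm_exp_ofReal_mul_I, mul_one, Complex.norm_real,
    Real.norm_of_nonneg (by positivity)]

/-- A continuous function that is orthogonal to all test functions supported near a point vanishes
there. -/
theorem eq_zero_of_forall_integral_eq_zero {h : ℝ → ℂ} (hc : Continuous h) {z R : ℝ} (hR : 0 < R)
    (h0 : ∀ g : ℝ → ℂ, IsTest g → (∀ q, g q ≠ 0 → |q - z| < R) → ∫ q, g q * h q = 0) :
    h z = 0 := by
  have h1 := Metric.isOpen_ball.ae_eq_zero_of_integral_contDiff_smul_eq_zero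
    (U := Metric.ball z R) (μ := volume) (f := h) (hc.locallyIntegrable.locallyIntegrableOn _)
    fun g hg hgc hgs => by
      have := h0 (fun q => (g q : ℂ)) ⟨Complex.ofRealCLM.contDiff.comp hg,
        hgc.comp_left (g := fun x : ℝ => (x : ℂ)) (by simp)⟩ fun q hq => by
          have := hgs (subset_tsupport g (by simpa using hq))
          rwa [Metric.mem_ball, Real.dist_eq] at this
      simpa using this
  have h2 : Set.EqOn h (fun _ => 0) (Metric.ball z R) :=
    Measure.eqOn_open_of_ae_eq ((ae_restrict_iff' Metric.isOpen_ball.measurableSet).2 h1)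
      Metric.isOpen_ball hc.continuousOn continuousOn_const
  exact h2 (Metric.mem_ball_self hR)

theorem IsTest.conj {f : ℝ → ℂ} (hf : IsTest f) : IsTest fun q => conj (f q) :=
  ⟨Complex.conjCLE.contDiff.comp hf.1, hf.2.comp_left (g := fun x : ℂ => conj x) (by simp)⟩

/-- If all such matrix elements vanished, removing first `g` and then `f` would give a zero of the
kernel at (z, y), but its modulus is a positive constant. -/
theorem exists_inner_chirpU_ne_zero (p₁ p₂ p₃ p₄ : ℝ) {l : ℝ} (hl : l ≠ 0) (y z : ℝ) {R : ℝ}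
    (hR : 0 < R) : ∃ (f g : ℝ → ℂ) (hf : IsTest f) (hg : IsTest g),
      (∀ q, f q ≠ 0 → |q - y| < R) ∧ (∀ q, g q ≠ 0 → |q - z| < R) ∧
      ⟪hg.toL2, chirpU p₁ p₂ p₃ p₄ hl hf.toL2⟫_ℂ ≠ 0 := by
  by_contra! hcon
  set k := chirpKer p₁ p₂ p₃ p₄ l
  have hk1 : ∀ q, Continuous fun q' => k q q' := fun q => by simp only [k, chirpKer]; fun_prop
  have hk2 : ∀ q', Continuous fun q => k q q' := fun q' => by simp only [k, chirpKer]; fun_prop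
  have h1 : ∀ f : ℝ → ℂ, IsTest f → (∀ q, f q ≠ 0 → |q - y| < R) → ∫ q', f q' * k z q' = 0 := by
    intro f hf hfs
    refine eq_zero_of_forall_integral_eq_zero (h := fun q => ∫ q', f q' * k q q') (z := z) ?_ hR ?_
    · have hfc := hf.1.continuous
      refine continuous_of_dominated (bound := fun q' => ‖f q'‖ * (√|l| * (√(2 * Real.pi))⁻¹))
        (fun q => Continuous.aestronglyMeasurable ?_) (fun q => ae_of_all _ fun q' => ?_)
        (hf.integrable.norm.mul_const _) (ae_of_all _ fun q' => ?_)
      · exact hfc.mul (hk1 q)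
      · rw [norm_mul, norm_chirpKer]
      · exact continuous_const.mul (hk2 q')
    · intro g hg hgs
      have := hcon f (fun q => conj (g q)) hf hg.conj hfs (by simpa using hgs)
      rw [inner_eq_integral_of_ae hg.conj.coeFn_toL2 (coeFn_chirpU hf _ _ _ _ hl)] at this
      rw [← this]
      congr 1; ext q
      rw [Complex.conj_conj]
      simp only [mul_comm, k]
  have h2 : k z y = 0 := eq_zero_of_forall_integral_eq_zero
    (hk1 z) hR h1
  have h3 := norm_chirpKer p₁ p₂ p₃ p₄ l z y
  rw [show chirpKer p₁ p₂ p₃ p₄ l z y = 0 from h2, norm_zero] at h3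
  have := abs_pos.2 hl
  have h4 : 0 < √|l| * (√(2 * Real.pi))⁻¹ := by positivity
  linarith

/-- The one-delta kernel vanishes away from the support of the delta. -/
theorem tendsto_pairing_kernelI_zero {𝒩 : ℂ} {α β : Fin 2 → ℝ} {κ : Coeffs ℂ} {f₁ f₂ g₁ g₂ : ℝ → ℂ}
    (hf₁ : IsTest f₁) (hf₂ : IsTest f₂) (hg₁ : IsTest g₁) (hg₂ : IsTest g₂) {δ : ℝ} (hδ : 0 < δ)
    (h : ∀ xf rf xi ri, testProd f₁ f₂ g₁ g₂ xf rf xi ri ≠ 0 →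
      δ ≤ |α 0 * rf + α 1 * xf - (β 0 * ri + β 1 * xi)|) :
    Tendsto (fun ε => pairing (kernelI 𝒩 α β κ ε) f₁ f₂ g₁ g₂) (𝓝[>] 0) (𝓝 0) := by
  obtain ⟨R, hR, hs⟩ := exists_testProd_support hf₁ hf₂ hg₁ hg₂
  obtain ⟨M, R', hM, hb⟩ := exists_bound_exp_testProd hf₁ hf₂ hg₁ hg₂ κ
  have hbM : ∀ xf rf xi ri : ℝ,
      ‖Complex.exp (κ.exponent xf rf xi ri) * testProd f₁ f₂ g₁ g₂ xf rf xi ri‖ ≤ M := by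
    intro xf rf xi ri
    have hi : ∀ x : ℝ, (Set.Icc (-R') R').indicator (1 : ℝ → ℝ) x ≤ 1 := fun x =>
      Set.indicator_le_self' (by simp) x
    have hi0 : ∀ x : ℝ, 0 ≤ (Set.Icc (-R') R').indicator (1 : ℝ → ℝ) x := fun x =>
      Set.indicator_nonneg (by simp) x
    calc _ ≤ _ := hb xf rf xi ri
      _ ≤ M * 1 * 1 := by gcongr <;> first | exact hi _ | exact hi0 _
      _ = M := by ring
  have key : ∀ ε : ℝ, 0 < ε → ‖pairing (kernelI 𝒩 α β κ ε) f₁ f₂ g₁ g₂‖ ≤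
      ‖𝒩‖ * (ε / (√Real.pi * δ ^ 2)) * M * (2 * R) ^ 4 := by
    intro ε hε
    have hv : volume (Set.Icc (-R) R) ≤ ENNReal.ofReal (2 * R) := by
      rw [Real.volume_Icc]; exact ENNReal.ofReal_le_ofReal (by linarith)
    have hsh : ∀ u : ℝ, (fun _ : ℝ => ENNReal.ofReal (‖𝒩‖ * (ε / (√Real.pi * δ ^ 2)) * M)) u ≤
      ENNReal.ofReal (‖𝒩‖ * (ε / (√Real.pi * δ ^ 2)) * M) := fun _ => le_rfl
    have hall : ‖pairing (kernelI 𝒩 α β κ ε) f₁ f₂ g₁ g₂‖ₑ ≤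
        ENNReal.ofReal (‖𝒩‖ * (ε / (√Real.pi * δ ^ 2)) * M * (2 * R) ^ 4) := by
      refine (enorm_iterated_integral_le (c₁ := 0) (c₂ := 0) (c₃ := 0) (c₄ := 0)
        (A := fun _ => ENNReal.ofReal (‖𝒩‖ * (ε / (√Real.pi * δ ^ 2)) * M))
        (I₁ := Set.Icc (-R) R) (I₂ := Set.Icc (-R) R) (I₃ := Set.Icc (-R) R)
        (I₄ := Set.Icc (-R) R) ?_ ?_).trans
        ((shear_le_of_le (shear_le_of_le (shear_le_of_le (shear_le_of_le hsh hv) hv) hv) hv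
          0).trans_eq ?_)
      · intro a b c d hne
        have h0 : testProd f₁ f₂ g₁ g₂ a b c d ≠ 0 := by
          intro h0
          refine hne ?_
          rw [mul_assoc]
          exact mul_eq_zero_of_right _ h0
        simpa only [abs_le, Set.mem_Icc] using hs a b c d h0
      · intro a b c d
        rw [← ofReal_norm]
        refine ENNReal.ofReal_le_ofReal ?_
        rw [mul_assoc, kernelI, mul_assoc, norm_mul, norm_mul, Complex.norm_real,
          Real.norm_of_nonneg (deltaReg_nonneg hε _)]
        by_cases h0 : testProd f₁ f₂ g₁ g₂ a b c d = 0
        · have h0' := h0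
          rw [testProd] at h0'
          rw [h0', mul_zero, norm_zero, mul_zero]
          positivity
        · have := deltaReg_le hε hδ (h a b c d h0)
          gcongr
          exact hbM a b c d
      · rw [← ENNReal.ofReal_mul (by positivity), ← ENNReal.ofReal_mul (by positivity),
          ← ENNReal.ofReal_mul (by positivity), ← ENNReal.ofReal_mul (by positivity)]
        congr 1; ring
    rw [← ofReal_norm] at hall
    exact (ENNReal.ofReal_le_ofReal_iff (by positivity)).1 hall
  refine squeeze_zero_norm' (eventually_mem_nhdsWithin.mono fun ε hε => key ε hε) ?_
  have : Tendsto (fun ε : ℝ => ‖𝒩‖ * (ε / (√Real.pi * δ ^ 2)) * M * (2 * R) ^ 4) (𝓝[>] 0)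
      (𝓝 (‖𝒩‖ * (0 / (√Real.pi * δ ^ 2)) * M * (2 * R) ^ 4)) :=
    (Continuous.tendsto (by fun_prop) 0).mono_left nhdsWithin_le_nhds
  simpa using this

theorem not_hasKernel_chirpU_kernelI {p₁ p₂ p₃ p₄ l : ℝ} (hl : l ≠ 0) {𝒩 : ℂ} {α β : Fin 2 → ℝ}
    {κ : Coeffs ℂ} (h : α ≠ 0 ∨ β ≠ 0) :
    ¬ HasKernel (chirpU p₁ p₂ p₃ p₄ hl) (kernelI 𝒩 α β κ) := by
  intro hk
  -- The argument of the delta in terms of the four positions, final ones first. In these variables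
  -- the supports of the four test functions can be localised independently around a point where ℓ ≠
  -- 0.
  let ℓ : ℝ × ℝ × ℝ × ℝ → ℝ := fun v => α 0 * ((v.1 + v.2.1) / 2) + α 1 * (v.2.1 - v.1) -
    (β 0 * ((v.2.2.1 + v.2.2.2) / 2) + β 1 * (v.2.2.2 - v.2.2.1))
  have hℓ : Continuous ℓ := by fun_prop
  obtain ⟨v, hv⟩ : ∃ v, ℓ v ≠ 0 := by
    by_contra! hh
    have h1 := hh (1, 1, 0, 0)
    have h2 := hh (-1, 1, 0, 0)
    have h3 := hh (0, 0, 1, 1)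
    have h4 := hh (0, 0, -1, 1)
    norm_num [ℓ] at h1 h2 h3 h4
    rcases h with h | h <;> refine h (funext fun i => ?_) <;> fin_cases i <;> simp_all
  obtain ⟨R, hR, hball⟩ := Metric.eventually_nhds_iff.1
    ((hℓ.abs.tendsto v).eventually (lt_mem_nhds (half_lt_self (abs_pos.2 hv))))
  obtain ⟨f₁, g₁, hf₁, hg₁, sf₁, sg₁, n₁⟩ :=
    exists_inner_chirpU_ne_zero p₁ p₂ p₃ p₄ hl v.2.2.1 v.1 hR
  obtain ⟨f₂, g₂, hf₂, hg₂, sf₂, sg₂, n₂⟩ :=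
    exists_inner_chirpU_ne_zero p₁ p₂ p₃ p₄ hl v.2.2.2 v.2.1 hR
  have hzero := tendsto_pairing_kernelI_zero (𝒩 := 𝒩) (α := α) (β := β) (κ := κ) hf₁ hf₂ hg₁ hg₂
    (half_pos (abs_pos.2 hv)) fun xf rf xi ri hne => by
      simp only [testProd, mul_ne_zero_iff, map_ne_zero] at hne
      have hd : dist ((rf - xf / 2, rf + xf / 2, ri - xi / 2, ri + xi / 2) : ℝ × ℝ × ℝ × ℝ) v < R := by
        simp only [Prod.dist_eq, max_lt_iff, Real.dist_eq]
        exact ⟨sg₁ _ hne.2.1, sg₂ _ hne.2.2, sf₁ _ hne.1.1, sf₂ _ hne.1.2⟩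
      have := (hball hd).le
      refine this.trans_eq (congrArg abs ?_)
      simp only [ℓ]
      ring
  have heq := tendsto_nhds_unique (hk f₁ f₂ g₁ g₂ hf₁ hf₂ hg₁ hg₂) hzero
  rw [← inner_conj_symm (chirpU p₁ p₂ p₃ p₄ hl _)] at heq
  exact mul_ne_zero n₁ ((map_ne_zero _).2 n₂) heq

theorem not_hasKernel_kernelI {U : L2 ≃ₗᵢ[ℂ] L2} (hU : IsGaussianUnitary U) {𝒩 : ℂ}
    {α β : Fin 2 → ℝ} {κ : Coeffs ℂ} (h : α ≠ 0 ∨ β ≠ 0) : ¬ HasKernel U (kernelI 𝒩 α β κ) := by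
  rcases affineU_or_chirpU_of_isGaussianUnitary hU with ⟨p₁, p₂, l, s, θ, hl, hθ, hV⟩ |
    ⟨p₁, p₂, p₃, p₄, l, θ, hl, hθ, hV⟩
  · rw [hasKernel_of_phase hθ hV]
    exact not_hasKernel_affineU_kernelI hl h
  · rw [hasKernel_of_phase hθ hV]
    exact not_hasKernel_chirpU_kernelI hl h

end OneMode

end

theorem lemma1 :
    -- every Gaussian unitary has the Gaussian form or the two-delta form
    (∀ U : OneMode.L2 ≃ₗᵢ[ℂ] OneMode.L2, OneMode.IsGaussianUnitary U →
      (∃ κ : OneMode.Coeffs ℝ, κ.a1 = 0 ∧ κ.a2 = 0 ∧ κ.a3 = 0 ∧ κ.b3 ≠ 0 ∧ κ.b2 = κ.b3 ∧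
        OneMode.HasKernel U (OneMode.kernelG κ)) ∨
      (∃ (α β γ η s : ℝ) (κ : OneMode.Coeffs ℝ),
        κ.a1 = 0 ∧ κ.a2 = 0 ∧ κ.a3 = 0 ∧
        κ.e1 = 0 ∧ κ.e2 = 0 ∧ κ.e3 = 0 ∧ κ.d1 = 0 ∧ κ.d2 = 0 ∧
        β ≠ 0 ∧ γ ≠ 0 ∧ α * η = β * γ ∧
        (OneMode.NoPositionDisplacement U → s = 0) ∧
        OneMode.HasKernel U (OneMode.kernelII α β γ η s κ))) ∧
    -- no Gaussian unitary has the one-delta form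
    (∀ U : OneMode.L2 ≃ₗᵢ[ℂ] OneMode.L2, OneMode.IsGaussianUnitary U →
      ∀ (𝒩 : ℂ) (α β : Fin 2 → ℝ) (κ : OneMode.Coeffs ℂ), (α ≠ 0 ∨ β ≠ 0) →
        ¬ OneMode.HasKernel U (OneMode.kernelI 𝒩 α β κ)) ∧
    -- a trace-preserving operation of the one-delta form has noise matrix `N ≠ 0`
    (∀ (α β : ℝ) (κ : OneMode.Coeffs ℝ), β ≠ 0 → 0 < κ.e1 →
      κ.e2 ^ 2 / (4 * κ.e1) - κ.e3 = 0 → κ.d1 = 0 → κ.d2 = 0 →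
      ∃ (T N : Matrix (Fin 2) (Fin 2) ℝ) (τ : Fin 2 → ℝ),
        N.transpose = N ∧ N 0 0 = 1 / (2 * κ.e1) ∧ N ≠ 0 ∧
        ∀ (σ : Matrix (Fin 2) (Fin 2) ℝ) (d : Fin 2 → ℝ), σ.PosDef → ∀ xf rf : ℝ,
          Tendsto
            (fun ε : ℝ => ∫ xi : ℝ, ∫ ri : ℝ,
              OneMode.kernelI ((|β| * √(κ.e1 / Real.pi) : ℝ) : ℂ) ![0, α] ![0, β] κ.toComplex
                ε xf rf xi ri * OneMode.gaussianKernel σ d xi ri)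
            (𝓝[>] 0)
            (𝓝 (OneMode.gaussianKernel (T * σ * T.transpose + N) (T.mulVec d + τ) xf rf))) ∧
    -- the Gaussian form is unitary when `a_n = 0` and `b₂ = b₃`
    (∀ κ : OneMode.Coeffs ℝ, κ.a1 = 0 → κ.a2 = 0 → κ.a3 = 0 → κ.b3 ≠ 0 → κ.b2 = κ.b3 →
      ∃ U : OneMode.L2 ≃ₗᵢ[ℂ] OneMode.L2,
        OneMode.IsGaussianUnitary U ∧ OneMode.HasKernel U (OneMode.kernelG κ)) ∧
    -- the trace-preserving two-delta form is unitary when `a_n = 0` and `α η = β γ`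
    (∀ (α β γ η : ℝ) (κ : OneMode.Coeffs ℝ), β ≠ 0 → γ ≠ 0 →
      κ.e1 * (η / γ) ^ 2 + κ.e2 * (η / γ) + κ.e3 = 0 → κ.d1 * (η / γ) + κ.d2 = 0 →
      κ.a1 = 0 → κ.a2 = 0 → κ.a3 = 0 → α * η = β * γ →
      ∃ U : OneMode.L2 ≃ₗᵢ[ℂ] OneMode.L2,
        OneMode.IsGaussianUnitary U ∧ OneMode.HasKernel U (OneMode.kernelII α β γ η 0 κ)) := by
  exact ⟨fun U hU => OneMode.exists_kernel_of_isGaussianUnitary hU,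
    fun U hU 𝒩 α β κ h => OneMode.not_hasKernel_kernelI hU h,
    fun α β κ hβ he1 he hd1 hd2 => OneMode.exists_noise_kernelI hβ he1 he hd1 hd2,
    fun κ ha1 ha2 ha3 hb hbb => OneMode.exists_isGaussianUnitary_kernelG ha1 ha2 ha3 hb hbb,
    fun α β γ η κ hβ hγ he hd ha1 ha2 ha3 h =>
      OneMode.exists_isGaussianUnitary_kernelII hβ hγ he hd ha1 ha2 ha3 h⟩
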